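/- Let $n\ge 1$ and let $\pi$ be the Schrödinger representation of the Heisenberg group $\mathbb H^n=\mathbb R^n\times\mathbb R^n\times\mathbb R$ on $L^2(\mathbb R^n)$, $\pi(x,u,\tau)\varphi(\xi)=e^{i\tau}e^{i(x\cdot\xi+\frac12 x\cdot u)}\varphi(\xi+u)$. A function $\varphi\in L^2(\mathbb R^n)$ is called an analytic vector for $\pi$ if the map $(x,u,\tau)\mapsto\pi(x,u,\tau)\varphi$ is real analytic from $\mathbb H^n$ into $L^2(\mathbb R^n)$. Let $P_k$ be the orthogonal projection of $L^2(\mathbb R^n)$ onto the eigenspace of the Hermite operator $H=-\Delta+|x|^2$ with eigenvalue $2k+n$, i.e. onto the span of the Hermite functions $\Phi_\alpha$ with $|\alpha|=k$. Let $\varphi_k^{n-1}(z,w)=L_k^{n-1}\big(\tfrac12(z^2+w^2)\big)e^{-\frac14(z^2+w^2)}$, $z,w\in\mathbb C^n$, be the Laguerre functions, where $z^2=\sum_j z_j^2$. For $t>0$ let $V_t^\omega$ be the space of all $\varphi\in L^2(\mathbb R^n)$ such that $$\sum_{k=0}^\infty \|P_k\varphi\|_2^2\,\frac{k!\,(n-1)!}{(k+n-1)!}\,\varphi_k^{n-1}(2iy,2iv)<\infty\quad\text{for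 all } y,v\in\mathbb R^n \text{ with } |y|^2+|v|^2\le t^2 .$$ Put $\Omega_t=\{x+iy\in\mathbb C^n:\ |y|<t\}$, and say that $\varphi$ satisfies $(\ast)_t$ if $\varphi$ agrees almost everywhere on $\mathbb R^n$ with a holomorphic function on $\Omega_t$, again denoted $\varphi$, such that for some constant $C$ $$|\varphi(x+iy)|\le C\,e^{-|x|(t^2-|y|^2)^{1/2}}\qquad\text{for all } x+iy\in\Omega_t .$$ Let $\varphi\in L^2(\mathbb R^n)$. Then: 1. $\varphi$ is an analytic vector for $\pi$ if and only if it satisfies $(\ast)_t$ for some $t>0$. 2. If $t>0$ and $\varphi\in V_t^\omega$, then $\varphi$ extends holomorphically to $\Omega_t$ and this extension satisfies the estimate of $(\ast)_s$ on $\Omega_s$ for every $0<s<t$ (with a constant depending on $s$). 3. Conversely, if $\varphi$ satisfies $(\ast)_t$ for some $t>0$, then $\varphi\in V_s^\omega$ for every $0<s<t$. -/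

import Mathlib

open MeasureTheory

noncomputable section

namespace AnalyticVectors

/-- The real Euclidean space of dimension `n`. -/
abbrev RSpace (n : ℕ) : Type := EuclideanSpace ℝ (Fin n)

/-- The complex Euclidean space of dimension `n`. -/
abbrev CSpace (n : ℕ) : Type := EuclideanSpace ℂ (Fin n)

/-- The Hilbert space of square integrable complex functions (modulo null sets) for Lebesgue
measure. -/
abbrev LTwo (n : ℕ) : Type := Lp ℂ 2 (volume : Measure (RSpace n))

/-! ### The Schrödinger representation and its analytic vectors -/

/-- `ξ ↦ e^{i τ} e^{i (x·ξ + x·u/2)} φ(ξ + u)`. -/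
def schrodingerFun {n : ℕ} (x u : RSpace n) (τ : ℝ) (φ : RSpace n → ℂ) (ξ : RSpace n) : ℂ :=
  Complex.exp (Complex.I * (τ : ℂ)) *
    Complex.exp (Complex.I * ((inner ℝ x ξ + (1 / 2) * inner ℝ x u : ℝ) : ℂ)) * φ (ξ + u)

theorem memLp_schrodingerFun {n : ℕ} (x u : RSpace n) (τ : ℝ) (φ : LTwo n) :
    MemLp (schrodingerFun x u τ φ) 2 (volume : Measure (RSpace n)) := by
  have h1 : MemLp (fun ξ : RSpace n => (φ : RSpace n → ℂ) (ξ + u)) 2 volume :=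
    (Lp.memLp φ).comp_measurePreserving (measurePreserving_add_right volume u)
  refine h1.of_le ?_ (Filter.Eventually.of_forall fun ξ => ?_)
  · refine AEStronglyMeasurable.mul (Continuous.aestronglyMeasurable ?_) h1.1
    fun_prop
  · simp only [schrodingerFun, norm_mul, mul_comm Complex.I, Complex.norm_exp_ofReal_mul_I, one_mul,
      le_refl]

/-- The operator `π(x, u, τ)` of the Schrödinger representation (with parameter `1`) of the
Heisenberg group `ℝⁿ × ℝⁿ × ℝ`. -/
def schrodinger {n : ℕ} (x u : RSpace n) (τ : ℝ) (φ : LTwo n) : LTwo n :=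
  (memLp_schrodingerFun x u τ φ).toLp (schrodingerFun x u τ φ)

/-- `φ` is an analytic vector if its orbit map `(x, u, τ) ↦ π(x, u, τ) φ` is real analytic, as a
map from the Heisenberg group to the Hilbert space. -/
def IsAnalyticVector {n : ℕ} (φ : LTwo n) : Prop :=
  AnalyticOnNhd ℝ (fun g : RSpace n × RSpace n × ℝ => schrodinger g.1 g.2.1 g.2.2 φ) Set.univ

/-! ### Hermite functions and the spectral projections of `H = -Δ + |x|²` -/

/-- The `L²`-normalized Hermite function of one variable,
`h_k(x) = (2^k k! √π)^{-1/2} H_k(x) e^{-x²/2}`, where the physicists' polynomial `H_k` is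
written through Mathlib's (probabilists') polynomials as `H_k(x) = 2^{k/2} He_k(√2 x)`. -/
def hermiteFun (k : ℕ) (x : ℝ) : ℝ :=
  (√((k.factorial : ℝ) * √Real.pi))⁻¹ * Polynomial.aeval (√2 * x) (Polynomial.hermite k) *
    Real.exp (-x ^ 2 / 2)

/-- The Hermite function `Φ_α(x) = ∏ⱼ h_{αⱼ}(xⱼ)`, an eigenfunction of `H` with eigenvalue
`2|α| + n`. -/
def hermiteMulti {n : ℕ} (α : Fin n → ℕ) (x : RSpace n) : ℂ :=
  ∏ j, ((hermiteFun (α j) (x j) : ℝ) : ℂ)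

theorem integrable_polynomial_mul_exp (p : Polynomial ℝ) :
    Integrable (fun x : ℝ => p.eval x * Real.exp (-x ^ 2)) := by
  induction p using Polynomial.induction_on' with
  | add p q hp hq =>
    simp only [Polynomial.eval_add, add_mul]
    exact hp.add hq
  | monomial k a =>
    have h := (integrable_rpow_mul_exp_neg_mul_sq (b := 1) one_pos (s := (k : ℝ))
      (by have : (0 : ℝ) ≤ k := k.cast_nonneg
          linarith)).const_mul a
    refine h.congr (Filter.Eventually.of_forall fun x => ?_)
    simp [Polynomial.eval_monomial, mul_assoc]

theorem continuous_hermiteFun (k : ℕ) : Continuous (hermiteFun k) := by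
  have h : Continuous fun x : ℝ => Polynomial.aeval (√2 * x) (Polynomial.hermite k) :=
    (Polynomial.continuous_aeval _).comp (by fun_prop)
  unfold hermiteFun
  fun_prop

theorem integrable_hermiteFun_sq (k : ℕ) : Integrable (fun x : ℝ => hermiteFun k x ^ 2) := by
  have h := (integrable_polynomial_mul_exp
    ((((Polynomial.hermite k).map (Int.castRingHom ℝ)).comp
      (Polynomial.C (√2) * Polynomial.X)) ^ 2)).const_mul (((√((k.factorial : ℝ) * √Real.pi))⁻¹) ^ 2)
  refine h.congr (Filter.Eventually.of_forall fun x => ?_)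
  have e : Real.exp (-x ^ 2) = Real.exp (-x ^ 2 / 2) ^ 2 := by
    rw [← Real.exp_nat_mul]
    congr 1
    push_cast
    ring
  simp only [hermiteFun, Polynomial.eval_pow, Polynomial.eval_comp, Polynomial.eval_mul,
    Polynomial.eval_C, Polynomial.eval_X, Polynomial.eval_map, Polynomial.aeval_def, e,
    algebraMap_int_eq]
  ring

theorem memLp_hermiteMulti {n : ℕ} (α : Fin n → ℕ) :
    MemLp (hermiteMulti α) 2 (volume : Measure (RSpace n)) := by
  have hc : Continuous (hermiteMulti α) := by
    unfold hermiteMulti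
    refine continuous_finsetProd _ fun j _ => ?_
    exact Complex.continuous_ofReal.comp ((continuous_hermiteFun (α j)).comp (by fun_prop))
  rw [memLp_two_iff_integrable_sq_norm hc.aestronglyMeasurable]
  have h : Integrable (fun x : Fin n → ℝ => ∏ j, hermiteFun (α j) (x j) ^ 2) volume :=
    Integrable.fintype_prod (f := fun j x => hermiteFun (α j) x ^ 2)
      fun j => integrable_hermiteFun_sq (α j)
  have h' := (EuclideanSpace.volume_preserving_symm_measurableEquiv_toLp (Fin n)).integrable_comp_of_integrable h
  refine h'.congr (Filter.Eventually.of_forall fun x => ?_)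
  simp [hermiteMulti, Finset.prod_pow, ← Finset.abs_prod]

/-- `Φ_α` as an element of the Hilbert space. -/
def hermiteVec {n : ℕ} (α : Fin n → ℕ) : LTwo n :=
  (memLp_hermiteMulti α).toLp (hermiteMulti α)

/-- The `k`-th eigenspace of the Hermite operator (eigenvalue `2k + n`), spanned by the `Φ_α`
with `|α| = k`. -/
def hermiteSpace (n k : ℕ) : Submodule ℂ (LTwo n) :=
  Submodule.span ℂ (hermiteVec '' (Finset.piAntidiag (Finset.univ : Finset (Fin n)) k : Set (Fin n → ℕ)))

instance finiteDimensional_hermiteSpace (n k : ℕ) : FiniteDimensional ℂ (hermiteSpace n k) :=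
  FiniteDimensional.span_of_finite ℂ ((Finset.finite_toSet _).image _)

/-- The orthogonal projection `P_k` onto the `k`-th eigenspace of the Hermite operator. -/
def hermiteProj {n : ℕ} (k : ℕ) (φ : LTwo n) : LTwo n :=
  (hermiteSpace n k).starProjection φ

/-! ### Laguerre functions and the spaces `V_t^ω` -/

/-- The Laguerre polynomial `L_k^a(z) = ∑_{j ≤ k} (-1)^j binom(k + a, k - j) z^j / j!`. -/
def laguerre (k a : ℕ) (z : ℂ) : ℂ :=
  ∑ j ∈ Finset.range (k + 1), (-1) ^ j * ((k + a).choose (k - j) : ℂ) * z ^ j / (j.factorial : ℂ)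

/-- The Laguerre function `φ_k^a(z, w) = L_k^a((z² + w²)/2) e^{-(z² + w²)/4}` on `ℂⁿ × ℂⁿ`, where
`z² = ∑ⱼ zⱼ²` (no complex conjugation). -/
def laguerreFun {n : ℕ} (k a : ℕ) (z w : CSpace n) : ℂ :=
  laguerre k a ((1 / 2) * ((∑ j, z j ^ 2) + ∑ j, w j ^ 2)) *
    Complex.exp (-(1 / 4) * ((∑ j, z j ^ 2) + ∑ j, w j ^ 2))

/-- The inclusion of real points into complex ones. -/
def toComplex {n : ℕ} (x : RSpace n) : CSpace n := WithLp.toLp 2 fun j => (x j : ℂ)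

/-- The coordinatewise real part. -/
def rePart {n : ℕ} (z : CSpace n) : RSpace n := WithLp.toLp 2 fun j => (z j).re

/-- The coordinatewise imaginary part. -/
def imPart {n : ℕ} (z : CSpace n) : RSpace n := WithLp.toLp 2 fun j => (z j).im

/-- The space `V_t^ω` of all `φ` for which
`∑_k ‖P_k φ‖² (k! (n-1)! / (k+n-1)!) φ_k^{n-1}(2iy, 2iv)` converges for all `|y|² + |v|² ≤ t²`.
The terms of this series are nonnegative reals. -/
def VOmega (n : ℕ) (t : ℝ) : Set (LTwo n) :=
  {φ | ∀ y v : RSpace n, ‖y‖ ^ 2 + ‖v‖ ^ 2 ≤ t ^ 2 →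
    Summable fun k : ℕ =>
      ((‖hermiteProj k φ‖ ^ 2 * ((k.factorial : ℝ) * ((n - 1).factorial : ℝ) / ((k + n - 1).factorial : ℝ)) : ℝ) : ℂ) *
        laguerreFun k (n - 1) ((2 * Complex.I) • toComplex y) ((2 * Complex.I) • toComplex v)}

/-! ### Holomorphic extension to tubes -/

/-- The tube domain `Ω_t = {x + iy : |y| < t}`. -/
def tube (n : ℕ) (t : ℝ) : Set (CSpace n) := {z | ‖imPart z‖ < t}

/-- `F` is a holomorphic extension of (the class of) `φ` to the tube `Ω_t`. -/
def IsHolomorphicExtension {n : ℕ} (φ : LTwo n) (t : ℝ) (F : CSpace n → ℂ) : Prop :=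
  DifferentiableOn ℂ F (tube n t) ∧
    ∀ᵐ x : RSpace n, (φ : RSpace n → ℂ) x = F (toComplex x)

/-- `|F(x + iy)| ≤ C e^{-|x| (t² - |y|²)^{1/2}}` on `Ω_t`, for some constant `C`. -/
def HasTubeBound {n : ℕ} (t : ℝ) (F : CSpace n → ℂ) : Prop :=
  ∃ C : ℝ, ∀ z ∈ tube n t,
    ‖F z‖ ≤ C * Real.exp (-(‖rePart z‖ * √(t ^ 2 - ‖imPart z‖ ^ 2)))

end AnalyticVectors

end

/-! Everything is compared with the vectors exp(√2 ζ·A)φ, where A is the tuple of annihilation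
operators and ζ ∈ ℂⁿ. These exponentials are complexified Heisenberg translations: the transpose of
π(X, U, 0) at X = -iζ, U = ζ is the exponential of the creation operators. On Hermite functions it
is explicit, namely `creationFun ζ α`, with an absolutely convergent expansion in the Φ_{α+β}
(`hasSum_creationFun`). The proof uses only the dual form, integrals of φ against `creationFun`, so
no unbounded operator has to be constructed.

From bounds to V_s^ω. At the points (2iy, 2iv) the Laguerre functions become sums of positive terms,
so membership is a weighted summability condition (`mem_VOmega_iff`). If the exponentials are
bounded for ‖ζ‖ ≤ t, Cauchy's estimates on polycircles inside that ball bound all the A^β φ. With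
the optimal radii and a crude Stirling bound, a factor (s/t)^{2|β|} with polynomial corrections
remains; summing over β controls the weighted series for s < t (`mem_VOmega_of_bounded`).

There are two sources of such bounds. If φ extends to F with the tube estimate, a contour shift
turns the exponential into F(x + ζ) exp(ζ·x + ζ²/2), which is bounded in L² uniformly over each
smaller ball (`mem_VOmega_of_hasTubeBound`). If φ is an analytic vector, the power series of its
orbit map can be evaluated at a complex point, and the identity theorem recognizes the value as the
same exponential (`exists_mem_VOmega_of_isAnalyticVector`).

From V_t^ω to an extension. The weight is at least of order exp(2t√(2k)), up to polynomial factors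
(`exp_le_mul_hermiteWeight`). A Mehler type bound controls the Hermite functions of level k at
complex points (`sum_norm_hermiteMultiC_sq_le`). Choosing its parameter close to s/√(2k) and
completing a square produces exactly the decay exp(-|x|√(s² - |y|²)), with a summable factor in k
(`exists_norm_hermiteBlock_le`); the sum of the eigenspace components is the extension.

Finally, a function with the tube estimate has a complexified orbit that is pointwise holomorphic
and locally dominated in L², hence holomorphic as an L²-valued map
(`analyticOnNhd_Lp_of_dominated`). -/

open MeasureTheory Metric Set Filter Topology
open scoped BoundedContinuousFunction

/-! ### Vector-valued holomorphic functions of several variables. -/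

section SeveralVariables

variable {E : Type*} [NormedAddCommGroup E] [NormedSpace ℂ E] [CompleteSpace E]

/-- The Cauchy formula on a polydisc for functions that are continuous and separately holomorphic
near the closed polydisc. -/
theorem torusIntegral_prod_sub_inv_smul {N : ℕ} (f : (Fin N → ℂ) → E) (c w : Fin N → ℂ) {r : ℝ}
    (hr : 0 < r) (hc : ContinuousOn f (closedBall c r))
    (hd : ∀ z ∈ closedBall c r, ∀ i, DifferentiableAt ℂ (fun x => f (Function.update z i x)) (z i))
    (hw : w ∈ ball c r) :
    (∯ z in T(c, fun _ => r), (∏ j, (z j - w j)⁻¹) • f z) = (2 * Real.pi * Complex.I) ^ N • f w := by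
  induction N with
  | zero =>
    rw [torusIntegral_dim0]
    simp only [Finset.univ_eq_empty, Finset.prod_empty, one_smul, pow_zero]
    congr 1
    exact Subsingleton.elim _ _
  | succ N ih =>
    have hmem : ∀ θ : Fin (N + 1) → ℝ, torusMap c (fun _ => r) θ ∈ closedBall c r := by
      intro θ
      rw [mem_closedBall, dist_pi_le_iff hr.le]
      intro i
      simp [torusMap, dist_eq_norm, abs_of_pos hr]
    have hw' : ∀ i, dist (w i) (c i) < r := by
      intro i
      exact (dist_pi_lt_iff hr).1 (mem_ball.1 hw) i
    have hne : ∀ θ : Fin (N + 1) → ℝ, ∀ j, torusMap c (fun _ => r) θ j - w j ≠ 0 := by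
      intro θ j h
      have h1 : torusMap c (fun _ => r) θ j = w j := sub_eq_zero.1 h
      have h2 := hw' j
      rw [← h1] at h2
      simp [torusMap, dist_eq_norm, abs_of_pos hr] at h2
    have htc : Continuous (torusMap c (fun _ : Fin (N + 1) => r)) := by
      unfold torusMap
      fun_prop
    have hinteg : TorusIntegrable (fun z => (∏ j, (z j - w j)⁻¹) • f z) c (fun _ => r) := by
      refine ContinuousOn.integrableOn_Icc (Continuous.continuousOn ?_)
      refine Continuous.smul ?_ (hc.comp_continuous htc hmem)
      refine continuous_finsetProd _ fun j _ => ?_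
      exact Continuous.inv₀ (((continuous_apply j).comp htc).sub continuous_const) fun θ => hne θ j
    -- Fubini splits off coordinate 0. The remaining N-fold integral is the induction hypothesis,
    -- and the outer circle integral is the one-variable Cauchy formula.
    rw [torusIntegral_succ hinteg]
    have hcons : ∀ x ∈ closedBall (c 0) r, ∀ y ∈ closedBall (c ∘ Fin.succ) r,
        (Fin.cons x y : Fin (N + 1) → ℂ) ∈ closedBall c r := by
      intro x hx y hy
      rw [mem_closedBall, dist_pi_le_iff hr.le]
      intro i
      refine Fin.cases ?_ (fun i => ?_) i
      · simpa using hx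
      · have := (dist_pi_le_iff hr.le).1 (mem_closedBall.1 hy) i
        simpa using this
    have hwt : w ∘ Fin.succ ∈ ball (c ∘ Fin.succ) r := by
      rw [mem_ball, dist_pi_lt_iff hr]
      intro i
      exact hw' i.succ
    have inner : ∀ x ∈ sphere (c 0) r,
        (∯ y in T(c ∘ Fin.succ, (fun _ : Fin (N + 1) => r) ∘ Fin.succ),
          (∏ j, ((Fin.cons x y : Fin (N + 1) → ℂ) j - w j)⁻¹) • f (Fin.cons x y)) =
        (2 * Real.pi * Complex.I) ^ N • ((x - w 0)⁻¹ • f (Fin.cons x (w ∘ Fin.succ))) := by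
      intro x hx
      have hx' := sphere_subset_closedBall hx
      have := ih (fun y => f (Fin.cons x y)) (c ∘ Fin.succ) (w ∘ Fin.succ)
        (by
          refine hc.comp (Continuous.continuousOn ?_) fun y hy => hcons x hx' y hy
          exact Continuous.finCons (A := fun _ : Fin (N + 1) => ℂ) continuous_const continuous_id)
        (by
          intro y hy i
          have := hd _ (hcons x hx' y hy) i.succ
          simpa [Fin.cons_update] using this)
        hwt
      rw [smul_comm, ← this, ← torusIntegral_smul]
      congr 1
      ext y
      rw [Fin.prod_univ_succ, smul_smul]
      simp
    rw [circleIntegral.integral_congr hr.le (fun x hx => inner x hx)]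
    rw [circleIntegral.integral_smul]
    have hcauchy := Complex.circleIntegral_sub_inv_smul_of_differentiable_on_off_countable
      (f := fun x => f (Fin.cons x (w ∘ Fin.succ))) (s := ∅) countable_empty (w := w 0) (c := c 0)
      (R := r) (mem_ball.2 (hw' 0))
      (by
        refine hc.comp (Continuous.continuousOn ?_) fun x hx => hcons x hx _ (ball_subset_closedBall hwt)
        exact Continuous.finCons (A := fun _ : Fin (N + 1) => ℂ) continuous_id continuous_const)
      (by
        intro x hx
        have := hd _ (hcons x (ball_subset_closedBall hx.1) _ (ball_subset_closedBall hwt)) 0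
        simpa [Fin.update_cons_zero] using this)
    rw [hcauchy, smul_smul, ← pow_succ]
    congr 2
    exact Fin.cons_self_tail w

/-- A continuous separately holomorphic function near a closed polydisc is analytic at the
center. -/
theorem analyticAt_of_separately_differentiable {N : ℕ} (f : (Fin N → ℂ) → E) (c : Fin N → ℂ)
    {r : ℝ} (hr : 0 < r) (hc : ContinuousOn f (closedBall c r))
    (hd : ∀ z ∈ closedBall c r, ∀ i,
      DifferentiableAt ℂ (fun x => f (Function.update z i x)) (z i)) :
    AnalyticAt ℂ f c := by
  set tm := torusMap c (fun _ : Fin N => r) with htm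
  have hmem : ∀ θ : Fin N → ℝ, tm θ ∈ closedBall c r := by
    intro θ
    rw [mem_closedBall, dist_pi_le_iff hr.le]
    intro i
    simp [htm, torusMap, dist_eq_norm, abs_of_pos hr]
  have htc : Continuous tm := by
    rw [htm]; unfold torusMap
    fun_prop
  set G : (Fin N → ℝ) → E :=
    fun θ => (∏ i, (r : ℂ) * Complex.exp (θ i * Complex.I) * Complex.I) • f (tm θ) with hG
  have hGc : Continuous G := by
    refine Continuous.smul (by fun_prop) (hc.comp_continuous htc hmem)
  set S : Set (Fin N → ℝ) := Icc 0 fun _ => 2 * Real.pi with hS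
  have hGi : IntegrableOn G S := hGc.continuousOn.integrableOn_Icc
  have hmul : ∀ u : (Fin N → ℝ) →ᵇ ℂ, IntegrableOn (fun θ => u θ • G θ) S := fun u =>
    (u.continuous.smul hGc).continuousOn.integrableOn_Icc
  -- Integration against f on the torus is a continuous linear functional of the kernel, so
  -- analyticity of f reduces to analyticity of the Cauchy kernel as a map into the Banach algebra
  -- of bounded continuous functions.
  let T : ((Fin N → ℝ) →ᵇ ℂ) →L[ℂ] E :=
    LinearMap.mkContinuous
      { toFun := fun u => ∫ θ in S, u θ • G θ
        map_add' := fun u v => by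
          simp only [BoundedContinuousFunction.coe_add, Pi.add_apply, add_smul]
          exact integral_add (hmul u) (hmul v)
        map_smul' := fun a u => by
          simp only [BoundedContinuousFunction.coe_smul, smul_eq_mul, mul_smul,
            RingHom.id_apply]
          exact integral_smul _ _ }
      (∫ θ in S, ‖G θ‖) fun u => by
        change ‖∫ θ in S, u θ • G θ‖ ≤ _
        rw [← integral_mul_const]
        refine norm_integral_le_of_norm_le (hGi.norm.mul_const _) (Eventually.of_forall fun θ => ?_)
        rw [norm_smul, mul_comm]
        exact mul_le_mul_of_nonneg_left (u.norm_coe_le_norm θ) (norm_nonneg _)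
  have hT : ∀ u, T u = ∫ θ in S, u θ • G θ := fun u => rfl
  -- The kernel at the center. At a nearby z the kernel is the Neumann series b (1 - (z - c) b)⁻¹,
  -- where the inverse is taken in the Banach algebra.
  let b : Fin N → ((Fin N → ℝ) →ᵇ ℂ) := fun j =>
    BoundedContinuousFunction.ofNormedAddCommGroup (fun θ => (tm θ j - c j)⁻¹)
      (by
        refine Continuous.inv₀ (((continuous_apply j).comp htc).sub continuous_const) fun θ h => ?_
        simp [htm, torusMap, hr.ne'] at h)
      r⁻¹ (by
        intro θ
        simp [htm, torusMap, abs_of_pos hr])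
  have hbn : ∀ j, ‖b j‖ ≤ r⁻¹ := fun j =>
    BoundedContinuousFunction.norm_ofNormedAddCommGroup_le _ (inv_nonneg.2 hr.le) _
  have hbv : ∀ j θ, b j θ = (tm θ j - c j)⁻¹ := fun j θ => rfl
  have hsm : ∀ z ∈ ball c r, ∀ j, ‖(z j - c j) • b j‖ < 1 := by
    intro z hz j
    have := (dist_pi_lt_iff hr).1 (mem_ball.1 hz) j
    rw [dist_eq_norm] at this
    rw [norm_smul]
    calc ‖z j - c j‖ * ‖b j‖ ≤ ‖z j - c j‖ * r⁻¹ :=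
          mul_le_mul_of_nonneg_left (hbn j) (norm_nonneg _)
      _ < r * r⁻¹ := by gcongr
      _ = 1 := mul_inv_cancel₀ hr.ne'
  have hev : (fun z : Fin N → ℂ => ((2 * Real.pi * Complex.I) ^ N : ℂ)⁻¹ •
      T (∏ j, b j * Ring.inverse (1 - (z j - c j) • b j))) =ᶠ[𝓝 c] f := by
    filter_upwards [ball_mem_nhds c hr] with z hz
    have h := torusIntegral_prod_sub_inv_smul f c z hr hc hd hz
    have hne : ((2 * Real.pi * Complex.I) ^ N : ℂ) ≠ 0 := by
      simp [Real.pi_ne_zero]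
    rw [inv_smul_eq_iff₀ hne, ← h, hT, torusIntegral]
    congr 1
    ext θ
    rw [hG]
    simp only
    rw [smul_comm]
    congr 2
    rw [BoundedContinuousFunction.coe_prod, Finset.prod_apply]
    refine Finset.prod_congr rfl fun j _ => ?_
    have hu := Ring.mul_inverse_cancel _ (isUnit_one_sub_of_norm_lt_one (hsm z hz j))
    have hu' := congrArg (fun u : (Fin N → ℝ) →ᵇ ℂ => u θ) hu
    simp only [BoundedContinuousFunction.coe_mul, Pi.mul_apply, BoundedContinuousFunction.coe_sub,
      Pi.sub_apply, BoundedContinuousFunction.coe_one, Pi.one_apply,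
      BoundedContinuousFunction.coe_smul, smul_eq_mul] at hu' ⊢
    rw [hbv] at hu' ⊢
    have hne' : tm θ j - c j ≠ 0 := by
      intro h
      simp [htm, torusMap, hr.ne'] at h
    have h1 : (1 - (z j - c j) * (tm θ j - c j)⁻¹) = (tm θ j - z j) * (tm θ j - c j)⁻¹ := by
      field_simp
      ring
    rw [h1] at hu'
    rw [mul_assoc] at hu'
    exact eq_inv_of_mul_eq_one_right hu'
  refine AnalyticAt.congr ?_ hev
  refine AnalyticAt.const_smul ?_
  refine (T.analyticAt _).comp (f := fun z : Fin N → ℂ =>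
    ∏ j, b j * Ring.inverse (1 - (z j - c j) • b j)) ?_
  refine Finset.analyticAt_fun_prod _ fun j _ => ?_
  refine analyticAt_const.mul ?_
  have h2 : AnalyticAt ℂ (fun z : Fin N → ℂ => (z j - c j) • b j) c := by
    have h1 : AnalyticAt ℂ (fun z : Fin N → ℂ => z j - c j) c :=
      ((ContinuousLinearMap.proj (R := ℂ) (φ := fun _ : Fin N => ℂ) j).analyticAt c).sub
        analyticAt_const
    exact AnalyticAt.smul h1 analyticAt_const
  refine AnalyticAt.comp (g := fun x : (Fin N → ℝ) →ᵇ ℂ => Ring.inverse (1 - x)) ?_ h2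
  simpa using analyticAt_inverse_one_sub ℂ ((Fin N → ℝ) →ᵇ ℂ)

theorem differentiableAt_lineMap_of_gateaux {E V : Type*} [NormedAddCommGroup E] [NormedSpace ℂ E]
    [NormedAddCommGroup V] [NormedSpace ℂ V]
    {f : V → E} {z v : V} {a : ℂ}
    (h : DifferentiableAt ℂ (fun l : ℂ => f ((z + a • v) + l • v)) 0) :
    DifferentiableAt ℂ (fun l : ℂ => f (z + l • v)) a := by
  have h2 : DifferentiableAt ℂ (fun l : ℂ => l - a) a := by fun_prop
  have h3 := DifferentiableAt.comp (g := fun l : ℂ => f ((z + a • v) + l • v)) a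
    (by simpa using h) h2
  refine h3.congr_of_eventuallyEq (Eventually.of_forall fun l => ?_)
  simp only [Function.comp]
  congr 1
  module

/-- A locally bounded Gateaux-holomorphic function on an open subset of a finite-dimensional
complex space is analytic. -/
theorem analyticOnNhd_of_gateaux {V : Type*} [NormedAddCommGroup V] [NormedSpace ℂ V]
    [FiniteDimensional ℂ V] {f : V → E} {U : Set V} (hU : IsOpen U)
    (hd : ∀ z ∈ U, ∀ v, DifferentiableAt ℂ (fun l : ℂ => f (z + l • v)) 0)
    (hb : ∀ z ∈ U, ∃ C, ∀ᶠ w in 𝓝 z, ‖f w‖ ≤ C) :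
    AnalyticOnNhd ℂ f U := by
  have hcont : ContinuousOn f U := by
    intro z hz
    refine ContinuousAt.continuousWithinAt ?_
    obtain ⟨C, hC⟩ := hb z hz
    obtain ⟨δ, hδ, hball⟩ := Metric.eventually_nhds_iff_ball.1 (hC.and (hU.mem_nhds hz))
    -- Schwarz's lemma on the complex line through z and w: the line stays in the ball for |l| <
    -- δ/‖w - z‖, and w is the point l = 1. Local boundedness thus upgrades to continuity.
    have key : ∀ w ∈ ball z δ, ‖f w - f z‖ ≤ 2 * C / δ * ‖w - z‖ := by
      intro w hw
      rcases eq_or_ne w z with rfl | hwz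
      · simp
      have hn : 0 < ‖w - z‖ := norm_pos_iff.2 (sub_ne_zero.2 hwz)
      have hin : ∀ l ∈ ball (0 : ℂ) (δ / ‖w - z‖), z + l • (w - z) ∈ ball z δ := by
        intro l hl
        rw [mem_ball_zero_iff, lt_div_iff₀ hn] at hl
        simpa [dist_eq_norm, norm_smul] using hl
      have h1 := Complex.dist_le_div_mul_dist_of_mapsTo_ball
        (f := fun l : ℂ => f (z + l • (w - z))) (c := 0) (R₁ := δ / ‖w - z‖) (R₂ := 2 * C) (z := 1)
        (fun l hl => (differentiableAt_lineMap_of_gateaux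
          (hd _ (hball _ (hin l hl)).2 _)).differentiableWithinAt)
        (by
          intro l hl
          rw [mem_closedBall, dist_eq_norm]
          refine (norm_sub_le _ _).trans ?_
          have h1 := (hball _ (hin l hl)).1
          have h2 := (hball z (mem_ball_self hδ)).1
          simp only [zero_smul, add_zero]
          linarith)
        (by
          rw [mem_ball, dist_eq_norm, sub_zero, norm_one, lt_div_iff₀ hn, one_mul]
          simpa [dist_eq_norm] using hw)
      simp only [one_smul, zero_smul, add_zero, add_sub_cancel, dist_eq_norm, sub_zero,
        norm_one, mul_one] at h1
      refine h1.trans (le_of_eq ?_)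
      field_simp
    rw [ContinuousAt, tendsto_iff_norm_sub_tendsto_zero]
    have hlim : Tendsto (fun w => 2 * C / δ * ‖w - z‖) (𝓝 z) (𝓝 0) := by
      have : Continuous fun w => 2 * C / δ * ‖w - z‖ := by fun_prop
      simpa using this.tendsto z
    refine squeeze_zero' (Eventually.of_forall fun w => norm_nonneg _) ?_ hlim
    filter_upwards [ball_mem_nhds z hδ] with w hw using key w hw
  intro z hz
  let e : V ≃L[ℂ] (Fin (Module.finrank ℂ V) → ℂ) := ContinuousLinearEquiv.ofFinrankEq (by simp)
  have hUe : IsOpen (e.symm ⁻¹' U) := hU.preimage e.symm.continuous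
  obtain ⟨r, hr, hrU⟩ := Metric.nhds_basis_closedBall.mem_iff.1
    (hUe.mem_nhds (show e z ∈ e.symm ⁻¹' U by simpa using hz))
  have h := analyticAt_of_separately_differentiable (f ∘ e.symm) (e z) hr
    (hcont.comp e.symm.continuous.continuousOn hrU)
    (by
      intro w hw i
      have h1 := hd (e.symm w) (hrU hw) (e.symm (Pi.single i 1))
      have h2 : DifferentiableAt ℂ (fun x : ℂ => x - w i) (w i) := by fun_prop
      have h3 := DifferentiableAt.comp (g := fun l : ℂ => f (e.symm w + l • e.symm (Pi.single i 1)))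
        (w i) (by simpa using h1) h2
      refine h3.congr_of_eventuallyEq (Eventually.of_forall fun x => ?_)
      simp only [Function.comp]
      rw [← map_smul, ← map_add]
      congr 2
      ext j
      rcases eq_or_ne j i with rfl | hji
      · simp
      · simp [hji])
  have h4 := h.comp (e.toContinuousLinearMap.analyticAt z)
  refine h4.congr (Eventually.of_forall fun w => ?_)
  simp

end SeveralVariables

/-! ### Holomorphic families dominated in Lᵖ. -/

section DominatedFamilies

variable {X : Type*} [MeasurableSpace X] {μ : Measure X}

/-- Second order Taylor estimate for a bounded holomorphic function on a disc. -/
theorem norm_sub_sub_deriv_le {g : ℂ → ℂ} {r B : ℝ} (hr : 0 < r)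
    (hd : DifferentiableOn ℂ g (ball 0 r)) (hb : ∀ l ∈ ball (0 : ℂ) r, ‖g l‖ ≤ B) {l : ℂ}
    (hl : l ∈ ball (0 : ℂ) r) :
    ‖deriv g 0‖ ≤ 2 * B / r ∧ ‖g l - g 0 - l * deriv g 0‖ ≤ 4 * B / r ^ 2 * ‖l‖ ^ 2 := by
  have h0 : (0 : ℂ) ∈ ball (0 : ℂ) r := mem_ball_self hr
  have hn : ball (0 : ℂ) r ∈ 𝓝 (0 : ℂ) := isOpen_ball.mem_nhds h0
  -- Schwarz's lemma is applied to g and then to its divided difference; each time the bound is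
  -- doubled and divided by r.
  have h1 : ∀ l ∈ ball (0 : ℂ) r, ‖dslope g 0 l‖ ≤ 2 * B / r := fun l hl =>
    Complex.norm_dslope_le_div_of_mapsTo_ball hd (fun w hw => by
      rw [mem_closedBall, dist_eq_norm]
      have := norm_sub_le (g w) (g 0)
      linarith [hb w hw, hb 0 h0]) hl
  have hd1 : DifferentiableOn ℂ (dslope g 0) (ball 0 r) :=
    (Complex.differentiableOn_dslope hn).2 hd
  have h2 : ‖dslope (dslope g 0) 0 l‖ ≤ 2 * (2 * B / r) / r :=
    Complex.norm_dslope_le_div_of_mapsTo_ball hd1 (fun w hw => by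
      rw [mem_closedBall, dist_eq_norm]
      have := norm_sub_le (dslope g 0 w) (dslope g 0 0)
      linarith [h1 w hw, h1 0 h0]) hl
  refine ⟨by simpa using h1 0 h0, ?_⟩
  have e1 := sub_smul_dslope g 0 l
  have e2 := sub_smul_dslope (dslope g 0) 0 l
  simp only [sub_zero, smul_eq_mul, dslope_same] at e1 e2
  have : g l - g 0 - l * deriv g 0 = l ^ 2 * dslope (dslope g 0) 0 l := by
    linear_combination -e1 - l * e2
  rw [this, norm_mul, norm_pow, mul_comm]
  refine (mul_le_mul_of_nonneg_right h2 (by positivity)).trans (le_of_eq ?_)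
  field_simp
  ring

/-- The pointwise Taylor remainder is at most 4 b(x) |l|²/r², with a constant that does not depend
on x. Taking Lᵖ norms therefore gives a quadratic remainder in Lᵖ, and the pointwise derivative
represents the Lᵖ derivative. -/
theorem differentiableAt_Lp_of_dominated {p : ENNReal} [Fact (1 ≤ p)] {G : ℂ → Lp ℂ p μ}
    {g : ℂ → X → ℂ} {b : X → ℝ} {r : ℝ} (hr : 0 < r)
    (hG : ∀ l ∈ ball (0 : ℂ) r, G l =ᵐ[μ] g l)
    (hd : ∀ x, DifferentiableOn ℂ (fun l => g l x) (ball 0 r))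
    (hb : ∀ l ∈ ball (0 : ℂ) r, ∀ x, ‖g l x‖ ≤ b x) (hbm : MemLp b p μ) :
    DifferentiableAt ℂ G 0 := by
  set D : X → ℂ := fun x => deriv (fun l => g l x) 0 with hD
  have h0 : (0 : ℂ) ∈ ball (0 : ℂ) r := mem_ball_self hr
  have hm : ∀ l ∈ ball (0 : ℂ) r, AEStronglyMeasurable (g l) μ := fun l hl =>
    (Lp.aestronglyMeasurable (G l)).congr (hG l hl)
  -- Difference quotients along this sequence show that the derivative is measurable. The shift by 2
  -- keeps the term k = 0 strictly inside the disc.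
  have hseq : ∀ k : ℕ, ((r / (k + 2) : ℝ) : ℂ) ∈ ball (0 : ℂ) r := by
    intro k
    rw [mem_ball_zero_iff, Complex.norm_real, Real.norm_of_nonneg (by positivity)]
    exact div_lt_self hr (by have : (0 : ℝ) ≤ k := k.cast_nonneg; linarith)
  have hDm : AEStronglyMeasurable D μ := by
    refine aestronglyMeasurable_of_tendsto_ae atTop
      (f := fun (k : ℕ) x => (((r / (k + 2) : ℝ) : ℂ))⁻¹ • (g ((r / (k + 2) : ℝ) : ℂ) x - g 0 x))
      (fun k => ((hm _ (hseq k)).sub (hm 0 h0)).const_smul (((r / (k + 2) : ℝ) : ℂ))⁻¹) (Eventually.of_forall fun x => ?_)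
    have hder : HasDerivAt (fun l => g l x) (D x) 0 :=
      ((hd x).differentiableAt (isOpen_ball.mem_nhds h0)).hasDerivAt
    have ht := hasDerivAt_iff_tendsto_slope_zero.1 hder
    have hlim : Tendsto (fun k : ℕ => ((r / (k + 2) : ℝ) : ℂ)) atTop (𝓝[≠] 0) := by
      refine tendsto_nhdsWithin_iff.2 ⟨?_, Eventually.of_forall fun k => ?_⟩
      · have : Tendsto (fun k : ℕ => (r / (k + 2) : ℝ)) atTop (𝓝 0) :=
          tendsto_const_nhds.div_atTop
            (tendsto_natCast_atTop_atTop.atTop_add tendsto_const_nhds)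
        have h2 := (Complex.continuous_ofReal.tendsto 0).comp this
        simpa [Function.comp_def] using h2
      · have : (r / (k + 2) : ℝ) ≠ 0 := by positivity
        simpa only [mem_compl_iff, mem_singleton_iff, Complex.ofReal_eq_zero] using this
    simpa only [Function.comp_def, zero_add] using ht.comp hlim
  have hDmem : MemLp D p μ := by
    refine (hbm.const_mul (2 / r)).of_le hDm (Eventually.of_forall fun x => ?_)
    have h1 := (norm_sub_sub_deriv_le hr (hd x) (fun l hl => hb l hl x) h0).1
    refine h1.trans (le_trans (le_of_eq ?_) (le_abs_self _))
    ring
  refine HasDerivAt.differentiableAt (f' := hDmem.toLp D) ?_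
  rw [hasDerivAt_iff_isLittleO_nhds_zero]
  have hO : (fun h : ℂ => G (0 + h) - G 0 - h • hDmem.toLp D) =O[𝓝 0] fun h : ℂ => h ^ 2 := by
    refine Asymptotics.IsBigO.of_bound (4 / r ^ 2 * ‖hbm.toLp b‖) ?_
    filter_upwards [isOpen_ball.mem_nhds h0] with h hh
    have : ‖G (0 + h) - G 0 - h • hDmem.toLp D‖ ≤ (4 / r ^ 2 * ‖h‖ ^ 2) * ‖hbm.toLp b‖ := by
      refine Lp.norm_le_mul_norm_of_ae_le_mul ?_
      filter_upwards [Lp.coeFn_sub (G (0 + h) - G 0) (h • hDmem.toLp D), Lp.coeFn_sub (G (0 + h)) (G 0),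
        Lp.coeFn_smul h (hDmem.toLp D), hDmem.coeFn_toLp, hbm.coeFn_toLp, hG 0 h0,
        hG (0 + h) (by simpa using hh)] with x e1 e2 e3 e4 e5 e6 e7
      rw [e1, Pi.sub_apply, e2, Pi.sub_apply, e3, Pi.smul_apply, e4, e5, e6, e7, zero_add,
        smul_eq_mul]
      have h1 := (norm_sub_sub_deriv_le hr (hd x) (fun l hl => hb l hl x) hh).2
      refine h1.trans (le_trans (le_of_eq ?_)
        (mul_le_mul_of_nonneg_left (le_abs_self (b x)) (by positivity)))
      ring
    refine this.trans (le_of_eq ?_)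
    rw [norm_pow]
    ring
  refine hO.trans_isLittleO ?_
  simpa using Asymptotics.isLittleO_pow_id (𝕜 := ℂ) (n := 2) one_lt_two

/-- A locally dominated family of functions depending holomorphically on a parameter is
holomorphic as an `Lᵖ`-valued function. -/
theorem analyticOnNhd_Lp_of_dominated {p : ENNReal} [Fact (1 ≤ p)]
    {V : Type*} [NormedAddCommGroup V] [NormedSpace ℂ V] [FiniteDimensional ℂ V] {U : Set V}
    (hU : IsOpen U) {G : V → Lp ℂ p μ} {g : V → X → ℂ} (hG : ∀ z ∈ U, G z =ᵐ[μ] g z)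
    (hd : ∀ x, DifferentiableOn ℂ (fun z => g z x) U)
    (hb : ∀ z ∈ U, ∃ b : X → ℝ, MemLp b p μ ∧ ∀ᶠ w in 𝓝 z, ∀ x, ‖g w x‖ ≤ b x) :
    AnalyticOnNhd ℂ G U := by
  refine analyticOnNhd_of_gateaux hU (fun z hz v => ?_) fun z hz => ?_
  · obtain ⟨b, hbm, hbz⟩ := hb z hz
    have hline : Tendsto (fun l : ℂ => z + l • v) (𝓝 0) (𝓝 z) := by
      have : Continuous fun l : ℂ => z + l • v := by fun_prop
      simpa using this.tendsto 0
    obtain ⟨r, hr, hball⟩ := Metric.eventually_nhds_iff_ball.1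
      (hline.eventually (hbz.and (hU.mem_nhds hz)))
    refine differentiableAt_Lp_of_dominated (g := fun l => g (z + l • v)) hr
      (fun l hl => hG _ (hball l hl).2) (fun x => ?_) (fun l hl => (hball l hl).1) hbm
    refine (hd x).comp (Differentiable.differentiableOn (by fun_prop)) fun l hl => (hball l hl).2
  · obtain ⟨b, hbm, hbz⟩ := hb z hz
    refine ⟨‖hbm.toLp b‖, ?_⟩
    filter_upwards [hbz, hU.mem_nhds hz] with w hw hwU
    refine Lp.norm_le_norm_of_ae_le ?_
    filter_upwards [hG w hwU, hbm.coeFn_toLp] with x e1 e2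
    rw [e1, e2]
    exact (hw x).trans (le_abs_self _)

/-- The case p = 1 of the preceding result, composed with the integral as a continuous linear
functional on L¹. -/
theorem differentiableOn_integral_of_dominated {U : Set ℂ} (hU : IsOpen U) {g : ℂ → X → ℂ}
    (hm : ∀ l ∈ U, AEStronglyMeasurable (g l) μ)
    (hd : ∀ x, DifferentiableOn ℂ (fun l => g l x) U)
    (hb : ∀ l ∈ U, ∃ b : X → ℝ, Integrable b μ ∧ ∀ᶠ w in 𝓝 l, ∀ x, ‖g w x‖ ≤ b x) :
    DifferentiableOn ℂ (fun l => ∫ x, g l x ∂μ) U := by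
  classical
  have hi : ∀ l ∈ U, Integrable (g l) μ := by
    intro l hl
    obtain ⟨b, hbi, hbl⟩ := hb l hl
    exact hbi.mono' (hm l hl) (Eventually.of_forall hbl.self_of_nhds)
  -- The default value 0 is never reached on U, where every `g l` is integrable.
  let G : ℂ → Lp ℂ 1 μ := fun l => if h : Integrable (g l) μ then h.toL1 (g l) else 0
  have hG : ∀ l ∈ U, G l =ᵐ[μ] g l := by
    intro l hl
    simp only [G, dif_pos (hi l hl)]
    exact (hi l hl).coeFn_toL1
  have h := analyticOnNhd_Lp_of_dominated hU hG hd (fun z hz => by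
    obtain ⟨b, hbi, hbl⟩ := hb z hz
    exact ⟨b, memLp_one_iff_integrable.2 hbi, hbl⟩)
  let J : Lp ℂ 1 μ →L[ℂ] ℂ := LinearMap.mkContinuous
    { toFun := fun f => L1.integral f
      map_add' := L1.integral_add
      map_smul' := fun a f => L1.integral_smul a f } 1
    fun f => by simpa using L1.norm_integral_le f
  have h2 : DifferentiableOn ℂ (fun l => J (G l)) U :=
    J.differentiable.comp_differentiableOn h.differentiableOn
  refine h2.congr fun l hl => ?_
  rw [← integral_congr_ae (hG l hl), ← L1.integral_eq_integral]
  rfl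

end DominatedFamilies

namespace AnalyticVectors

/-! ### Hermite functions of one complex variable. -/

section HermiteOneVariable

/-- The Hermite polynomial with complex coefficients. -/
noncomputable def hermitePoly (m : ℕ) : Polynomial ℂ :=
  (Polynomial.hermite m).map (Int.castRingHom ℂ)

theorem eval_hermitePoly (m : ℕ) (z : ℂ) :
    (hermitePoly m).eval z = Polynomial.aeval z (Polynomial.hermite m) := by
  rw [hermitePoly, Polynomial.eval_map, Polynomial.aeval_def, algebraMap_int_eq]

theorem hermitePoly_zero : hermitePoly 0 = 1 := by simp [hermitePoly]

theorem hermitePoly_succ (m : ℕ) :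
    hermitePoly (m + 1) = Polynomial.X * hermitePoly m - Polynomial.derivative (hermitePoly m) := by
  simp [hermitePoly, Polynomial.hermite_succ, Polynomial.derivative_map]

theorem derivative_hermitePoly_succ (m : ℕ) :
    Polynomial.derivative (hermitePoly (m + 1)) = ((m : Polynomial ℂ) + 1) * hermitePoly m := by
  induction m with
  | zero => simp [hermitePoly_succ, hermitePoly_zero]
  | succ m ih =>
    have h : Polynomial.derivative ((m : Polynomial ℂ) + 1) = 0 := by simp
    rw [hermitePoly_succ (m + 1), Polynomial.derivative_sub, Polynomial.derivative_mul, ih,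
      Polynomial.derivative_X, Polynomial.derivative_mul, h, hermitePoly_succ m]
    push_cast
    ring

theorem hermitePoly_succ_succ (m : ℕ) :
    hermitePoly (m + 2) =
      Polynomial.X * hermitePoly (m + 1) - ((m : Polynomial ℂ) + 1) * hermitePoly m := by
  rw [hermitePoly_succ (m + 1), derivative_hermitePoly_succ]

/-- The derivatives of the Gaussian `exp (-y² / 2)` on the complex plane. -/
noncomputable def gaussDeriv (m : ℕ) (y : ℂ) : ℂ :=
  (-1) ^ m * (hermitePoly m).eval y * Complex.exp (-y ^ 2 / 2)

theorem hasDerivAt_gaussDeriv (m : ℕ) (y : ℂ) :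
    HasDerivAt (gaussDeriv m) (gaussDeriv (m + 1) y) y := by
  have h1 : HasDerivAt (fun y : ℂ => -y ^ 2 / 2) (-y) y := by
    have := ((hasDerivAt_pow 2 y).neg).div_const 2
    refine this.congr_deriv ?_
    simp
    ring
  have h2 := (((hermitePoly m).hasDerivAt y).const_mul ((-1 : ℂ) ^ m)).mul h1.cexp
  refine h2.congr_deriv ?_
  rw [gaussDeriv, hermitePoly_succ]
  simp only [Polynomial.eval_sub, Polynomial.eval_mul, Polynomial.eval_X]
  ring

theorem iteratedDeriv_gaussDeriv (m b : ℕ) :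
    iteratedDeriv b (gaussDeriv m) = gaussDeriv (m + b) := by
  induction b with
  | zero => simp
  | succ b ih =>
    rw [iteratedDeriv_succ, ih]
    ext y
    exact (hasDerivAt_gaussDeriv (m + b) y).deriv

/-- Since the derivatives of `gaussDeriv m` are the later `gaussDeriv`, this is the Taylor series of
that entire function about y, evaluated at y - w and multiplied by (-1)^m exp(y²/2). -/
theorem hasSum_hermitePoly (m : ℕ) (y w : ℂ) :
    HasSum (fun b : ℕ => w ^ b / (b.factorial : ℂ) * (hermitePoly (m + b)).eval y)
      ((hermitePoly m).eval (y - w) * Complex.exp (w * y - w ^ 2 / 2)) := by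
  have h := Complex.hasSum_taylorSeries_of_entire
    (fun y => (hasDerivAt_gaussDeriv m y).differentiableAt) y (y - w)
  have h2 := h.mul_left ((-1) ^ m * Complex.exp (y ^ 2 / 2))
  refine Eq.mpr (congrArg₂ (HasSum · ·) (funext fun b => ?_) ?_) h2
  · rw [iteratedDeriv_gaussDeriv, gaussDeriv, smul_eq_mul, smul_eq_mul]
    have e : Complex.exp (y ^ 2 / 2) * Complex.exp (-y ^ 2 / 2) = 1 := by
      rw [← Complex.exp_add]
      ring_nf
      simp
    have e2 : ((-1 : ℂ) ^ m * (-1) ^ (m + b) * (y - w - y) ^ b) = w ^ b := by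
      rw [← pow_add, show y - w - y = (-1) * w by ring, mul_pow, ← mul_assoc, ← pow_add,
        show m + (m + b) + b = 2 * (m + b) by ring, pow_mul]
      simp
    calc w ^ b / (b.factorial : ℂ) * (hermitePoly (m + b)).eval y
        = ((-1 : ℂ) ^ m * (-1) ^ (m + b) * (y - w - y) ^ b) * (b.factorial : ℂ)⁻¹ *
          (hermitePoly (m + b)).eval y *
          (Complex.exp (y ^ 2 / 2) * Complex.exp (-y ^ 2 / 2)) := by rw [e, e2]; ring
      _ = _ := by ring
  · rw [gaussDeriv]
    have e : Complex.exp (w * y - w ^ 2 / 2) =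
        Complex.exp (y ^ 2 / 2) * Complex.exp (-(y - w) ^ 2 / 2) := by
      rw [← Complex.exp_add]
      ring_nf
    have e2 : ((-1 : ℂ) ^ m * (-1) ^ m) = 1 := by
      rw [← mul_pow]; simp
    rw [e]
    linear_combination (-(hermitePoly m).eval (y - w) * Complex.exp (y ^ 2 / 2) *
      Complex.exp (-(y - w) ^ 2 / 2)) * e2

/-- The entire extension of the Hermite function `hermiteFun k`. -/
noncomputable def hermiteFunC (k : ℕ) (z : ℂ) : ℂ :=
  ((√((k.factorial : ℝ) * √Real.pi))⁻¹ : ℝ) * (hermitePoly k).eval ((√2 : ℝ) * z) *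
    Complex.exp (-z ^ 2 / 2)

theorem hermiteFunC_ofReal (k : ℕ) (x : ℝ) : hermiteFunC k x = hermiteFun k x := by
  rw [hermiteFunC, hermiteFun, eval_hermitePoly]
  push_cast
  congr 2
  rw [← Complex.ofReal_mul, Polynomial.aeval_def, Polynomial.aeval_def,
    Polynomial.eval₂_eq_sum_range, Polynomial.eval₂_eq_sum_range]
  push_cast
  rfl

theorem differentiable_hermiteFunC (k : ℕ) : Differentiable ℂ (hermiteFunC k) := by
  unfold hermiteFunC
  have h : Differentiable ℂ fun z : ℂ => (hermitePoly k).eval ((√2 : ℝ) * z) :=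
    (hermitePoly k).differentiable.comp (by fun_prop)
  fun_prop

theorem sqrt_factorial_norm (m b : ℕ) :
    (√((m.factorial : ℝ) * √Real.pi))⁻¹ =
      √(((m + b).factorial : ℝ) / m.factorial) * (√(((m + b).factorial : ℝ) * √Real.pi))⁻¹ := by
  have h1 : (0 : ℝ) < m.factorial := by exact_mod_cast m.factorial_pos
  have h2 : (0 : ℝ) < (m + b).factorial := by exact_mod_cast (m + b).factorial_pos
  rw [Real.sqrt_mul h1.le, Real.sqrt_mul h2.le, Real.sqrt_div h2.le]
  have h3 : 0 < √(m.factorial : ℝ) := Real.sqrt_pos.2 h1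
  have h4 : 0 < √((m + b).factorial : ℝ) := Real.sqrt_pos.2 h2
  have h5 : 0 < √(√Real.pi) := Real.sqrt_pos.2 (Real.sqrt_pos.2 Real.pi_pos)
  field_simp

/-- The previous series at (√2 x, √2 ζ), times a Gaussian and renormalized. In operator terms it is
the exponential of √2 ζ times the creation operator, applied to the m-th Hermite function. -/
theorem hasSum_hermiteFunC (m : ℕ) (x ζ : ℂ) :
    HasSum (fun b : ℕ => ((√2 : ℝ) * ζ) ^ b / (b.factorial : ℂ) *
        (√(((m + b).factorial : ℝ) / m.factorial) : ℝ) * hermiteFunC (m + b) x)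
      (Complex.exp (ζ * x - ζ ^ 2 / 2) * hermiteFunC m (x - ζ)) := by
  have h := (hasSum_hermitePoly m ((√2 : ℝ) * x) ((√2 : ℝ) * ζ)).mul_left
    (((√((m.factorial : ℝ) * √Real.pi))⁻¹ : ℝ) * Complex.exp (-x ^ 2 / 2))
  have h2 : ((√2 : ℝ) : ℂ) ^ 2 = 2 := by
    rw [← Complex.ofReal_pow, Real.sq_sqrt (by norm_num)]; norm_num
  refine Eq.mpr (congrArg₂ (HasSum · ·) (funext fun b => ?_) ?_) h
  · rw [hermiteFunC, sqrt_factorial_norm m b]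
    push_cast
    ring
  · rw [hermiteFunC, ← mul_sub]
    have e : Complex.exp (-x ^ 2 / 2) *
        Complex.exp ((√2 : ℝ) * ζ * ((√2 : ℝ) * x) - ((√2 : ℝ) * ζ) ^ 2 / 2) =
        Complex.exp (ζ * x - ζ ^ 2 / 2) * Complex.exp (-(x - ζ) ^ 2 / 2) := by
      rw [← Complex.exp_add, ← Complex.exp_add]
      congr 1
      linear_combination (ζ * x - ζ ^ 2 / 2) * h2
    linear_combination (-((√((m.factorial : ℝ) * √Real.pi))⁻¹ : ℝ) *
      (hermitePoly m).eval (((√2 : ℝ) : ℂ) * (x - ζ))) * e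

/-! ### Gaussian integrals of Hermite polynomials -/

theorem norm_complexGaussian (s : ℂ) (v y : ℝ) :
    ‖Complex.exp (-((y : ℂ) - s) ^ 2 / (2 * v))‖ =
      Real.exp (-(y - s.re) ^ 2 / (2 * v) + s.im ^ 2 / (2 * v)) := by
  rw [Complex.norm_exp]
  congr 1
  have : -((y : ℂ) - s) ^ 2 / (2 * v) = (-((y : ℂ) - s) ^ 2) / ((2 * v : ℝ) : ℂ) := by push_cast; rfl
  rw [this, Complex.div_ofReal_re]
  simp only [Complex.neg_re, pow_two, Complex.mul_re, Complex.sub_re, Complex.ofReal_re,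
    Complex.sub_im, Complex.ofReal_im]
  ring

theorem integrable_polynomial_mul_complexGaussian (p : Polynomial ℂ) (s : ℂ) {v : ℝ} (hv : 0 < v) :
    Integrable fun y : ℝ => p.eval (y : ℂ) * Complex.exp (-((y : ℂ) - s) ^ 2 / (2 * v)) := by
  induction p using Polynomial.induction_on' with
  | add p q hp hq =>
    simp only [Polynomial.eval_add, add_mul]
    exact hp.add hq
  | monomial k a =>
    have h := (integrable_rpow_mul_exp_neg_mul_sq (b := 1 / (4 * v)) (by positivity) (s := (k : ℝ))
      (by have : (0 : ℝ) ≤ k := k.cast_nonneg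
          linarith)).norm
    refine (h.const_mul (‖a‖ * Real.exp (s.re ^ 2 / (2 * v) + s.im ^ 2 / (2 * v)))).mono'
      (Continuous.aestronglyMeasurable (by fun_prop)) (Eventually.of_forall fun y => ?_)
    rw [norm_mul, norm_complexGaussian, Polynomial.eval_monomial, norm_mul, norm_pow, norm_mul,
      Real.rpow_natCast, norm_pow, Complex.norm_real, Real.norm_of_nonneg (Real.exp_pos _).le]
    have : Real.exp (-(y - s.re) ^ 2 / (2 * v) + s.im ^ 2 / (2 * v)) ≤
        Real.exp (s.re ^ 2 / (2 * v) + s.im ^ 2 / (2 * v)) * Real.exp (-(1 / (4 * v)) * y ^ 2) := by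
      rw [← Real.exp_add]
      refine Real.exp_le_exp.2 ?_
      have h3 : -(y - s.re) ^ 2 ≤ s.re ^ 2 - y ^ 2 / 2 := by nlinarith [sq_nonneg (y - 2 * s.re)]
      have h4 : -(y - s.re) ^ 2 / (2 * v) ≤ (s.re ^ 2 - y ^ 2 / 2) / (2 * v) := by gcongr
      have h5 : (s.re ^ 2 - y ^ 2 / 2) / (2 * v) = s.re ^ 2 / (2 * v) + -(1 / (4 * v)) * y ^ 2 := by
        field_simp
        ring
      linarith
    calc ‖a‖ * ‖y‖ ^ k * Real.exp (-(y - s.re) ^ 2 / (2 * v) + s.im ^ 2 / (2 * v))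
        ≤ ‖a‖ * ‖y‖ ^ k * (Real.exp (s.re ^ 2 / (2 * v) + s.im ^ 2 / (2 * v)) *
          Real.exp (-(1 / (4 * v)) * y ^ 2)) := by gcongr
      _ = _ := by ring

/-- Gaussian integration by parts: differentiating the exponential brings down -(y - s)/v, and the
derivative of an integrable function with integrable derivative has integral zero. -/
theorem integral_derivative_mul_complexGaussian (p : Polynomial ℂ) (s : ℂ) {v : ℝ} (hv : 0 < v) :
    (v : ℂ) * ∫ y : ℝ, (Polynomial.derivative p).eval (y : ℂ) *
        Complex.exp (-((y : ℂ) - s) ^ 2 / (2 * v)) =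
      ∫ y : ℝ, (p * (Polynomial.X - Polynomial.C s)).eval (y : ℂ) *
        Complex.exp (-((y : ℂ) - s) ^ 2 / (2 * v)) := by
  have hv' : (v : ℂ) ≠ 0 := by exact_mod_cast hv.ne'
  have i1 := integrable_polynomial_mul_complexGaussian (Polynomial.derivative p) s hv
  have i2 := integrable_polynomial_mul_complexGaussian (p * (Polynomial.X - Polynomial.C s)) s hv
  have hder : ∀ y : ℝ, HasDerivAt
      (fun y : ℝ => p.eval (y : ℂ) * Complex.exp (-((y : ℂ) - s) ^ 2 / (2 * v)))
      ((Polynomial.derivative p).eval (y : ℂ) * Complex.exp (-((y : ℂ) - s) ^ 2 / (2 * v)) -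
        (v : ℂ)⁻¹ * ((p * (Polynomial.X - Polynomial.C s)).eval (y : ℂ) *
          Complex.exp (-((y : ℂ) - s) ^ 2 / (2 * v)))) y := by
    intro y
    have h1 : HasDerivAt (fun y : ℂ => -(y - s) ^ 2 / (2 * v)) (-((y : ℂ) - s) / v) (y : ℂ) := by
      have := ((((hasDerivAt_id (y : ℂ)).sub_const s).pow 2).neg).div_const (2 * (v : ℂ))
      refine this.congr_deriv ?_
      simp only [id]
      field_simp
      norm_num
      ring
    have h2 := ((p.hasDerivAt (y : ℂ)).mul h1.cexp).comp_ofReal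
    refine h2.congr_deriv ?_
    simp only [Polynomial.eval_mul, Polynomial.eval_sub, Polynomial.eval_X, Polynomial.eval_C]
    field_simp
    ring
  have h0 := integral_eq_zero_of_hasDerivAt_of_integrable hder (i1.sub (i2.const_mul _))
    (integrable_polynomial_mul_complexGaussian p s hv)
  rw [integral_sub i1 (i2.const_mul _), integral_const_mul, sub_eq_zero] at h0
  rw [h0, mul_inv_cancel_left₀ hv']

theorem integral_complexGaussian (s : ℂ) {v : ℝ} (hv : 0 < v) :
    ∫ y : ℝ, Complex.exp (-((y : ℂ) - s) ^ 2 / (2 * v)) = (√(2 * Real.pi * v) : ℝ) := by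
  have hv' : (v : ℂ) ≠ 0 := by exact_mod_cast hv.ne'
  have hb : (-(1 / (2 * v) : ℝ) : ℂ).re < 0 := by
    rw [Complex.neg_re, Complex.ofReal_re]
    have : 0 < 1 / (2 * v) := by positivity
    linarith
  have h := integral_cexp_quadratic hb (s / v) (-s ^ 2 / (2 * v))
  have e1 : ∀ y : ℝ, Complex.exp (-((y : ℂ) - s) ^ 2 / (2 * v)) =
      Complex.exp (-((1 / (2 * v) : ℝ) : ℂ) * (y : ℂ) ^ 2 + s / v * y + -s ^ 2 / (2 * v)) := by
    intro y
    congr 1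
    push_cast
    field_simp
    ring
  simp_rw [e1]
  rw [h]
  have e2 : -s ^ 2 / (2 * v) - (s / v) ^ 2 / (4 * -((1 / (2 * v) : ℝ) : ℂ)) = 0 := by
    push_cast
    field_simp
    norm_num
  have e3 : (Real.pi : ℂ) / -(-((1 / (2 * v) : ℝ) : ℂ)) = ((2 * Real.pi * v : ℝ) : ℂ) := by
    push_cast
    field_simp
  rw [e2, e3, Complex.exp_zero, mul_one, Real.sqrt_eq_rpow, Complex.ofReal_cpow (by positivity)]
  norm_num

/-- Averaging over a Gaussian of mean ra and variance 1 - r² is the Ornstein–Uhlenbeck semigroup,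
and He_m is an eigenfunction with eigenvalue r^m. Integration by parts turns the three-term
recurrence into I_{m+2} = ra I_{m+1} - r²(m+1) I_m, where the coefficient -r² is the variance minus
one. -/
theorem integral_hermitePoly_mul_complexGaussian {r : ℝ} (hr : r ^ 2 < 1) (a : ℂ) (m : ℕ) :
    ∫ y : ℝ, (hermitePoly m).eval (y : ℂ) *
        Complex.exp (-((y : ℂ) - r * a) ^ 2 / (2 * (1 - r ^ 2 : ℝ))) =
      r ^ m * (hermitePoly m).eval a * (√(2 * Real.pi * (1 - r ^ 2)) : ℝ) := by
  have hv : 0 < 1 - r ^ 2 := by linarith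
  have hinteg := fun p => integrable_polynomial_mul_complexGaussian p (r * a) hv
  have h0 := integral_complexGaussian (r * a) hv
  generalize ((√(2 * Real.pi * (1 - r ^ 2)) : ℝ) : ℂ) = q at h0 ⊢
  induction m using Nat.strong_induction_on with
  | _ m ih =>
    match m, ih with
    | 0, _ => simpa [hermitePoly_zero] using h0
    | 1, _ =>
      have h1 := integral_derivative_mul_complexGaussian 1 (r * a) hv
      have hX := hinteg Polynomial.X
      have hC := hinteg (Polynomial.C (r * a))
      simp only [Polynomial.derivative_one, Polynomial.eval_zero, zero_mul, integral_zero,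
        mul_zero, one_mul, Polynomial.eval_sub, Polynomial.eval_X, Polynomial.eval_C, sub_mul] at h1 hX hC
      rw [integral_sub hX hC, integral_const_mul, h0] at h1
      simp only [hermitePoly_succ, hermitePoly_zero, Polynomial.derivative_one, mul_one, sub_zero,
        Polynomial.eval_X, pow_one]
      linear_combination -h1
    | m + 2, ih =>
      have hm := ih m (by lia)
      have hm1 := ih (m + 1) (by lia)
      have h1 := integral_derivative_mul_complexGaussian (hermitePoly (m + 1)) (r * a) hv
      have hX := hinteg (Polynomial.X * hermitePoly (m + 1))
      have hC := hinteg (Polynomial.C (r * a) * hermitePoly (m + 1))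
      have hK := hinteg (Polynomial.C ((m : ℂ) + 1) * hermitePoly m)
      rw [derivative_hermitePoly_succ] at h1
      have e1 : ((m : Polynomial ℂ) + 1) = Polynomial.C ((m : ℂ) + 1) := by simp
      rw [e1] at h1
      have e2 : hermitePoly (m + 1) * (Polynomial.X - Polynomial.C (r * a)) =
        Polynomial.X * hermitePoly (m + 1) - Polynomial.C (r * a) * hermitePoly (m + 1) := by ring
      rw [e2] at h1
      simp only [Polynomial.eval_sub, sub_mul] at h1
      rw [integral_sub hX hC] at h1
      rw [hermitePoly_succ_succ, e1]
      simp only [Polynomial.eval_sub, sub_mul]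
      rw [integral_sub hX hK]
      simp only [Polynomial.eval_mul, Polynomial.eval_C, Polynomial.eval_X, mul_assoc,
        integral_const_mul] at h1 ⊢
      rw [hm, hm1] at h1
      rw [hm]
      push_cast at h1 ⊢
      linear_combination -h1

theorem integral_hermitePoly_mul_hermitePoly (m k : ℕ) :
    ∫ y : ℝ, (hermitePoly m).eval (y : ℂ) * (hermitePoly k).eval (y : ℂ) *
        Complex.exp (-(y : ℂ) ^ 2 / 2) =
      if m = k then (m.factorial : ℂ) * (√(2 * Real.pi) : ℝ) else 0 := by
  have hinteg := fun p => integrable_polynomial_mul_complexGaussian p 0 one_pos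
  -- He_{m+1} = X He_m - He_m', so integrating by parts lowers the degree of the Hermite factor by
  -- one and differentiates the other factor. Orthogonality follows by induction.
  have step : ∀ (m : ℕ) (p : Polynomial ℂ),
      ∫ y : ℝ, (hermitePoly (m + 1)).eval (y : ℂ) * p.eval (y : ℂ) *
        Complex.exp (-(y : ℂ) ^ 2 / 2) =
      ∫ y : ℝ, (hermitePoly m).eval (y : ℂ) * (Polynomial.derivative p).eval (y : ℂ) *
        Complex.exp (-(y : ℂ) ^ 2 / 2) := by
    intro m p
    have h1 := integral_derivative_mul_complexGaussian (hermitePoly m * p) 0 one_pos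
    have i1 := hinteg (Polynomial.derivative (hermitePoly m) * p)
    have i2 := hinteg (hermitePoly m * Polynomial.derivative p)
    have i3 := hinteg (Polynomial.X * hermitePoly m * p)
    rw [Polynomial.derivative_mul] at h1
    simp only [Polynomial.eval_add, Polynomial.eval_mul, Polynomial.eval_sub, Polynomial.eval_X,
      Polynomial.eval_C, sub_zero, Complex.ofReal_one, one_mul, mul_one, add_mul] at h1 i1 i2 i3
    rw [integral_add i1 i2] at h1
    simp only [hermitePoly_succ, Polynomial.eval_sub, Polynomial.eval_mul, Polynomial.eval_X,
      sub_mul]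
    rw [integral_sub i3 i1]
    have e : ∀ y : ℝ, (y : ℂ) * (hermitePoly m).eval (y : ℂ) * p.eval (y : ℂ) *
        Complex.exp (-(y : ℂ) ^ 2 / 2) = (hermitePoly m).eval (y : ℂ) * p.eval (y : ℂ) * y *
        Complex.exp (-(y : ℂ) ^ 2 / 2) := fun y => by ring
    simp_rw [e]
    linear_combination -h1
  induction m generalizing k with
  | zero =>
    cases k with
    | zero => simpa [hermitePoly_zero] using integral_complexGaussian 0 one_pos
    | succ k =>
      have := step k (hermitePoly 0)
      simp only [hermitePoly_zero, Polynomial.eval_one, mul_one, Polynomial.derivative_one,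
        Polynomial.eval_zero, mul_zero, zero_mul, integral_zero] at this
      simp [hermitePoly_zero, this]
  | succ m ih =>
    rw [step]
    cases k with
    | zero => simp [hermitePoly_zero]
    | succ k =>
      have e1 : ((k : Polynomial ℂ) + 1) = Polynomial.C ((k : ℂ) + 1) := by simp
      rw [derivative_hermitePoly_succ, e1]
      simp only [Polynomial.eval_mul, Polynomial.eval_C]
      have e : ∀ y : ℝ, (hermitePoly m).eval (y : ℂ) * (((k : ℂ) + 1) * (hermitePoly k).eval (y : ℂ)) *
        Complex.exp (-(y : ℂ) ^ 2 / 2) = ((k : ℂ) + 1) * ((hermitePoly m).eval (y : ℂ) *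
          (hermitePoly k).eval (y : ℂ) * Complex.exp (-(y : ℂ) ^ 2 / 2)) := fun y => by ring
      simp_rw [e]
      rw [integral_const_mul, ih]
      by_cases hmk : m = k
      · subst hmk
        simp [Nat.factorial_succ]
        ring
      · simp [hmk]

theorem integral_hermiteFun_mul_hermiteFun (m k : ℕ) :
    ∫ x : ℝ, (hermiteFun m x : ℂ) * (hermiteFun k x : ℂ) = if m = k then 1 else 0 := by
  have h := Measure.integral_comp_mul_left (fun y : ℝ => (hermitePoly m).eval (y : ℂ) *
    (hermitePoly k).eval (y : ℂ) * Complex.exp (-(y : ℂ) ^ 2 / 2)) (√2)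
  rw [integral_hermitePoly_mul_hermitePoly] at h
  have e : ∀ x : ℝ, (hermiteFun m x : ℂ) * (hermiteFun k x : ℂ) =
      (((√((m.factorial : ℝ) * √Real.pi))⁻¹ : ℝ) * ((√((k.factorial : ℝ) * √Real.pi))⁻¹ : ℝ)) *
      ((hermitePoly m).eval ((√2 * x : ℝ) : ℂ) * (hermitePoly k).eval ((√2 * x : ℝ) : ℂ) *
        Complex.exp (-((√2 * x : ℝ) : ℂ) ^ 2 / 2)) := by
    intro x
    have h2 : ((√2 : ℝ) : ℂ) ^ 2 = 2 := by
      rw [← Complex.ofReal_pow, Real.sq_sqrt (by norm_num)]; norm_num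
    have e2 : Complex.exp (-((√2 * x : ℝ) : ℂ) ^ 2 / 2) =
        Complex.exp (-(x : ℂ) ^ 2 / 2) * Complex.exp (-(x : ℂ) ^ 2 / 2) := by
      rw [← Complex.exp_add]
      congr 1
      push_cast
      linear_combination (-(x : ℂ) ^ 2 / 2) * h2
    rw [← hermiteFunC_ofReal, ← hermiteFunC_ofReal, hermiteFunC, hermiteFunC, e2]
    push_cast
    ring
  simp_rw [e]
  rw [integral_const_mul, h]
  by_cases hmk : m = k
  · subst hmk
    rw [if_pos rfl, if_pos rfl]
    have h1 : (0 : ℝ) < m.factorial := by exact_mod_cast m.factorial_pos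
    have hpi : (0 : ℝ) < √Real.pi := Real.sqrt_pos.2 Real.pi_pos
    have : (√((m.factorial : ℝ) * √Real.pi))⁻¹ * (√((m.factorial : ℝ) * √Real.pi))⁻¹ *
        (|(√2)⁻¹| * ((m.factorial : ℝ) * √(2 * Real.pi))) = 1 := by
      rw [← mul_inv, Real.mul_self_sqrt (by positivity), abs_of_pos (by positivity),
        Real.sqrt_mul (by norm_num : (0 : ℝ) ≤ 2)]
      field_simp
    rw [Complex.real_smul]
    exact_mod_cast this
  · simp [hmk]

theorem memLp_hermiteFun (m : ℕ) : MemLp (fun x : ℝ => (hermiteFun m x : ℂ)) 2 volume := by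
  have hc : Continuous fun x : ℝ => (hermiteFun m x : ℂ) :=
    Complex.continuous_ofReal.comp (continuous_hermiteFun m)
  rw [memLp_two_iff_integrable_sq_norm hc.aestronglyMeasurable]
  refine (integrable_hermiteFun_sq m).congr (Eventually.of_forall fun x => ?_)
  simp

theorem orthonormal_hermiteFun :
    Orthonormal ℂ fun m : ℕ => (memLp_hermiteFun m).toLp (fun x : ℝ => (hermiteFun m x : ℂ)) := by
  rw [orthonormal_iff_ite]
  intro m k
  rw [L2.inner_def, ← integral_hermiteFun_mul_hermiteFun]
  refine integral_congr_ae ?_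
  filter_upwards [(memLp_hermiteFun m).coeFn_toLp, (memLp_hermiteFun k).coeFn_toLp] with x h1 h2
  rw [h1, h2]
  simp [mul_comm]

/-- An upper bound for the diagonal of the Mehler kernel at a complex point. -/
theorem sum_pow_mul_norm_hermiteFunC_sq_le {r : ℝ} (hr0 : 0 < r) (hr1 : r < 1) (z : ℂ)
    (S : Finset ℕ) :
    ∑ m ∈ S, (r ^ 2) ^ m * ‖hermiteFunC m z‖ ^ 2 ≤
      (1 - r ^ 2)⁻¹ * Real.exp (-((1 - r ^ 2) / (1 + r ^ 2)) * z.re ^ 2 +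
        ((1 + r ^ 2) / (1 - r ^ 2)) * z.im ^ 2) := by
  have hr2 : r ^ 2 < 1 := by nlinarith
  have hv : 0 < 1 - r ^ 2 := by linarith
  set v := 1 - r ^ 2 with hvdef
  set a : ℂ := (√2 : ℝ) * z with ha
  have h2 : √2 ^ 2 = 2 := Real.sq_sqrt (by norm_num)
  set K : ℝ → ℂ := fun y => Complex.exp (-((y : ℂ) - r * a) ^ 2 / (2 * (v : ℝ))) with hK
  -- The factor exp(x²/2) cancels the Gaussian of the Hermite functions, so the coefficients of u
  -- are the integrals computed above and equal r^m h_m(z) up to a factor independent of m. The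
  -- constants A, B, D complete the square in the exponent of ‖u x‖².
  set u : ℝ → ℂ := fun x => K (√2 * x) * Complex.exp ((x : ℂ) ^ 2 / 2) with hu
  set A := (1 + r ^ 2) / v with hA
  set B := 2 * r * z.re / (1 + r ^ 2) with hB
  set D := 2 * r ^ 2 * z.re ^ 2 / (1 + r ^ 2) + 2 * r ^ 2 * z.im ^ 2 / v with hD
  have hA1 : 1 ≤ A := by
    rw [hA, le_div_iff₀ hv]
    nlinarith [sq_nonneg r]
  have hun : ∀ x, ‖u x‖ ^ 2 = Real.exp D * Real.exp (-A * (x - B) ^ 2) := by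
    intro x
    have e1 : ‖Complex.exp ((x : ℂ) ^ 2 / 2)‖ = Real.exp (x ^ 2 / 2) := by
      rw [Complex.norm_exp]
      congr 1
      have : ((x : ℂ) ^ 2 / 2) = ((x ^ 2 / 2 : ℝ) : ℂ) := by push_cast; rfl
      rw [this, Complex.ofReal_re]
    rw [hu]
    simp only
    rw [norm_mul, hK]
    simp only
    rw [norm_complexGaussian, e1, ← Real.exp_add, ← Real.exp_nat_mul, ← Real.exp_add]
    congr 1
    have ea : (r * a).re = √2 * (r * z.re) := by simp [ha]; ring
    have eb : (r * a).im = √2 * (r * z.im) := by simp [ha]; ring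
    rw [ea, eb, ← mul_sub, mul_pow, mul_pow, h2, hA, hB, hD]
    have h1r : (0 : ℝ) < 1 + r ^ 2 := by positivity
    have hv2 : r ^ 2 = 1 - v := by rw [hvdef]; ring
    push_cast
    field_simp
    rw [hvdef]
    ring
  have hKc : Continuous K := by fun_prop
  have huc : Continuous u := by fun_prop
  have hgi : Integrable fun x : ℝ => Real.exp (-A * (x - B) ^ 2) :=
    (integrable_exp_neg_mul_sq (by linarith : 0 < A)).comp_sub_right B
  have hum : MemLp u 2 volume := by
    rw [memLp_two_iff_integrable_sq_norm huc.aestronglyMeasurable]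
    simp_rw [hun]
    exact hgi.const_mul _
  -- The Gaussian integral is √(π/A), and A ≥ 1.
  have hnorm : ‖hum.toLp u‖ ^ 2 ≤ Real.exp D * √Real.pi := by
    have e1 : ‖hum.toLp u‖ ^ 2 = ∫ x, ‖u x‖ ^ 2 := by
      have e2 := L2.inner_def (𝕜 := ℂ) (hum.toLp u) (hum.toLp u)
      rw [inner_self_eq_norm_sq_to_K] at e2
      have e3 : ∫ x, inner ℂ ((hum.toLp u : ℝ → ℂ) x) ((hum.toLp u : ℝ → ℂ) x) =
          ∫ x, ((‖u x‖ ^ 2 : ℝ) : ℂ) := by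
        refine integral_congr_ae ?_
        filter_upwards [hum.coeFn_toLp] with x hx
        rw [hx, inner_self_eq_norm_sq_to_K]
        simp
      rw [e3, show ∫ x, ((‖u x‖ ^ 2 : ℝ) : ℂ) = ((∫ x, ‖u x‖ ^ 2 : ℝ) : ℂ) from integral_ofReal] at e2
      refine Complex.ofReal_injective (Eq.trans ?_ e2)
      simp
    rw [e1]
    simp_rw [hun]
    rw [integral_const_mul, integral_sub_right_eq_self (fun x : ℝ => Real.exp (-A * x ^ 2)) B,
      integral_gaussian]
    gcongr
    exact div_le_self Real.pi_pos.le hA1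
  have hcoef : ∀ m, ((r ^ m : ℝ) : ℂ) * hermiteFunC m z =
      Complex.exp (-z ^ 2 / 2) * ((√Real.pi * √v)⁻¹ : ℝ) * ∫ x : ℝ, (hermiteFun m x : ℂ) * u x := by
    intro m
    have h1 := integral_hermitePoly_mul_complexGaussian hr2 a m
    have h3 := Measure.integral_comp_mul_left (fun y : ℝ => (hermitePoly m).eval (y : ℂ) * K y) (√2)
    rw [h1] at h3
    have e : ∀ x : ℝ, (hermiteFun m x : ℂ) * u x = ((√((m.factorial : ℝ) * √Real.pi))⁻¹ : ℝ) *
        ((hermitePoly m).eval ((√2 * x : ℝ) : ℂ) * K (√2 * x)) := by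
      intro x
      rw [← hermiteFunC_ofReal, hermiteFunC, hu]
      have : Complex.exp (-(x : ℂ) ^ 2 / 2) * Complex.exp ((x : ℂ) ^ 2 / 2) = 1 := by
        rw [← Complex.exp_add]; ring_nf; simp
      simp only
      push_cast
      linear_combination (((√((m.factorial : ℝ) * √Real.pi) : ℂ)⁻¹) *
        (hermitePoly m).eval ((√2 : ℂ) * x) * K (√2 * x)) * this
    simp_rw [e]
    rw [integral_const_mul, h3, hermiteFunC, ← ha, Complex.real_smul]
    have e5 : (√Real.pi * √v)⁻¹ * (|(√2)⁻¹| * √(2 * Real.pi * v)) = 1 := by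
      rw [abs_of_pos (by positivity), Real.sqrt_mul (by positivity),
        Real.sqrt_mul (by norm_num : (0 : ℝ) ≤ 2)]
      have : 0 < √Real.pi := Real.sqrt_pos.2 Real.pi_pos
      have : 0 < √v := Real.sqrt_pos.2 hv
      field_simp
    have e6 : (((√Real.pi * √v)⁻¹ : ℝ) : ℂ) * (((|(√2)⁻¹| : ℝ) : ℂ) *
        ((√(2 * Real.pi * v) : ℝ) : ℂ)) = 1 := by exact_mod_cast e5
    rw [Complex.ofReal_pow]
    linear_combination (-(r : ℂ) ^ m * (hermitePoly m).eval a * Complex.exp (-z ^ 2 / 2) *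
      ((√((m.factorial : ℝ) * √Real.pi))⁻¹ : ℝ)) * e6
  -- Only an upper bound is wanted, so Bessel's inequality replaces Mehler's identity and
  -- completeness is not needed here.
  have hbessel := Orthonormal.sum_inner_products_le (hum.toLp u) orthonormal_hermiteFun (s := S)
  have hinner : ∀ m, inner ℂ ((memLp_hermiteFun m).toLp (fun x : ℝ => (hermiteFun m x : ℂ)))
      (hum.toLp u) = ∫ x : ℝ, (hermiteFun m x : ℂ) * u x := by
    intro m
    rw [L2.inner_def]
    refine integral_congr_ae ?_
    filter_upwards [(memLp_hermiteFun m).coeFn_toLp, hum.coeFn_toLp] with x e1 e2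
    rw [e1, e2]
    simp [mul_comm]
  simp_rw [hinner] at hbessel
  have hterm : ∀ m, (r ^ 2) ^ m * ‖hermiteFunC m z‖ ^ 2 =
      (Real.exp (-z.re ^ 2 + z.im ^ 2) * (Real.pi * v)⁻¹) *
        ‖∫ x : ℝ, (hermiteFun m x : ℂ) * u x‖ ^ 2 := by
    intro m
    have h1 := congrArg (fun w => ‖w‖ ^ 2) (hcoef m)
    simp only [norm_mul, Complex.norm_real, mul_pow, Complex.norm_exp] at h1
    rw [Real.norm_eq_abs, sq_abs, Real.norm_eq_abs, sq_abs, inv_pow, mul_pow,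
      Real.sq_sqrt Real.pi_pos.le, Real.sq_sqrt hv.le, ← Real.exp_nat_mul] at h1
    rw [← pow_mul, mul_comm 2 m, pow_mul, h1]
    congr 3
    have : -z ^ 2 / 2 = (-z ^ 2) / ((2 : ℝ) : ℂ) := by push_cast; rfl
    rw [this, Complex.div_ofReal_re]
    simp only [Complex.neg_re, pow_two, Complex.mul_re]
    push_cast
    ring
  simp_rw [hterm]
  rw [← Finset.mul_sum]
  have hpi : √Real.pi ≤ Real.pi := by
    rw [Real.sqrt_le_left Real.pi_pos.le]
    nlinarith [Real.pi_gt_three]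
  calc (Real.exp (-z.re ^ 2 + z.im ^ 2) * (Real.pi * v)⁻¹) *
        ∑ m ∈ S, ‖∫ x : ℝ, (hermiteFun m x : ℂ) * u x‖ ^ 2
      ≤ (Real.exp (-z.re ^ 2 + z.im ^ 2) * (Real.pi * v)⁻¹) * (Real.exp D * Real.pi) := by
        gcongr
        exact hbessel.trans (hnorm.trans (by gcongr))
    _ = v⁻¹ * (Real.exp (-z.re ^ 2 + z.im ^ 2) * Real.exp D) := by
        have := Real.pi_pos
        field_simp
    _ = _ := by
        rw [← Real.exp_add]
        congr 2
        have h1r : (0 : ℝ) < 1 + r ^ 2 := by positivity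
        rw [hA, hD]
        field_simp
        rw [hvdef]
        ring

end HermiteOneVariable

end AnalyticVectors

/-! ### Products of series and factorial growth. -/

section Products

/-- The product of finitely many absolutely convergent series. -/
theorem hasSum_prod_pi {𝕜 : Type*} [NormedField 𝕜] [CompleteSpace 𝕜] {n : ℕ} (f : Fin n → ℕ → 𝕜)
    (s : Fin n → 𝕜) (h : ∀ j, HasSum (f j) (s j)) (hn : ∀ j, Summable fun b => ‖f j b‖) :
    HasSum (fun β : Fin n → ℕ => ∏ j, f j (β j)) (∏ j, s j) ∧
      Summable fun β : Fin n → ℕ => ‖∏ j, f j (β j)‖ := by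
  induction n with
  | zero => exact ⟨by simp, Summable.of_finite⟩
  | succ n ih =>
    obtain ⟨h1, n1⟩ := ih (fun j => f j.succ) (fun j => s j.succ) (fun j => h j.succ)
      fun j => hn j.succ
    have n3 := (hn 0).mul_of_nonneg n1 (fun b => norm_nonneg (f 0 b))
      fun β => norm_nonneg (∏ j : Fin n, f j.succ (β j))
    have n2 : Summable fun x : ℕ × (Fin n → ℕ) => f 0 x.1 * ∏ j : Fin n, f j.succ (x.2 j) :=
      Summable.of_norm (n3.congr fun x => (norm_mul _ _).symm)
    have h2 := HasSum.mul (g := fun β : Fin n → ℕ => ∏ j : Fin n, f j.succ (β j)) (h 0) h1 n2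
    have e : ∀ p : ℕ × (Fin n → ℕ), ∏ j, f j (Fin.consEquiv (fun _ : Fin (n + 1) => ℕ) p j) =
        f 0 p.1 * ∏ j : Fin n, f j.succ (p.2 j) := by
      intro p
      simp [Fin.consEquiv, Fin.prod_univ_succ]
    constructor
    · rw [← (Fin.consEquiv fun _ : Fin (n + 1) => ℕ).hasSum_iff, Fin.prod_univ_succ]
      exact Eq.mpr (congrArg₂ (HasSum · ·) (funext e) rfl) h2
    · rw [← (Fin.consEquiv fun _ : Fin (n + 1) => ℕ).summable_iff]
      refine n3.congr fun x => ?_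
      rw [Function.comp, e, norm_mul]

theorem summable_pow_div_sqrt_factorial (c : ℝ) :
    Summable fun b : ℕ => c ^ b / √(b.factorial : ℝ) := by
  have h1 := (Real.summable_pow_div_factorial (2 * c ^ 2)).add
    (summable_geometric_of_lt_one (r := (1 / 2 : ℝ)) (by norm_num) (by norm_num))
  refine Summable.of_norm_bounded h1 fun b => ?_
  have hb : (0 : ℝ) < b.factorial := by exact_mod_cast b.factorial_pos
  rw [norm_div, norm_pow, Real.norm_of_nonneg (Real.sqrt_nonneg _)]
  set A := |c| ^ b / √(b.factorial : ℝ) with hA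
  have e : (2 * c ^ 2) ^ b / (b.factorial : ℝ) = A ^ 2 * 2 ^ b := by
    rw [hA, div_pow, Real.sq_sqrt hb.le, mul_pow, ← sq_abs c, ← pow_mul, ← pow_mul]
    ring
  rw [Real.norm_eq_abs, ← hA, e, one_div, inv_pow]
  have h2 : (0 : ℝ) < 2 ^ b := by positivity
  -- A is dominated by A² 2^b + 2^{-b}, the first term being that of an exponential series and the
  -- second geometric.
  have h3 : A ^ 2 * 2 ^ b + (2 ^ b)⁻¹ - A = (2 ^ b)⁻¹ * ((A * 2 ^ b - 1 / 2) ^ 2 + 3 / 4) := by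
    field_simp
    ring
  have h4 : 0 ≤ (2 ^ b)⁻¹ * ((A * 2 ^ b - 1 / 2) ^ 2 + 3 / 4) := by positivity
  linarith

/-- The quotient (m+b)!/m! is a binomial coefficient times b!, hence at most 2^{m+b} b!. This
reduces the series to the preceding one with √2 c in place of c. -/
theorem summable_pow_div_factorial_mul_sqrt (m : ℕ) {c : ℝ} (hc : 0 ≤ c) :
    Summable fun b : ℕ => c ^ b / (b.factorial : ℝ) * √(((m + b).factorial : ℝ) / m.factorial) := by
  refine Summable.of_nonneg_of_le (fun b => by positivity) (fun b => ?_)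
    ((summable_pow_div_sqrt_factorial (√2 * c)).mul_left (√2 ^ m))
  have hb : (0 : ℝ) < b.factorial := by exact_mod_cast b.factorial_pos
  have hm : (0 : ℝ) < m.factorial := by exact_mod_cast m.factorial_pos
  have h1 : ((m + b).factorial : ℝ) / m.factorial ≤ 2 ^ (m + b) * b.factorial := by
    rw [div_le_iff₀ hm]
    have h2 := Nat.add_choose_mul_factorial_mul_factorial m b
    have h3 : (m + b).choose b ≤ 2 ^ (m + b) := Nat.choose_le_two_pow _ _
    have h4 : ((m + b).factorial : ℝ) = ((m + b).choose b : ℝ) * m.factorial * b.factorial := by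
      exact_mod_cast h2.symm
    rw [h4]
    have h5 : ((m + b).choose b : ℝ) ≤ 2 ^ (m + b) := by exact_mod_cast h3
    nlinarith [mul_le_mul_of_nonneg_right h5 (mul_pos hm hb).le]
  have h2 : √(((m + b).factorial : ℝ) / m.factorial) ≤ √2 ^ (m + b) * √(b.factorial : ℝ) := by
    refine (Real.sqrt_le_sqrt h1).trans (le_of_eq ?_)
    rw [Real.sqrt_mul (by positivity), Real.sqrt_eq_rpow, Real.sqrt_eq_rpow, Real.sqrt_eq_rpow,
      ← Real.rpow_natCast, ← Real.rpow_mul (by norm_num), ← Real.rpow_natCast,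
      ← Real.rpow_mul (by norm_num), mul_comm (1 / 2 : ℝ)]
  have hs : 0 < √(b.factorial : ℝ) := Real.sqrt_pos.2 hb
  calc c ^ b / (b.factorial : ℝ) * √(((m + b).factorial : ℝ) / m.factorial)
      ≤ c ^ b / (b.factorial : ℝ) * (√2 ^ (m + b) * √(b.factorial : ℝ)) := by gcongr
    _ = √2 ^ m * ((√2 * c) ^ b / √(b.factorial : ℝ)) := by
      have e : (b.factorial : ℝ) = √(b.factorial : ℝ) * √(b.factorial : ℝ) :=
        (Real.mul_self_sqrt hb.le).symm
      rw [pow_add, mul_pow]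
      nth_rewrite 1 [e]
      field_simp

end Products

/-- A complex integrable function whose Fourier transform vanishes is zero almost everywhere. -/
theorem ae_eq_zero_of_integral_exp_inner_eq_zero {E : Type*} [NormedAddCommGroup E]
    [InnerProductSpace ℝ E] [MeasurableSpace E] [BorelSpace E] [SecondCountableTopology E]
    [CompleteSpace E] {μ : Measure E} {h : E → ℂ} (hi : Integrable h μ)
    (h0 : ∀ η : E, ∫ x, Complex.exp (inner ℝ x η * Complex.I) * h x ∂μ = 0) : h =ᵐ[μ] 0 := by
  -- For real g, the positive and negative parts are densities of two finite measures. Their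
  -- characteristic functions agree, so the measures agree, and then g vanishes almost everywhere.
  have hreal : ∀ g : E → ℝ, Integrable g μ →
      (∀ η : E, ∫ x, Complex.exp (inner ℝ x η * Complex.I) * (g x : ℂ) ∂μ = 0) → g =ᵐ[μ] 0 := by
    intro g hg hg0
    have hexp : ∀ η, Continuous fun x : E => Complex.exp (inner ℝ x η * Complex.I) := fun η => by
      fun_prop
    have hm : ∀ f : E → ℝ, Integrable f μ →
        IsFiniteMeasure (μ.withDensity fun x => ENNReal.ofReal (f x)) := fun f hf =>
      isFiniteMeasure_withDensity_ofReal hf.2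
    have hinteg : ∀ f : E → ℝ, Integrable f μ → ∀ η,
        Integrable (fun x => Complex.exp (inner ℝ x η * Complex.I) * (f x : ℂ)) μ := fun f hf η =>
      hf.ofReal.bdd_mul (c := 1) (hexp η).aestronglyMeasurable
        (Eventually.of_forall fun x => by rw [Complex.norm_exp_ofReal_mul_I])
    have hcf : ∀ f : E → ℝ, Integrable f μ → ∀ η,
        charFun (μ.withDensity fun x => ENNReal.ofReal (f x)) η =
          ∫ x, Complex.exp (inner ℝ x η * Complex.I) * ((max (f x) 0 : ℝ) : ℂ) ∂μ := by
      intro f hf η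
      rw [charFun, integral_withDensity_eq_integral_toReal_smul₀
        hf.1.aemeasurable.ennreal_ofReal (Eventually.of_forall fun x => ENNReal.ofReal_lt_top)]
      refine integral_congr_ae (Eventually.of_forall fun x => ?_)
      simp only
      rw [ENNReal.toReal_ofReal', Complex.real_smul, mul_comm]
    have hpos := hm g hg
    have hneg := hm (fun x => -g x) hg.neg
    have heq : (μ.withDensity fun x => ENNReal.ofReal (g x)) =
        μ.withDensity fun x => ENNReal.ofReal (-g x) := by
      refine Measure.ext_of_charFun (funext fun η => ?_)
      have i2 : Integrable (fun x => max (-g x) 0) μ := hg.neg.pos_part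
      rw [hcf g hg, hcf (fun x => -g x) hg.neg, ← sub_eq_zero,
        ← integral_sub (hinteg _ hg.pos_part η) (hinteg _ i2 η), ← hg0 η]
      refine integral_congr_ae (Eventually.of_forall fun x => ?_)
      simp only
      rw [← mul_sub, ← Complex.ofReal_sub]
      congr 2
      rcases le_total (g x) 0 with h | h
      · rw [max_eq_right h, max_eq_left (by linarith)]; ring
      · rw [max_eq_left h, max_eq_right (by linarith)]; ring
    have i3 : AEMeasurable (fun x => -g x) μ := hg.1.aemeasurable.neg
    rw [withDensity_eq_iff hg.1.aemeasurable.ennreal_ofReal i3.ennreal_ofReal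
      hg.lintegral_lt_top.ne] at heq
    filter_upwards [heq] with x hx
    change g x = 0
    rcases le_total (g x) 0 with h | h
    · rw [ENNReal.ofReal_of_nonpos h, eq_comm, ENNReal.ofReal_eq_zero] at hx
      exact le_antisymm h (by linarith)
    · rw [ENNReal.ofReal_of_nonpos (by linarith : -g x ≤ 0), ENNReal.ofReal_eq_zero] at hx
      exact le_antisymm hx h
  have hintegc : ∀ f : E → ℂ, Integrable f μ → ∀ η,
      Integrable (fun x => Complex.exp (inner ℝ x η * Complex.I) * f x) μ := fun f hf η =>
    hf.bdd_mul (c := 1) (Continuous.aestronglyMeasurable (by fun_prop))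
      (Eventually.of_forall fun x => by rw [Complex.norm_exp_ofReal_mul_I])
  -- Conjugating the hypothesis at -η gives the same vanishing for the conjugate of h, hence for its
  -- real and imaginary parts.
  have hconj : ∀ η : E, ∫ x, Complex.exp (inner ℝ x η * Complex.I) *
      (starRingEnd ℂ) (h x) ∂μ = 0 := by
    intro η
    have h1 := congrArg (starRingEnd ℂ) (h0 (-η))
    rw [← integral_conj, map_zero] at h1
    rw [← h1]
    refine integral_congr_ae (Eventually.of_forall fun x => ?_)
    simp [← Complex.exp_conj, inner_neg_right]
  have hci : Integrable (fun x => (starRingEnd ℂ) (h x)) μ :=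
    (LinearIsometryEquiv.integrable_comp_iff Complex.conjLIE).2 hi
  have hre := hreal (fun x => (h x).re) hi.re (fun η => by
    have e : ∀ x, Complex.exp (inner ℝ x η * Complex.I) * ((h x).re : ℂ) =
        (1 / 2 : ℂ) * (Complex.exp (inner ℝ x η * Complex.I) * h x +
          Complex.exp (inner ℝ x η * Complex.I) * (starRingEnd ℂ) (h x)) := by
      intro x
      rw [Complex.re_eq_add_conj]
      ring
    simp_rw [e]
    rw [integral_const_mul, integral_add (hintegc h hi η) (hintegc _ hci η), h0, hconj]
    simp)
  have him := hreal (fun x => (h x).im) hi.im (fun η => by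
    have e : ∀ x, Complex.exp (inner ℝ x η * Complex.I) * ((h x).im : ℂ) =
        (1 / (2 * Complex.I) : ℂ) * (Complex.exp (inner ℝ x η * Complex.I) * h x -
          Complex.exp (inner ℝ x η * Complex.I) * (starRingEnd ℂ) (h x)) := by
      intro x
      rw [Complex.im_eq_sub_conj]
      ring
    simp_rw [e]
    rw [integral_const_mul, integral_sub (hintegc h hi η) (hintegc _ hci η), h0, hconj]
    simp)
  filter_upwards [hre, him] with x h1 h2
  exact Complex.ext h1 h2

namespace AnalyticVectors

/-! ### Hermite functions of several variables: creation series, completeness, projections. -/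

section HermiteSeveralVariables

variable {n : ℕ}

/-- The entire extension of the Hermite function `hermiteMulti α`. -/
noncomputable def hermiteMultiC (α : Fin n → ℕ) (z : CSpace n) : ℂ :=
  ∏ j, hermiteFunC (α j) (z j)

theorem hermiteMultiC_toComplex (α : Fin n → ℕ) (x : RSpace n) :
    hermiteMultiC α (toComplex x) = hermiteMulti α x := by
  simp [hermiteMultiC, hermiteMulti, toComplex, hermiteFunC_ofReal]

theorem differentiable_hermiteMultiC (α : Fin n → ℕ) : Differentiable ℂ (hermiteMultiC α) := by
  unfold hermiteMultiC
  have h : ∀ j, Differentiable ℂ fun z : CSpace n => hermiteFunC (α j) (z j) := fun j =>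
    (differentiable_hermiteFunC (α j)).comp (by fun_prop)
  fun_prop

/-- The function `x ↦ exp (ζ·x - ζ²/2) Φ_α(x - ζ)`, that is, the exponential of the creation
operator `√2 ζ·A*` applied to `Φ_α`. -/
noncomputable def creationFun (ζ : CSpace n) (α : Fin n → ℕ) (x : RSpace n) : ℂ :=
  Complex.exp ((∑ j, ζ j * x j) - (∑ j, ζ j ^ 2) / 2) * hermiteMultiC α (toComplex x - ζ)

/-- The coefficient of `Φ_{α+β}` in `creationFun ζ α`. -/
noncomputable def creationCoeff (ζ : CSpace n) (α β : Fin n → ℕ) : ℂ :=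
  ∏ j, (((√2 : ℝ) * ζ j) ^ (β j) / ((β j).factorial : ℂ) *
    (√(((α j + β j).factorial : ℝ) / (α j).factorial) : ℝ))

theorem hasSum_creationFun (ζ : CSpace n) (α : Fin n → ℕ) (x : RSpace n) :
    HasSum (fun β => creationCoeff ζ α β * hermiteMulti (α + β) x) (creationFun ζ α x) := by
  have h := (hasSum_prod_pi _ _ (fun j => hasSum_hermiteFunC (α j) (x j : ℂ) (ζ j))
    fun j => (hasSum_hermiteFunC (α j) (x j : ℂ) (ζ j)).summable.norm).1
  refine Eq.mpr (congrArg₂ (HasSum · ·) (funext fun β => ?_) ?_) h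
  · rw [creationCoeff, hermiteMulti, ← Finset.prod_mul_distrib]
    refine Finset.prod_congr rfl fun j _ => ?_
    rw [hermiteFunC_ofReal, Pi.add_apply]
  · rw [creationFun, hermiteMultiC, Finset.prod_mul_distrib, ← Complex.exp_sum,
      Finset.sum_sub_distrib, Finset.sum_div]
    rfl

theorem summable_norm_creationCoeff (ζ : CSpace n) (α : Fin n → ℕ) :
    Summable fun β => ‖creationCoeff ζ α β‖ := by
  have h := (hasSum_prod_pi _ _ (fun j => (summable_pow_div_factorial_mul_sqrt (α j)
    (norm_nonneg ((√2 : ℝ) * ζ j))).hasSum) fun j => (summable_pow_div_factorial_mul_sqrt (α j)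
      (norm_nonneg ((√2 : ℝ) * ζ j))).norm).1.summable
  refine h.congr fun β => ?_
  rw [creationCoeff, norm_prod]
  refine Finset.prod_congr rfl fun j _ => ?_
  simp only [norm_mul, norm_div, norm_pow, Complex.norm_natCast, Complex.norm_real,
    Real.norm_of_nonneg (Real.sqrt_nonneg _)]

theorem integral_hermiteMulti_mul_hermiteMulti (α β : Fin n → ℕ) :
    ∫ x : RSpace n, hermiteMulti α x * hermiteMulti β x = if α = β then 1 else 0 := by
  have h := (EuclideanSpace.volume_preserving_symm_measurableEquiv_toLp (Fin n)).integral_comp'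
    (fun x : Fin n → ℝ => ∏ j, ((hermiteFun (α j) (x j) : ℂ) * (hermiteFun (β j) (x j) : ℂ)))
  rw [volume_pi, integral_fintype_prod_eq_prod
    (fun j x => (hermiteFun (α j) x : ℂ) * (hermiteFun (β j) x : ℂ))] at h
  simp_rw [integral_hermiteFun_mul_hermiteFun] at h
  have e : ∀ x : RSpace n, hermiteMulti α x * hermiteMulti β x =
      ∏ j, ((hermiteFun (α j) (((MeasurableEquiv.toLp 2 (Fin n → ℝ)).symm x) j) : ℂ) *
        (hermiteFun (β j) (((MeasurableEquiv.toLp 2 (Fin n → ℝ)).symm x) j) : ℂ)) := by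
    intro x
    rw [hermiteMulti, hermiteMulti, ← Finset.prod_mul_distrib]
    rfl
  simp_rw [e]
  rw [h]
  by_cases hab : α = β
  · simp [hab]
  · obtain ⟨j, hj⟩ := Function.ne_iff.1 hab
    rw [if_neg hab]
    exact Finset.prod_eq_zero (Finset.mem_univ j) (if_neg hj)

theorem conj_hermiteMulti (α : Fin n → ℕ) (x : RSpace n) :
    (starRingEnd ℂ) (hermiteMulti α x) = hermiteMulti α x := by
  simp [hermiteMulti, map_prod]

theorem inner_toLp_left {f : RSpace n → ℂ} (hf : MemLp f 2 volume) (φ : LTwo n) :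
    inner ℂ (hf.toLp f) φ = ∫ x, (φ : RSpace n → ℂ) x * (starRingEnd ℂ) (f x) := by
  rw [L2.inner_def]
  refine integral_congr_ae ?_
  filter_upwards [hf.coeFn_toLp] with x hx
  rw [hx]
  rfl

theorem inner_hermiteVec (α : Fin n → ℕ) (φ : LTwo n) :
    inner ℂ (hermiteVec α) φ = ∫ x, (φ : RSpace n → ℂ) x * hermiteMulti α x := by
  rw [hermiteVec, inner_toLp_left]
  simp_rw [conj_hermiteMulti]

theorem orthonormal_hermiteVec : Orthonormal ℂ (hermiteVec (n := n)) := by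
  rw [orthonormal_iff_ite]
  intro α β
  rw [inner_hermiteVec, ← integral_hermiteMulti_mul_hermiteMulti]
  refine integral_congr_ae ?_
  filter_upwards [(memLp_hermiteMulti β).coeFn_toLp] with x hx
  rw [hermiteVec, hx, mul_comm]

theorem integrable_mul_of_memLp_two (φ : LTwo n) {f : RSpace n → ℂ} (hf : MemLp f 2 volume) :
    Integrable fun x => (φ : RSpace n → ℂ) x * f x :=
  (Lp.memLp φ).integrable_mul hf

/-- From |ab| ≤ |a|² + |b|² and the normalization of Φ_α. Uniformity in α is what allows the
creation series to be integrated term by term against φ. -/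
theorem integral_norm_mul_hermiteMulti_le (φ : LTwo n) : ∃ C : ℝ, ∀ α : Fin n → ℕ,
    ∫ x, ‖(φ : RSpace n → ℂ) x * hermiteMulti α x‖ ≤ C := by
  have i1 := (memLp_two_iff_integrable_sq_norm (Lp.memLp φ).1).1 (Lp.memLp φ)
  refine ⟨(∫ x, ‖(φ : RSpace n → ℂ) x‖ ^ 2) + 1, fun α => ?_⟩
  have i2 := (memLp_two_iff_integrable_sq_norm (memLp_hermiteMulti α).1).1 (memLp_hermiteMulti α)
  have h1 : ∫ x, ‖hermiteMulti α x‖ ^ 2 = 1 := by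
    have h2 := integral_hermiteMulti_mul_hermiteMulti α α
    rw [if_pos rfl] at h2
    have e : ∀ x : RSpace n, hermiteMulti α x * hermiteMulti α x =
        ((‖hermiteMulti α x‖ ^ 2 : ℝ) : ℂ) := by
      intro x
      nth_rewrite 2 [← conj_hermiteMulti α x]
      rw [Complex.mul_conj']
      push_cast
      rfl
    simp_rw [e] at h2
    rw [show ∫ x, ((‖hermiteMulti α x‖ ^ 2 : ℝ) : ℂ) = ((∫ x, ‖hermiteMulti α x‖ ^ 2 : ℝ) : ℂ)
      from integral_ofReal] at h2
    exact_mod_cast h2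
  rw [← h1, ← integral_add i1 i2]
  refine integral_mono (integrable_mul_of_memLp_two φ (memLp_hermiteMulti α)).norm (i1.add i2)
    fun x => ?_
  simp only [norm_mul]
  nlinarith [sq_nonneg (‖(φ : RSpace n → ℂ) x‖ - ‖hermiteMulti α x‖),
    sq_nonneg (‖(φ : RSpace n → ℂ) x‖), sq_nonneg (‖hermiteMulti α x‖)]

theorem hasSum_integral_mul_creationFun (φ : LTwo n) (ζ : CSpace n) (α : Fin n → ℕ) :
    HasSum (fun β => creationCoeff ζ α β * inner ℂ (hermiteVec (α + β)) φ)
      (∫ x, (φ : RSpace n → ℂ) x * creationFun ζ α x) := by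
  obtain ⟨C, hC⟩ := integral_norm_mul_hermiteMulti_le φ
  have h := hasSum_integral_of_summable_integral_norm (μ := (volume : Measure (RSpace n)))
    (F := fun β x => creationCoeff ζ α β * ((φ : RSpace n → ℂ) x * hermiteMulti (α + β) x))
    (fun β => (integrable_mul_of_memLp_two φ (memLp_hermiteMulti _)).const_mul _)
    (by
      refine Summable.of_nonneg_of_le (fun β => integral_nonneg fun x => norm_nonneg _)
        (fun β => ?_) ((summable_norm_creationCoeff ζ α).mul_right C)
      simp_rw [norm_mul (creationCoeff ζ α β)]
      rw [integral_const_mul]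
      exact mul_le_mul_of_nonneg_left (hC _) (norm_nonneg _))
  refine Eq.mpr (congrArg₂ (HasSum · ·) (funext fun β => ?_) ?_) h
  · rw [integral_const_mul, inner_hermiteVec]
  · refine integral_congr_ae (Eventually.of_forall fun x => ?_)
    simp only
    rw [← ((hasSum_creationFun ζ α x).mul_left ((φ : RSpace n → ℂ) x)).tsum_eq]
    refine tsum_congr fun β => ?_
    ring

theorem hermiteMultiC_zero (z : CSpace n) :
    hermiteMultiC 0 z = (((√(√Real.pi))⁻¹ : ℝ) : ℂ) ^ n * Complex.exp (-(∑ j, z j ^ 2) / 2) := by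
  simp only [hermiteMultiC, hermiteFunC, Pi.zero_apply, hermitePoly_zero, Polynomial.eval_one,
    Nat.factorial_zero, Nat.cast_one, one_mul, mul_one]
  rw [Finset.prod_mul_distrib, Finset.prod_const, Finset.card_univ, Fintype.card_fin,
    ← Complex.exp_sum, ← Finset.sum_neg_distrib, Finset.sum_div]

/-- The Hermite functions are complete in `L²(ℝⁿ)`. -/
theorem eq_zero_of_inner_hermiteVec_eq_zero (φ : LTwo n)
    (h : ∀ α, inner ℂ (hermiteVec α) φ = 0) : φ = 0 := by
  have hg : MemLp (hermiteMulti (0 : Fin n → ℕ)) 2 volume := memLp_hermiteMulti 0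
  have h1 := ae_eq_zero_of_integral_exp_inner_eq_zero (integrable_mul_of_memLp_two φ hg) (fun η => by
    -- At α = 0 the creation function is a constant times exp(2ζ·x) Φ_0(x), so 2ζ = iη makes it a
    -- character times a Gaussian. Its integral against φ vanishes because every Hermite coefficient
    -- does.
    set ζ : CSpace n := (Complex.I / 2) • toComplex η with hζ
    have h2 := (hasSum_integral_mul_creationFun φ ζ 0).unique
      (show HasSum _ (0 : ℂ) by simp only [h, mul_zero]; exact hasSum_zero)
    have e : ∀ x : RSpace n, creationFun ζ 0 x = Complex.exp (-∑ j, ζ j ^ 2) *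
        (Complex.exp (inner ℝ x η * Complex.I) * hermiteMulti 0 x) := by
      intro x
      rw [creationFun, ← hermiteMultiC_toComplex, hermiteMultiC_zero, hermiteMultiC_zero]
      have : Complex.exp ((∑ j, ζ j * x j) - (∑ j, ζ j ^ 2) / 2) *
          Complex.exp (-(∑ j, (toComplex x - ζ) j ^ 2) / 2) =
          Complex.exp (-∑ j, ζ j ^ 2) * (Complex.exp (inner ℝ x η * Complex.I) *
            Complex.exp (-(∑ j, (toComplex x) j ^ 2) / 2)) := by
        rw [← Complex.exp_add, ← Complex.exp_add, ← Complex.exp_add]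
        congr 1
        have e1 : ((inner ℝ x η : ℝ) : ℂ) * Complex.I = 2 * ∑ j, ζ j * x j := by
          rw [PiLp.inner_apply, Complex.ofReal_sum, Finset.sum_mul, Finset.mul_sum]
          refine Finset.sum_congr rfl fun j _ => ?_
          simp [hζ, toComplex]
          ring
        have e2 : ∑ j, (toComplex x - ζ) j ^ 2 =
            (∑ j, (toComplex x) j ^ 2) - 2 * (∑ j, ζ j * x j) + ∑ j, ζ j ^ 2 := by
          rw [Finset.mul_sum, ← Finset.sum_sub_distrib, ← Finset.sum_add_distrib]
          refine Finset.sum_congr rfl fun j _ => ?_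
          simp [toComplex]
          ring
        rw [e1, e2]
        ring
      linear_combination ((((√(√Real.pi))⁻¹ : ℝ) : ℂ) ^ n) * this
    simp_rw [e] at h2
    have e3 : ∀ x : RSpace n, (φ : RSpace n → ℂ) x * (Complex.exp (-∑ j, ζ j ^ 2) *
        (Complex.exp (inner ℝ x η * Complex.I) * hermiteMulti 0 x)) =
        Complex.exp (-∑ j, ζ j ^ 2) * (Complex.exp (inner ℝ x η * Complex.I) *
          ((φ : RSpace n → ℂ) x * hermiteMulti 0 x)) := fun x => by ring
    simp_rw [e3] at h2
    rw [integral_const_mul] at h2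
    exact (mul_eq_zero.1 h2).resolve_left (Complex.exp_ne_zero _))
  refine (Lp.eq_zero_iff_ae_eq_zero).2 ?_
  filter_upwards [h1] with x hx
  -- Fourier uniqueness gives φ Φ_0 = 0 almost everywhere, and the Gaussian Φ_0 has no zeros.
  refine (mul_eq_zero.1 hx).resolve_right ?_
  rw [← hermiteMultiC_toComplex, hermiteMultiC_zero]
  have : 0 < √(√Real.pi) := Real.sqrt_pos.2 (Real.sqrt_pos.2 Real.pi_pos)
  exact mul_ne_zero (pow_ne_zero _ (by exact_mod_cast (inv_pos.2 this).ne')) (Complex.exp_ne_zero _)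

theorem hasSum_hermiteVec (φ : LTwo n) :
    HasSum (fun α => inner ℂ (hermiteVec α) φ • hermiteVec α) φ := by
  let b := HilbertBasis.mkOfOrthogonalEqBot (orthonormal_hermiteVec (n := n)) (by
    rw [Submodule.eq_bot_iff]
    intro φ hφ
    refine eq_zero_of_inner_hermiteVec_eq_zero φ fun α => ?_
    exact (Submodule.mem_orthogonal _ _).1 hφ _ (Submodule.subset_span ⟨α, rfl⟩))
  have h := b.hasSum_repr φ
  simpa [b, HilbertBasis.repr_apply_apply] using h

theorem hermiteProj_eq_sum (k : ℕ) (φ : LTwo n) :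
    hermiteProj k φ = ∑ α ∈ Finset.piAntidiag (Finset.univ : Finset (Fin n)) k,
      inner ℂ (hermiteVec α) φ • hermiteVec α := by
  rw [hermiteProj]
  refine Submodule.eq_starProjection_of_mem_orthogonal ?_ ?_
  · refine Submodule.sum_mem _ fun α hα => Submodule.smul_mem _ _ (Submodule.subset_span ?_)
    exact ⟨α, hα, rfl⟩
  · rw [hermiteSpace, Submodule.mem_orthogonal]
    intro u hu
    induction hu using Submodule.span_induction with
    | mem u hu =>
      obtain ⟨α, hα, rfl⟩ := hu
      rw [inner_sub_right, (orthonormal_hermiteVec (n := n)).inner_right_sum _ hα, sub_self]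
    | zero => simp
    | add u v _ _ hu hv => rw [inner_add_left, hu, hv, add_zero]
    | smul a u _ hu => rw [inner_smul_left, hu, mul_zero]

theorem norm_hermiteProj_sq (k : ℕ) (φ : LTwo n) :
    ‖hermiteProj k φ‖ ^ 2 = ∑ α ∈ Finset.piAntidiag (Finset.univ : Finset (Fin n)) k,
      ‖inner ℂ (hermiteVec α) φ‖ ^ 2 := by
  rw [hermiteProj_eq_sum]
  have h := (orthonormal_hermiteVec (n := n)).inner_sum (fun α => inner ℂ (hermiteVec α) φ)
    (fun α => inner ℂ (hermiteVec α) φ) (Finset.piAntidiag (Finset.univ : Finset (Fin n)) k)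
  rw [inner_self_eq_norm_sq_to_K] at h
  simp_rw [RCLike.conj_mul] at h
  exact_mod_cast h

end HermiteSeveralVariables

end AnalyticVectors

/-! ### Cauchy estimates for power series on a torus. -/

section CauchyEstimate

theorem integral_fourier_mul_fourier_neg (m k : ℤ) :
    ∫ x : UnitAddCircle, fourier (-k) x * fourier m x ∂AddCircle.haarAddCircle =
      if m = k then 1 else 0 := by
  have h := orthonormal_iff_ite.1 (orthonormal_fourier (T := (1 : ℝ))) k m
  rw [fourierLp, fourierLp, ContinuousMap.inner_toLp] at h
  simp_rw [eq_comm (a := m)]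
  rw [← h]
  refine integral_congr_ae (Eventually.of_forall fun x => ?_)
  simp [mul_comm]

/-- Cauchy's estimate for the coefficients of a power series in several variables. -/
theorem norm_coeff_mul_prod_pow_le {n : ℕ} (A : (Fin n → ℕ) → ℂ) (r : Fin n → ℝ)
    (hs : Summable fun β => ‖A β‖ * ∏ j, |r j| ^ β j) (B : ℝ)
    (hB : ∀ ζ : Fin n → ℂ, (∀ j, ‖ζ j‖ = |r j|) → ‖∑' β, A β * ∏ j, ζ j ^ β j‖ ≤ B)
    (β : Fin n → ℕ) : ‖A β‖ * ∏ j, |r j| ^ β j ≤ B := by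
  set μ : Measure (Fin n → UnitAddCircle) := Measure.pi fun _ => AddCircle.haarAddCircle with hμ
  set ζ : (Fin n → UnitAddCircle) → Fin n → ℂ := fun x j => (r j : ℂ) * fourier 1 (x j) with hζ
  have hfn : ∀ (k : ℤ) (x : UnitAddCircle), ‖fourier k x‖ = 1 := fun k x => by
    rw [fourier_apply]
    exact Circle.norm_coe _
  have hζn : ∀ x j, ‖ζ x j‖ = |r j| := by
    intro x j
    rw [hζ, norm_mul, hfn, mul_one, Complex.norm_real, Real.norm_eq_abs]
  have hF : ∀ γ x, (∏ j, fourier (-(β j : ℤ)) (x j)) * (A γ * ∏ j, ζ x j ^ γ j) =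
      (A γ * ∏ j, (r j : ℂ) ^ γ j) * ∏ j, (fourier (-(β j : ℤ)) (x j) * fourier (γ j : ℤ) (x j)) := by
    intro γ x
    have : ∀ j, ζ x j ^ γ j = (r j : ℂ) ^ γ j * fourier (γ j : ℤ) (x j) := by
      intro j
      simp only [hζ, mul_pow, fourier_apply]
      congr 1
      rw [← Circle.coe_pow, ← AddCircle.toCircle_nsmul]
      simp
    simp_rw [this]
    rw [Finset.prod_mul_distrib, Finset.prod_mul_distrib]
    ring
  have hcont : ∀ γ, Continuous fun x : Fin n → UnitAddCircle =>
      (∏ j, fourier (-(β j : ℤ)) (x j)) * (A γ * ∏ j, ζ x j ^ γ j) := by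
    intro γ
    simp only [hζ]
    fun_prop
  have hnorm : ∀ γ x, ‖(∏ j, fourier (-(β j : ℤ)) (x j)) * (A γ * ∏ j, ζ x j ^ γ j)‖ =
      ‖A γ‖ * ∏ j, |r j| ^ γ j := by
    intro γ x
    rw [norm_mul, norm_mul, norm_prod, norm_prod]
    simp_rw [norm_pow, hζn, hfn]
    rw [Finset.prod_const_one, one_mul]
  -- Integrating against the character of frequency -β isolates the coefficient of index β. The
  -- terms have constant modulus on the torus, so absolute summability permits the exchange of sum
  -- and integral.
  have hsum := hasSum_integral_of_summable_integral_norm (μ := μ)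
    (F := fun γ x => (∏ j, fourier (-(β j : ℤ)) (x j)) * (A γ * ∏ j, ζ x j ^ γ j))
    (fun γ => Integrable.of_bound (hcont γ).aestronglyMeasurable (‖A γ‖ * ∏ j, |r j| ^ γ j)
      (Eventually.of_forall fun x => (hnorm γ x).le))
    (by simpa only [hnorm, integral_const, probReal_univ, one_smul] using hs)
  have hinteg : ∀ γ, ∫ x, (∏ j, fourier (-(β j : ℤ)) (x j)) * (A γ * ∏ j, ζ x j ^ γ j) ∂μ =
      if γ = β then A β * ∏ j, (r j : ℂ) ^ β j else 0 := by
    intro γ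
    simp_rw [hF]
    rw [integral_const_mul, hμ, integral_fintype_prod_eq_prod
      (fun j x => fourier (-(β j : ℤ)) x * fourier (γ j : ℤ) x)]
    simp_rw [integral_fourier_mul_fourier_neg]
    by_cases h : γ = β
    · simp [h]
    · rw [if_neg h]
      obtain ⟨j, hj⟩ := Function.ne_iff.1 h
      exact mul_eq_zero_of_right _
        (Finset.prod_eq_zero (Finset.mem_univ j) (if_neg (by exact_mod_cast hj)))
  simp_rw [hinteg] at hsum
  have h1 := hsum.unique (hasSum_ite_eq β _)
  have h2 : ‖∫ x, ∑' γ, (∏ j, fourier (-(β j : ℤ)) (x j)) * (A γ * ∏ j, ζ x j ^ γ j) ∂μ‖ ≤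
      B * μ.real univ := by
    refine norm_integral_le_of_norm_le_const (Eventually.of_forall fun x => ?_)
    rw [tsum_mul_left, norm_mul, norm_prod]
    simp_rw [hfn]
    rw [Finset.prod_const_one, one_mul]
    exact hB (ζ x) (hζn x)
  rw [h1, probReal_univ, mul_one, norm_mul, norm_prod] at h2
  simpa using h2

end CauchyEstimate

/-! ### Binomial sums and a crude Stirling bound. -/

section Combinatorics

/-- A weighted Vandermonde identity: expand (X + 1)^{Σγ} as one power and as a product of powers,
then apply the linear functional that sends X^j to w j. -/
theorem sum_choose_mul_eq_sum_prod_choose {n : ℕ} (γ : Fin n → ℕ) (w : ℕ → ℝ) :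
    ∑ j ∈ Finset.range ((∑ i, γ i) + 1), ((∑ i, γ i).choose j : ℝ) * w j =
      ∑ β ∈ Fintype.piFinset fun i => Finset.range (γ i + 1),
        (∏ i, ((γ i).choose (β i) : ℝ)) * w (∑ i, β i) := by
  let L : Polynomial ℝ →ₗ[ℝ] ℝ := Polynomial.lsum fun j => w j • LinearMap.id
  have hL : ∀ (j : ℕ) (a : ℝ), L (Polynomial.monomial j a) = a * w j := by
    intro j a
    simp [L, Polynomial.lsum_apply, Polynomial.sum_monomial_index, mul_comm]
  have hpow : ∀ k : ℕ, (Polynomial.X + 1 : Polynomial ℝ) ^ k =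
      ∑ j ∈ Finset.range (k + 1), Polynomial.monomial j (k.choose j : ℝ) := by
    intro k
    rw [add_pow]
    refine Finset.sum_congr rfl fun j _ => ?_
    rw [one_pow, mul_one, ← Polynomial.C_mul_X_pow_eq_monomial, mul_comm]
    simp
  have h : (Polynomial.X + 1 : Polynomial ℝ) ^ (∑ i, γ i) =
      ∏ i, (Polynomial.X + 1 : Polynomial ℝ) ^ γ i := (Finset.prod_pow_eq_pow_sum _ _ _).symm
  simp_rw [hpow] at h
  rw [Finset.prod_univ_sum] at h
  have h2 := congrArg L h
  simp only [map_sum, hL] at h2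
  rw [h2]
  refine Finset.sum_congr rfl fun β _ => ?_
  rw [← hL]
  congr 1
  have key : ∀ (s : Finset (Fin n)), ∏ i ∈ s, Polynomial.monomial (β i) ((γ i).choose (β i) : ℝ) =
      Polynomial.monomial (∑ i ∈ s, β i) (∏ i ∈ s, ((γ i).choose (β i) : ℝ)) := by
    intro s
    induction s using Finset.cons_induction with
    | empty => simp
    | cons a s ha ih =>
      rw [Finset.prod_cons, ih, Polynomial.monomial_mul_monomial, Finset.sum_cons,
        Finset.prod_cons]
  exact key _

/-- This is 1 + x ≤ e^x at x = -1/(b+1), raised to the power b + 1. It drives the induction for the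
factorial bound. -/
theorem exp_one_mul_pow_succ_le (b : ℕ) :
    Real.exp 1 * (b : ℝ) ^ (b + 1) ≤ ((b : ℝ) + 1) ^ (b + 1) := by
  have hb : (0 : ℝ) < (b : ℝ) + 1 := by positivity
  have h1 : (b : ℝ) / (b + 1) ≤ Real.exp (-1 / (b + 1)) := by
    have := Real.add_one_le_exp (-1 / ((b : ℝ) + 1))
    refine le_trans (le_of_eq ?_) this
    field_simp
    ring
  have h2 : ((b : ℝ) / (b + 1)) ^ (b + 1) ≤ Real.exp (-1) := by
    refine (pow_le_pow_left₀ (by positivity) h1 _).trans (le_of_eq ?_)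
    rw [← Real.exp_nat_mul]
    congr 1
    push_cast
    field_simp
  rw [div_pow, div_le_iff₀ (by positivity), Real.exp_neg] at h2
  have h3 := mul_le_mul_of_nonneg_left h2 (Real.exp_pos 1).le
  rwa [← mul_assoc, mul_inv_cancel₀ (Real.exp_pos 1).ne', one_mul] at h3

/-- A crude form of Stirling's upper bound. -/
theorem factorial_mul_exp_le (b : ℕ) :
    (b.factorial : ℝ) * Real.exp b ≤ Real.exp 1 * (b + 1) * (b : ℝ) ^ b := by
  have key : ∀ c : ℕ, ((c + 1).factorial : ℝ) * Real.exp ((c : ℝ) + 1) ≤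
      Real.exp 1 * (c + 1) * ((c : ℝ) + 1) ^ (c + 1) := by
    intro c
    induction c with
    | zero => simp
    | succ c ih =>
      have h := exp_one_mul_pow_succ_le (c + 1)
      rw [Nat.factorial_succ]
      push_cast at h ⊢
      rw [Real.exp_add ((c : ℝ) + 1) 1]
      have hc : (0 : ℝ) ≤ (c : ℝ) + 1 + 1 := by positivity
      calc ((c : ℝ) + 1 + 1) * ((c + 1).factorial : ℝ) * (Real.exp ((c : ℝ) + 1) * Real.exp 1)
          = (((c + 1).factorial : ℝ) * Real.exp ((c : ℝ) + 1)) * (((c : ℝ) + 1 + 1) * Real.exp 1) := by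
            ring
        _ ≤ (Real.exp 1 * (c + 1) * ((c : ℝ) + 1) ^ (c + 1)) * (((c : ℝ) + 1 + 1) * Real.exp 1) := by
            gcongr
        _ = Real.exp 1 * ((c : ℝ) + 1 + 1) * (Real.exp 1 * ((c : ℝ) + 1) ^ (c + 1 + 1)) := by ring
        _ ≤ _ := by gcongr
  cases b with
  | zero =>
    simp
  | succ c =>
    have h := key c
    push_cast
    refine h.trans ?_
    have : (0 : ℝ) ≤ (c : ℝ) := c.cast_nonneg
    gcongr
    linarith

theorem summable_geometric_mul_add_one {q : ℝ} (hq0 : 0 ≤ q) (hq : q < 1) :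
    Summable fun b : ℕ => q ^ b * (Real.exp 1 * (b + 1)) := by
  have h1 := summable_pow_mul_geometric_of_norm_lt_one 1 (r := q)
    (by rwa [Real.norm_of_nonneg hq0])
  have h2 := summable_geometric_of_lt_one hq0 hq
  refine ((h1.add h2).mul_left (Real.exp 1)).congr fun b => ?_
  simp only [pow_one]
  ring

end Combinatorics

/-! ### Laguerre weights and a criterion for membership in V_s^ω. -/

namespace AnalyticVectors

variable {n : ℕ}

/-- The weight `∑ⱼ binom(k, j) (n-1)! / (n-1+j)! xʲ`, a normalized Laguerre polynomial. -/
noncomputable def hermiteWeight (n k : ℕ) (x : ℝ) : ℝ :=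
  ∑ j ∈ Finset.range (k + 1),
    (k.choose j : ℝ) * (((n - 1).factorial : ℝ) / ((n - 1 + j).factorial : ℝ)) * x ^ j

theorem hermiteWeight_nonneg (n k : ℕ) {x : ℝ} (hx : 0 ≤ x) : 0 ≤ hermiteWeight n k x :=
  Finset.sum_nonneg fun j _ => by positivity

theorem hermiteWeight_mono (n k : ℕ) {x y : ℝ} (hx : 0 ≤ x) (hxy : x ≤ y) :
    hermiteWeight n k x ≤ hermiteWeight n k y :=
  Finset.sum_le_sum fun j _ => by gcongr

/-- Squaring 2iy makes the Laguerre argument equal to -2(|y|² + |v|²), so its sign cancels the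
alternating signs and only positive terms remain. The factorial normalization turns the coefficients
into binomials of k. -/
theorem factorial_mul_laguerreFun (hn : 0 < n) (k : ℕ) (y v : RSpace n) :
    (((k.factorial : ℝ) * ((n - 1).factorial : ℝ) / ((k + n - 1).factorial : ℝ) : ℝ) : ℂ) *
        laguerreFun k (n - 1) ((2 * Complex.I) • toComplex y) ((2 * Complex.I) • toComplex v) =
      ((hermiteWeight n k (2 * (‖y‖ ^ 2 + ‖v‖ ^ 2)) * Real.exp (‖y‖ ^ 2 + ‖v‖ ^ 2) : ℝ) : ℂ) := by
  have hsq : ∀ y : RSpace n, ∑ j, ((2 * Complex.I) • toComplex y) j ^ 2 =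
      ((-4 * ‖y‖ ^ 2 : ℝ) : ℂ) := by
    intro y
    rw [EuclideanSpace.real_norm_sq_eq]
    push_cast
    rw [Finset.mul_sum]
    refine Finset.sum_congr rfl fun j _ => ?_
    simp only [PiLp.smul_apply, smul_eq_mul, toComplex, mul_pow, Complex.I_sq]
    ring
  rw [laguerreFun, hsq, hsq]
  have e1 : (1 / 2 : ℂ) * (((-4 * ‖y‖ ^ 2 : ℝ) : ℂ) + ((-4 * ‖v‖ ^ 2 : ℝ) : ℂ)) =
      -((2 * (‖y‖ ^ 2 + ‖v‖ ^ 2) : ℝ) : ℂ) := by push_cast; ring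
  have e2 : -(1 / 4 : ℂ) * (((-4 * ‖y‖ ^ 2 : ℝ) : ℂ) + ((-4 * ‖v‖ ^ 2 : ℝ) : ℂ)) =
      ((‖y‖ ^ 2 + ‖v‖ ^ 2 : ℝ) : ℂ) := by push_cast; ring
  rw [e1, e2, ← Complex.ofReal_exp, ← mul_assoc, Complex.ofReal_mul (hermiteWeight _ _ _)]
  congr 1
  generalize 2 * (‖y‖ ^ 2 + ‖v‖ ^ 2) = x
  rw [laguerre, hermiteWeight, Complex.ofReal_sum, Finset.mul_sum]
  refine Finset.sum_congr rfl fun j hj => ?_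
  have hjk : j ≤ k := Nat.lt_succ_iff.1 (Finset.mem_range.1 hj)
  have e3 : (-1 : ℂ) ^ j * ((k + (n - 1)).choose (k - j) : ℂ) * (-(x : ℂ)) ^ j / (j.factorial : ℂ) =
      ((((k + (n - 1)).choose (k - j) : ℝ) * x ^ j / (j.factorial : ℝ) : ℝ) : ℂ) := by
    rw [neg_pow (x : ℂ)]
    have : (-1 : ℂ) ^ j * (-1) ^ j = 1 := by rw [← mul_pow]; simp
    push_cast
    linear_combination (((k + (n - 1)).choose (k - j) : ℂ) * (x : ℂ) ^ j / (j.factorial : ℂ)) * this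
  rw [e3, ← Complex.ofReal_mul]
  congr 1
  have h1 := Nat.choose_mul_factorial_mul_factorial (n := k + (n - 1)) (k := k - j) (by lia)
  have h2 := Nat.choose_mul_factorial_mul_factorial hjk
  have h3 : k + (n - 1) - (k - j) = n - 1 + j := by lia
  have h4 : k + n - 1 = k + (n - 1) := by lia
  rw [h3] at h1
  rw [h4]
  have h1' : ((k + (n - 1)).choose (k - j) : ℝ) * ((k - j).factorial : ℝ) *
    ((n - 1 + j).factorial : ℝ) = ((k + (n - 1)).factorial : ℝ) := by exact_mod_cast h1
  have h2' : (k.choose j : ℝ) * (j.factorial : ℝ) * ((k - j).factorial : ℝ) = (k.factorial : ℝ) := by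
    exact_mod_cast h2
  rw [← h1', ← h2']
  have p1 : ((k - j).factorial : ℝ) ≠ 0 := by exact_mod_cast (k - j).factorial_ne_zero
  have p2 : ((n - 1 + j).factorial : ℝ) ≠ 0 := by exact_mod_cast (n - 1 + j).factorial_ne_zero
  have p3 : (j.factorial : ℝ) ≠ 0 := by exact_mod_cast j.factorial_ne_zero
  have p4 : ((k + (n - 1)).choose (k - j) : ℝ) ≠ 0 := by
    exact_mod_cast (Nat.choose_pos (by lia)).ne'
  field_simp

/-- The terms depend only on |y|² + |v|² and increase with it, so the family of conditions reduces
to the extremal value t². That value is attained at a multiple of a basis vector, which needs n > 0.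
-/
theorem mem_VOmega_iff (hn : 0 < n) {t : ℝ} (ht : 0 ≤ t) (φ : LTwo n) :
    φ ∈ VOmega n t ↔
      Summable fun k : ℕ => ‖hermiteProj k φ‖ ^ 2 * hermiteWeight n k (2 * t ^ 2) := by
  have key : ∀ (y v : RSpace n) (k : ℕ),
      ((‖hermiteProj k φ‖ ^ 2 * ((k.factorial : ℝ) * ((n - 1).factorial : ℝ) /
        ((k + n - 1).factorial : ℝ)) : ℝ) : ℂ) *
        laguerreFun k (n - 1) ((2 * Complex.I) • toComplex y) ((2 * Complex.I) • toComplex v) =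
      ((Real.exp (‖y‖ ^ 2 + ‖v‖ ^ 2) *
        (‖hermiteProj k φ‖ ^ 2 * hermiteWeight n k (2 * (‖y‖ ^ 2 + ‖v‖ ^ 2))) : ℝ) : ℂ) := by
    intro y v k
    rw [Complex.ofReal_mul, mul_assoc, factorial_mul_laguerreFun hn]
    push_cast
    ring
  have hiff : ∀ y v : RSpace n, (Summable fun k : ℕ =>
      ((‖hermiteProj k φ‖ ^ 2 * ((k.factorial : ℝ) * ((n - 1).factorial : ℝ) /
        ((k + n - 1).factorial : ℝ)) : ℝ) : ℂ) *
        laguerreFun k (n - 1) ((2 * Complex.I) • toComplex y) ((2 * Complex.I) • toComplex v)) ↔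
      Summable fun k : ℕ => ‖hermiteProj k φ‖ ^ 2 * hermiteWeight n k (2 * (‖y‖ ^ 2 + ‖v‖ ^ 2)) := by
    intro y v
    simp_rw [key]
    rw [Complex.summable_ofReal, summable_mul_left_iff (Real.exp_pos _).ne']
  constructor
  · intro h
    set y : RSpace n := EuclideanSpace.single ⟨0, hn⟩ t with hy
    have hyn : ‖y‖ = t := by rw [hy, PiLp.norm_single, Real.norm_of_nonneg ht]
    have h1 := (hiff y 0).1 (h y 0 (by simp [hyn]))
    simpa [hyn] using h1
  · intro h y v hyv
    refine (hiff y v).2 (Summable.of_nonneg_of_le (fun k => ?_) (fun k => ?_) h)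
    · exact mul_nonneg (sq_nonneg _) (hermiteWeight_nonneg n k (by positivity))
    · exact mul_le_mul_of_nonneg_left
        (hermiteWeight_mono n k (by positivity) (by linarith)) (sq_nonneg _)

/-- The positive constant in `creationCoeff ζ α β`. -/
noncomputable def creationConst (α β : Fin n → ℕ) : ℝ :=
  ∏ j, (√2 ^ (β j) / ((β j).factorial : ℝ) * √(((α j + β j).factorial : ℝ) / (α j).factorial))

theorem creationConst_nonneg (α β : Fin n → ℕ) : 0 ≤ creationConst α β :=
  Finset.prod_nonneg fun j _ => by positivity

theorem creationCoeff_eq (ζ : CSpace n) (α β : Fin n → ℕ) :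
    creationCoeff ζ α β = creationConst α β * ∏ j, ζ j ^ β j := by
  rw [creationCoeff, creationConst, Complex.ofReal_prod, ← Finset.prod_mul_distrib]
  refine Finset.prod_congr rfl fun j _ => ?_
  push_cast
  ring

theorem creationConst_sq (α β : Fin n → ℕ) :
    creationConst α β ^ 2 * ∏ j, ((β j).factorial : ℝ) =
      2 ^ (∑ j, β j) * ∏ j, ((α j + β j).choose (β j) : ℝ) := by
  rw [creationConst, ← Finset.prod_pow, ← Finset.prod_mul_distrib,
    ← Finset.prod_pow_eq_pow_sum, ← Finset.prod_mul_distrib]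
  refine Finset.prod_congr rfl fun j _ => ?_
  have h := Nat.add_choose_mul_factorial_mul_factorial (α j) (β j)
  have h' : ((α j + β j).factorial : ℝ) =
      ((α j + β j).choose (β j) : ℝ) * (α j).factorial * (β j).factorial := by exact_mod_cast h.symm
  have ha : ((α j).factorial : ℝ) ≠ 0 := by exact_mod_cast (α j).factorial_ne_zero
  have hb : ((β j).factorial : ℝ) ≠ 0 := by exact_mod_cast (β j).factorial_ne_zero
  have h2 : (√2 ^ β j) ^ 2 = 2 ^ β j := by
    rw [← pow_mul, mul_comm, pow_mul, Real.sq_sqrt (by norm_num)]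
  rw [mul_pow, div_pow, h2, Real.sq_sqrt (by positivity), h']
  field_simp

/-- The matrix coefficients of the annihilation operators are controlled by the exponentials of
those operators. -/
theorem sum_creationConst_sq_le (φ : LTwo n) {t M : ℝ}
    (hK : ∀ ζ : CSpace n, ‖ζ‖ ^ 2 ≤ t ^ 2 → ∀ (S : Finset (Fin n → ℕ)) (d : (Fin n → ℕ) → ℂ),
      ‖∑ α ∈ S, d α * ∫ x, (φ : RSpace n → ℂ) x * creationFun ζ α x‖ ≤
        M * √(∑ α ∈ S, ‖d α‖ ^ 2))
    (r : Fin n → ℝ) (hr : ∑ j, r j ^ 2 ≤ t ^ 2) (S : Finset (Fin n → ℕ)) (β : Fin n → ℕ) :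
    (∑ α ∈ S, creationConst α β ^ 2 * ‖inner ℂ (hermiteVec (α + β)) φ‖ ^ 2) *
      ∏ j, (r j ^ 2) ^ β j ≤ M ^ 2 := by
  set w : (Fin n → ℕ) → (Fin n → ℕ) → ℂ :=
    fun α β => creationConst α β * inner ℂ (hermiteVec (α + β)) φ with hw
  -- These test coefficients make the β-th coefficient of the power series in ζ equal to Q, while
  -- the bound on the torus is M √Q.
  set d : (Fin n → ℕ) → ℂ := fun α => (starRingEnd ℂ) (w α β) with hd
  set Q : ℝ := ∑ α ∈ S, ‖d α‖ ^ 2 with hQ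
  have hQ0 : 0 ≤ Q := Finset.sum_nonneg fun α _ => sq_nonneg _
  have hQ' : ∑ α ∈ S, creationConst α β ^ 2 * ‖inner ℂ (hermiteVec (α + β)) φ‖ ^ 2 = Q := by
    refine Finset.sum_congr rfl fun α _ => ?_
    simp only [hd, hw, RCLike.norm_conj, norm_mul, Complex.norm_real, mul_pow,
      Real.norm_of_nonneg (creationConst_nonneg α β)]
  have hterm : ∀ (ζ : CSpace n) (α γ : Fin n → ℕ),
      creationCoeff ζ α γ * inner ℂ (hermiteVec (α + γ)) φ = w α γ * ∏ j, ζ j ^ γ j := by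
    intro ζ α γ
    rw [creationCoeff_eq, hw]
    ring
  have hsum : ∀ ζ : CSpace n, HasSum (fun γ => (∑ α ∈ S, d α * w α γ) * ∏ j, ζ j ^ γ j)
      (∑ α ∈ S, d α * ∫ x, (φ : RSpace n → ℂ) x * creationFun ζ α x) := by
    intro ζ
    have h := hasSum_sum (s := S) fun α _ =>
      (hasSum_integral_mul_creationFun φ ζ α).mul_left (d α)
    refine Eq.mpr (congrArg₂ (HasSum · ·) (funext fun γ => ?_) rfl) h
    rw [Finset.sum_mul]
    refine Finset.sum_congr rfl fun α _ => ?_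
    rw [hterm, mul_assoc]
  have hcauchy := norm_coeff_mul_prod_pow_le (fun γ => ∑ α ∈ S, d α * w α γ) r
    (by
      have h1 := ((hsum (WithLp.toLp 2 fun j => ((|r j| : ℝ) : ℂ))).summable.norm)
      refine h1.congr fun γ => ?_
      rw [norm_mul, norm_prod]
      simp)
    (M * √Q)
    (by
      intro ζ hζ
      have h1 := (hsum (WithLp.toLp 2 ζ)).tsum_eq
      simp only at h1
      rw [h1]
      refine hK _ ?_ S d
      rw [EuclideanSpace.norm_sq_eq]
      simp only [hζ, sq_abs]
      exact hr) β
  have hA : ∑ α ∈ S, d α * w α β = (Q : ℂ) := by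
    rw [hQ, Complex.ofReal_sum]
    refine Finset.sum_congr rfl fun α _ => ?_
    simp only [hd, RCLike.norm_conj]
    rw [Complex.conj_mul']
    push_cast
    rfl
  rw [hA, Complex.norm_real, Real.norm_of_nonneg hQ0] at hcauchy
  rw [hQ']
  set R := ∏ j, |r j| ^ β j with hR
  have hR2 : ∏ j, (r j ^ 2) ^ β j = R ^ 2 := by
    rw [hR, ← Finset.prod_pow]
    refine Finset.prod_congr rfl fun j _ => ?_
    rw [← sq_abs, ← pow_mul, ← pow_mul, mul_comm]
  have hR0 : 0 ≤ R := Finset.prod_nonneg fun j _ => by positivity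
  rw [hR2]
  -- Cauchy's estimate reads Q R ≤ M √Q, and one factor √Q is to be divided out.
  rcases hQ0.eq_or_lt with h0 | hpos
  · rw [← h0, zero_mul]
    positivity
  · have hs : 0 < √Q := Real.sqrt_pos.2 hpos
    have h1 : √Q * R ≤ M := by
      have e : Q * R = (√Q * R) * √Q := by
        nth_rewrite 1 [← Real.mul_self_sqrt hQ0]
        ring
      rw [e] at hcauchy
      exact le_of_mul_le_mul_right hcauchy hs
    calc Q * R ^ 2 = (√Q * R) ^ 2 := by rw [mul_pow, Real.sq_sqrt hQ0]
      _ ≤ M ^ 2 := by gcongr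

/-- Cauchy's estimate at the best polyradius gives ∏ β_j^{β_j} / m^m, with m = |β|, where β!/m! is
wanted. The two agree up to a factor e(β_j + 1) per coordinate, and passing from t to s leaves a
geometric factor that makes the bound summable in β. -/
theorem sum_prod_choose_mul_le (φ : LTwo n) {s t M : ℝ} (hs : 0 < s) (hst : s < t)
    (hK : ∀ ζ : CSpace n, ‖ζ‖ ^ 2 ≤ t ^ 2 → ∀ (S : Finset (Fin n → ℕ)) (d : (Fin n → ℕ) → ℂ),
      ‖∑ α ∈ S, d α * ∫ x, (φ : RSpace n → ℂ) x * creationFun ζ α x‖ ≤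
        M * √(∑ α ∈ S, ‖d α‖ ^ 2)) (S : Finset (Fin n → ℕ)) (β : Fin n → ℕ) :
    ∑ α ∈ S, ‖inner ℂ (hermiteVec (α + β)) φ‖ ^ 2 *
        ((∏ j, ((α j + β j).choose (β j) : ℝ)) *
          ((2 * s ^ 2) ^ (∑ j, β j) / ((∑ j, β j).factorial : ℝ))) ≤
      M ^ 2 * ∏ j, (((s / t) ^ 2) ^ β j * (Real.exp 1 * (β j + 1))) := by
  have ht : 0 < t := hs.trans hst
  set m := ∑ j, β j with hm
  have hmf : (0 : ℝ) < m.factorial := by exact_mod_cast m.factorial_pos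
  -- The radii t√(β_j/m) maximize ∏ r_j^{2β_j} under Σ r_j² ≤ t². For m = 0 division by zero makes
  -- all radii 0, which is harmless because every exponent is then 0.
  have hrsq : ∀ j, (t * √((β j : ℝ) / m)) ^ 2 = t ^ 2 * ((β j : ℝ) / m) := fun j => by
    rw [mul_pow, Real.sq_sqrt (by positivity)]
  have hr : ∑ j, (t * √((β j : ℝ) / m)) ^ 2 ≤ t ^ 2 := by
    simp_rw [hrsq]
    rw [← Finset.mul_sum, ← Finset.sum_div, ← Nat.cast_sum, ← hm]
    exact mul_le_of_le_one_right (sq_nonneg t) (div_self_le_one _)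
  have h1 := sum_creationConst_sq_le φ hK _ hr S β
  simp_rw [hrsq] at h1
  set Q := ∑ α ∈ S, creationConst α β ^ 2 * ‖inner ℂ (hermiteVec (α + β)) φ‖ ^ 2 with hQ
  have hQ0 : 0 ≤ Q := Finset.sum_nonneg fun α _ => by positivity
  have hL : ∑ α ∈ S, ‖inner ℂ (hermiteVec (α + β)) φ‖ ^ 2 *
        ((∏ j, ((α j + β j).choose (β j) : ℝ)) * ((2 * s ^ 2) ^ m / (m.factorial : ℝ))) =
      Q * ((∏ j, ((β j).factorial : ℝ)) * ((s ^ 2) ^ m / (m.factorial : ℝ))) := by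
    rw [hQ, Finset.sum_mul]
    refine Finset.sum_congr rfl fun α _ => ?_
    have h2 := creationConst_sq α β
    rw [← hm] at h2
    rw [mul_pow 2 (s ^ 2)]
    calc ‖inner ℂ (hermiteVec (α + β)) φ‖ ^ 2 * ((∏ j, ((α j + β j).choose (β j) : ℝ)) *
          (2 ^ m * (s ^ 2) ^ m / (m.factorial : ℝ)))
        = ‖inner ℂ (hermiteVec (α + β)) φ‖ ^ 2 * ((2 ^ m * ∏ j, ((α j + β j).choose (β j) : ℝ)) *
          ((s ^ 2) ^ m / (m.factorial : ℝ))) := by ring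
      _ = _ := by rw [← h2]; ring
  rw [hL]
  -- compare the factorials with the weights of the torus
  have hprod : (∏ j, ((β j).factorial : ℝ)) * Real.exp m ≤
      (∏ j, (Real.exp 1 * (β j + 1))) * ∏ j, (β j : ℝ) ^ β j := by
    rw [hm, Nat.cast_sum, Real.exp_sum, ← Finset.prod_mul_distrib, ← Finset.prod_mul_distrib]
    exact Finset.prod_le_prod (fun j _ => by positivity) fun j _ => factorial_mul_exp_le (β j)
  have hpow : (m : ℝ) ^ m ≤ Real.exp m * m.factorial := by
    have := Real.pow_div_factorial_le_exp (m : ℝ) m.cast_nonneg m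
    rwa [div_le_iff₀ hmf] at this
  have hmm : (0 : ℝ) < (m : ℝ) ^ m := by
    rcases Nat.eq_zero_or_pos m with h | h
    · simp [h]
    · have : (0 : ℝ) < m := by exact_mod_cast h
      positivity
  have hR : ∏ j, (t ^ 2 * ((β j : ℝ) / m)) ^ β j =
      (t ^ 2) ^ m * (∏ j, (β j : ℝ) ^ β j) / (m : ℝ) ^ m := by
    simp_rw [mul_pow, div_pow]
    rw [Finset.prod_mul_distrib, Finset.prod_div_distrib, Finset.prod_pow_eq_pow_sum,
      Finset.prod_pow_eq_pow_sum, ← hm, mul_div_assoc]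
  rw [hR] at h1
  set P := ∏ j, (β j : ℝ) ^ β j with hP
  set F := ∏ j, ((β j).factorial : ℝ) with hF
  set E := ∏ j, (Real.exp 1 * ((β j : ℝ) + 1)) with hE
  have hP0 : 0 ≤ P := Finset.prod_nonneg fun j _ => by positivity
  have hE0 : 0 ≤ E := Finset.prod_nonneg fun j _ => by positivity
  have hRHS : ∏ j, (((s / t) ^ 2) ^ β j * (Real.exp 1 * ((β j : ℝ) + 1))) =
      (s ^ 2) ^ m / (t ^ 2) ^ m * E := by
    rw [Finset.prod_mul_distrib, Finset.prod_pow_eq_pow_sum, ← hm, div_pow, div_pow]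
  rw [hRHS]
  have hFle : F / m.factorial ≤ E * (P / (m : ℝ) ^ m) := by
    rw [div_le_iff₀ hmf, mul_div_assoc', div_mul_eq_mul_div, le_div_iff₀ hmm]
    have hF0 : 0 ≤ F := Finset.prod_nonneg fun j _ => by positivity
    calc F * (m : ℝ) ^ m ≤ F * (Real.exp m * m.factorial) := by gcongr
      _ = (F * Real.exp m) * m.factorial := by ring
      _ ≤ _ := by gcongr
  have hsm : (0 : ℝ) < (s ^ 2) ^ m := by positivity
  have htm : (0 : ℝ) < (t ^ 2) ^ m := by positivity
  calc Q * (F * ((s ^ 2) ^ m / (m.factorial : ℝ)))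
      = Q * (s ^ 2) ^ m * (F / m.factorial) := by ring
    _ ≤ Q * (s ^ 2) ^ m * (E * (P / (m : ℝ) ^ m)) := by gcongr
    _ = (Q * ((t ^ 2) ^ m * P / (m : ℝ) ^ m)) * ((s ^ 2) ^ m / (t ^ 2) ^ m * E) := by
        field_simp
    _ ≤ M ^ 2 * ((s ^ 2) ^ m / (t ^ 2) ^ m * E) := by gcongr

/-- If the exponentials of the annihilation operators applied to `φ` are bounded on a ball, then
`φ` lies in the spaces `V_s^ω`. -/
theorem mem_VOmega_of_bounded (hn : 0 < n) (φ : LTwo n) {s t M : ℝ} (hs : 0 < s) (hst : s < t)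
    (hK : ∀ ζ : CSpace n, ‖ζ‖ ^ 2 ≤ t ^ 2 → ∀ (S : Finset (Fin n → ℕ)) (d : (Fin n → ℕ) → ℂ),
      ‖∑ α ∈ S, d α * ∫ x, (φ : RSpace n → ℂ) x * creationFun ζ α x‖ ≤
        M * √(∑ α ∈ S, ‖d α‖ ^ 2)) :
    φ ∈ VOmega n s := by
  classical
  have ht : 0 < t := hs.trans hst
  rw [mem_VOmega_iff hn hs.le]
  set u : (Fin n → ℕ) × (Fin n → ℕ) → ℝ := fun p =>
    ‖inner ℂ (hermiteVec (p.2 + p.1)) φ‖ ^ 2 *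
        ((∏ j, ((p.2 j + p.1 j).choose (p.1 j) : ℝ)) *
          ((2 * s ^ 2) ^ (∑ j, p.1 j) / ((∑ j, p.1 j).factorial : ℝ))) with hu
  have hu0 : 0 ≤ u := fun p => by
    simp only [hu, Pi.zero_apply]
    positivity
  have hbound := sum_prod_choose_mul_le φ hs hst hK
  have hfib : ∀ β, Summable fun α => u (β, α) := fun β =>
    summable_of_sum_le (fun α => hu0 (β, α)) fun S => hbound S β
  have hq : (s / t) ^ 2 < 1 := by
    rw [div_pow, div_lt_one (by positivity)]
    gcongr
  have hmaj : Summable fun β : Fin n → ℕ =>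
      M ^ 2 * ∏ j, (((s / t) ^ 2) ^ β j * (Real.exp 1 * ((β j : ℝ) + 1))) := by
    have h1 := summable_geometric_mul_add_one (q := (s / t) ^ 2) (by positivity) hq
    exact ((hasSum_prod_pi (fun _ : Fin n => fun b : ℕ => ((s / t) ^ 2) ^ b * (Real.exp 1 * ((b : ℝ) + 1)))
      _ (fun _ => h1.hasSum) fun _ => h1.norm).1.summable).mul_left _
  have hsum : Summable u := by
    rw [summable_prod_of_nonneg hu0]
    refine ⟨hfib, Summable.of_nonneg_of_le (fun β => tsum_nonneg fun α => hu0 (β, α))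
      (fun β => ?_) hmaj⟩
    exact Real.tsum_le_of_sum_le (fun α => hu0 (β, α)) fun S => hbound S β
  -- Bound (n-1)!/(n-1+j)! by 1/j!, then distribute the binomial over the coordinates by the
  -- Vandermonde identity.
  have hweight : ∀ γ : Fin n → ℕ, hermiteWeight n (∑ j, γ j) (2 * s ^ 2) ≤
      ∑ β ∈ Fintype.piFinset fun i => Finset.range (γ i + 1),
        (∏ i, ((γ i).choose (β i) : ℝ)) *
          ((2 * s ^ 2) ^ (∑ j, β j) / ((∑ j, β j).factorial : ℝ)) := by
    intro γ
    rw [← sum_choose_mul_eq_sum_prod_choose γ fun j => (2 * s ^ 2) ^ j / (j.factorial : ℝ),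
      hermiteWeight]
    refine Finset.sum_le_sum fun j _ => ?_
    rw [mul_assoc]
    refine mul_le_mul_of_nonneg_left ?_ (Nat.cast_nonneg _)
    have h1 : ((n - 1).factorial : ℝ) * j.factorial ≤ (n - 1 + j).factorial := by
      exact_mod_cast Nat.le_of_dvd (Nat.factorial_pos _)
        (Nat.factorial_mul_factorial_dvd_factorial_add (n - 1) j)
    have hj : (0 : ℝ) < j.factorial := by exact_mod_cast j.factorial_pos
    have hnj : (0 : ℝ) < (n - 1 + j).factorial := by exact_mod_cast (n - 1 + j).factorial_pos
    rw [div_mul_eq_mul_div, div_le_div_iff₀ hnj hj]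
    have hx : (0 : ℝ) ≤ (2 * s ^ 2) ^ j := by positivity
    nlinarith [mul_le_mul_of_nonneg_left h1 hx]
  have hg : Summable fun γ : Fin n → ℕ =>
      ‖inner ℂ (hermiteVec γ) φ‖ ^ 2 * hermiteWeight n (∑ j, γ j) (2 * s ^ 2) := by
    refine summable_of_sum_le (c := ∑' p, u p)
      (fun γ => mul_nonneg (sq_nonneg _) (hermiteWeight_nonneg _ _ (by positivity))) fun U => ?_
    -- Substitute γ = α + β. As β ≤ γ, subtraction is genuine and (γ, β) ↦ (β, γ - β) is injective,
    -- so the double sum is part of the convergent sum of u.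
    have h1 : ∑ γ ∈ U, ‖inner ℂ (hermiteVec γ) φ‖ ^ 2 * hermiteWeight n (∑ j, γ j) (2 * s ^ 2) ≤
        ∑ γ ∈ U, ∑ β ∈ Fintype.piFinset fun i => Finset.range (γ i + 1), u (β, γ - β) := by
      refine Finset.sum_le_sum fun γ _ => ?_
      refine (mul_le_mul_of_nonneg_left (hweight γ) (sq_nonneg _)).trans (le_of_eq ?_)
      rw [Finset.mul_sum]
      refine Finset.sum_congr rfl fun β hβ => ?_
      have hle : ∀ j, β j ≤ γ j := fun j =>
        Nat.lt_succ_iff.1 (Finset.mem_range.1 (Fintype.mem_piFinset.1 hβ j))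
      have e1 : γ - β + β = γ := funext fun j => Nat.sub_add_cancel (hle j)
      simp only [hu]
      have e2 : ∀ j, (γ - β) j + β j = γ j := fun j => congrFun e1 j
      simp_rw [e1, e2]
    refine h1.trans ?_
    rw [Finset.sum_sigma']
    have hinj : Set.InjOn (fun p : (_ : Fin n → ℕ) × (Fin n → ℕ) => (p.2, p.1 - p.2))
        (U.sigma fun γ => Fintype.piFinset fun i => Finset.range (γ i + 1) : Finset _) := by
      rintro ⟨γ, β⟩ h1 ⟨γ', β'⟩ h2 h
      simp only [Finset.coe_sigma, Set.mem_sigma_iff, Finset.mem_coe, Fintype.mem_piFinset,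
        Finset.mem_range] at h1 h2
      simp only [Prod.mk.injEq] at h
      obtain ⟨rfl, h⟩ := h
      have : γ = γ' := by
        funext j
        have e1 := congrFun h j
        simp only [Pi.sub_apply] at e1
        have e2 := h1.2 j
        have e3 := h2.2 j
        lia
      subst this
      rfl
    rw [← Finset.sum_image (f := u) hinj]
    exact hsum.sum_le_tsum _ fun p _ => hu0 p
  refine summable_of_sum_range_le (c := ∑' γ : Fin n → ℕ,
    ‖inner ℂ (hermiteVec γ) φ‖ ^ 2 * hermiteWeight n (∑ j, γ j) (2 * s ^ 2))
    (fun k => mul_nonneg (sq_nonneg _) (hermiteWeight_nonneg _ _ (by positivity))) fun K => ?_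
  have h2 : ∀ k, ‖hermiteProj k φ‖ ^ 2 * hermiteWeight n k (2 * s ^ 2) =
      ∑ γ ∈ Finset.piAntidiag (Finset.univ : Finset (Fin n)) k,
        ‖inner ℂ (hermiteVec γ) φ‖ ^ 2 * hermiteWeight n (∑ j, γ j) (2 * s ^ 2) := by
    intro k
    rw [norm_hermiteProj_sq, Finset.sum_mul]
    refine Finset.sum_congr rfl fun γ hγ => ?_
    rw [(Finset.mem_piAntidiag.1 hγ).1]
  simp_rw [h2]
  rw [← Finset.sum_biUnion]
  · exact hg.sum_le_tsum _ fun γ _ =>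
      mul_nonneg (sq_nonneg _) (hermiteWeight_nonneg _ _ (by positivity))
  · intro k _ l _ hkl
    rw [Function.onFun, Finset.disjoint_left]
    intro γ h1 h2
    exact hkl ((Finset.mem_piAntidiag.1 h1).1.symm.trans (Finset.mem_piAntidiag.1 h2).1)

/-! ### Growth of the weights and of the Hermite functions -/

theorem one_le_hermiteWeight (n k : ℕ) {x : ℝ} (hx : 0 ≤ x) : 1 ≤ hermiteWeight n k x := by
  have h := Finset.single_le_sum (f := fun j => (k.choose j : ℝ) *
    (((n - 1).factorial : ℝ) / ((n - 1 + j).factorial : ℝ)) * x ^ j)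
    (fun j _ => by positivity) (Finset.mem_range.2 (Nat.succ_pos k))
  have hf : ((n - 1).factorial : ℝ) ≠ 0 := by exact_mod_cast (n - 1).factorial_ne_zero
  simpa [hermiteWeight, hf] using h

/-- For large k a single term of the weight already has this size: the terms behave like
(2kt²)^j/(j!)², which is largest near j = t√(2k). -/
theorem exp_le_mul_hermiteWeight (hn : 0 < n) {t : ℝ} (ht : 0 < t) (k : ℕ) :
    Real.exp (2 * t * √(2 * k)) ≤
      Real.exp (8 * t ^ 2 + 4) * ((k : ℝ) + n) ^ (n + 1) * hermiteWeight n k (2 * t ^ 2) := by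
  have hn1 : (1 : ℝ) ≤ n := by exact_mod_cast hn
  have hk0 : (0 : ℝ) ≤ k := k.cast_nonneg
  have hw := one_le_hermiteWeight n k (show 0 ≤ 2 * t ^ 2 by positivity)
  have hlam : √(2 * (k : ℝ)) ^ 2 = 2 * k := Real.sq_sqrt (by positivity)
  have hlam0 : 0 ≤ √(2 * (k : ℝ)) := Real.sqrt_nonneg _
  have hp : (1 : ℝ) ≤ ((k : ℝ) + n) ^ (n + 1) := one_le_pow₀ (by linarith)
  -- For small k the left side is bounded and the weight is at least 1. For k ≥ 8t² the index chosen
  -- below satisfies 2j ≤ k.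
  rcases lt_or_ge (k : ℝ) (8 * t ^ 2) with hk | hk
  · have h1 : √(2 * (k : ℝ)) ≤ 4 * t := by
      rw [Real.sqrt_le_left (by positivity)]
      nlinarith
    have h2 : 2 * t * √(2 * k) ≤ 8 * t ^ 2 + 4 := by nlinarith
    calc Real.exp (2 * t * √(2 * k)) ≤ Real.exp (8 * t ^ 2 + 4) * 1 * 1 := by
          rw [mul_one, mul_one]
          exact Real.exp_le_exp.2 h2
      _ ≤ _ := by gcongr
  set j := ⌊t * √(2 * (k : ℝ))⌋₊ with hj
  have hj1 : (j : ℝ) ≤ t * √(2 * k) := Nat.floor_le (by positivity)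
  have hj2 : t * √(2 * k) < j + 1 := Nat.lt_floor_add_one _
  have hj0 : (0 : ℝ) ≤ j := j.cast_nonneg
  have hjsq : (j : ℝ) ^ 2 ≤ 2 * k * t ^ 2 := by
    have := pow_le_pow_left₀ hj0 hj1 2
    rw [mul_pow, hlam] at this
    linarith
  have hkpos : (0 : ℝ) < k := lt_of_lt_of_le (by positivity) hk
  have hjk : 2 * (j : ℝ) ≤ k := by
    have h1 : (2 * (j : ℝ)) ^ 2 ≤ (k : ℝ) ^ 2 := by nlinarith
    exact le_of_sq_le_sq h1 hk0
  have hjk' : j ≤ k := by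
    have : (j : ℝ) ≤ k := by linarith
    exact_mod_cast this
  have hterm : (k.choose j : ℝ) * (((n - 1).factorial : ℝ) / ((n - 1 + j).factorial : ℝ)) *
      (2 * t ^ 2) ^ j ≤ hermiteWeight n k (2 * t ^ 2) :=
    Finset.single_le_sum (f := fun j => (k.choose j : ℝ) *
      (((n - 1).factorial : ℝ) / ((n - 1 + j).factorial : ℝ)) * (2 * t ^ 2) ^ j)
      (fun j _ => by positivity) (Finset.mem_range.2 (Nat.lt_succ_of_le hjk'))
  have hjf : (0 : ℝ) < j.factorial := by exact_mod_cast j.factorial_pos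
  have hnf : (1 : ℝ) ≤ (n - 1).factorial := by exact_mod_cast (n - 1).factorial_pos
  have hnjf : (0 : ℝ) < (n - 1 + j).factorial := by exact_mod_cast (n - 1 + j).factorial_pos
  have hchoose : ((k : ℝ) - j) ^ j ≤ (k.choose j : ℝ) * j.factorial := by
    have h1 : (k - j) ^ j ≤ k.descFactorial j :=
      (Nat.pow_le_pow_left (by lia) j).trans (Nat.pow_sub_le_descFactorial k j)
    rw [Nat.descFactorial_eq_factorial_mul_choose, mul_comm] at h1
    rw [← Nat.cast_sub hjk']
    exact_mod_cast h1
  have hfac : ((n - 1 + j).factorial : ℝ) ≤ j.factorial * ((k : ℝ) + n) ^ (n - 1) := by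
    have h1 := Nat.factorial_mul_ascFactorial j (n - 1)
    have h2 := Nat.ascFactorial_le_pow_add j (n - 1)
    have h3 : (n - 1 + j).factorial ≤ j.factorial * (k + n) ^ (n - 1) := by
      rw [add_comm (n - 1) j, ← h1]
      exact Nat.mul_le_mul_left _ (h2.trans (Nat.pow_le_pow_left (by lia) _))
    exact_mod_cast h3
  -- (k/(k-j))^j ≤ exp(j²/(k-j)), and j² ≤ 2kt² together with k - j ≥ k/2 bounds the exponent by
  -- 4t².
  have hexp : (k : ℝ) ^ j ≤ Real.exp (4 * t ^ 2) * ((k : ℝ) - j) ^ j := by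
    have hkj : 0 < (k : ℝ) - j := by linarith
    have h1 : (k : ℝ) ≤ ((k : ℝ) - j) * Real.exp (j / (k - j)) := by
      have := Real.add_one_le_exp ((j : ℝ) / (k - j))
      calc (k : ℝ) = ((k : ℝ) - j) * (j / (k - j) + 1) := by field_simp; ring
        _ ≤ _ := by gcongr
    calc (k : ℝ) ^ j ≤ (((k : ℝ) - j) * Real.exp (j / (k - j))) ^ j := by gcongr
      _ = Real.exp (j * (j / (k - j))) * ((k : ℝ) - j) ^ j := by
          rw [mul_pow, ← Real.exp_nat_mul, mul_comm]
      _ ≤ _ := by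
          refine mul_le_mul_of_nonneg_right (Real.exp_le_exp.2 ?_) (pow_nonneg hkj.le _)
          rw [mul_div_assoc', div_le_iff₀ hkj]
          nlinarith
  have hstir := factorial_mul_exp_le j
  have hjj : (j : ℝ) ^ j * (j : ℝ) ^ j ≤ (2 * t ^ 2) ^ j * (k : ℝ) ^ j := by
    rw [← mul_pow, ← mul_pow]
    refine pow_le_pow_left₀ (by positivity) ?_ j
    linarith
  have hjn : (j : ℝ) + 1 ≤ (k : ℝ) + n := by linarith
  have hA : Real.exp j * Real.exp j ≤ Real.exp (4 * t ^ 2 + 2) * ((k : ℝ) + n) ^ (n + 1) *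
      ((k.choose j : ℝ) * (((n - 1).factorial : ℝ) / ((n - 1 + j).factorial : ℝ)) *
        (2 * t ^ 2) ^ j) := by
    have e1 : ((j.factorial : ℝ) * Real.exp j) * ((j.factorial : ℝ) * Real.exp j) ≤
        (Real.exp 1 * (j + 1) * (j : ℝ) ^ j) * (Real.exp 1 * (j + 1) * (j : ℝ) ^ j) := by gcongr
    have e2 : (Real.exp 1 * (j + 1) * (j : ℝ) ^ j) * (Real.exp 1 * (j + 1) * (j : ℝ) ^ j) ≤
        Real.exp 2 * ((k : ℝ) + n) ^ 2 * ((2 * t ^ 2) ^ j * (k : ℝ) ^ j) := by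
      have : Real.exp 2 = Real.exp 1 * Real.exp 1 := by rw [← Real.exp_add]; norm_num
      calc (Real.exp 1 * (j + 1) * (j : ℝ) ^ j) * (Real.exp 1 * (j + 1) * (j : ℝ) ^ j)
          = Real.exp 2 * ((j : ℝ) + 1) ^ 2 * ((j : ℝ) ^ j * (j : ℝ) ^ j) := by rw [this]; ring
        _ ≤ _ := by gcongr
    have e3 : Real.exp 2 * ((k : ℝ) + n) ^ 2 * ((2 * t ^ 2) ^ j * (k : ℝ) ^ j) ≤
        Real.exp 2 * ((k : ℝ) + n) ^ 2 * ((2 * t ^ 2) ^ j *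
          (Real.exp (4 * t ^ 2) * ((k.choose j : ℝ) * j.factorial))) := by
      gcongr
      exact hexp.trans (by gcongr)
    have e4 := e1.trans (e2.trans e3)
    have e5 : Real.exp j * Real.exp j * ((j.factorial : ℝ) * j.factorial) ≤
        (Real.exp (4 * t ^ 2 + 2) * ((k : ℝ) + n) ^ 2 * ((2 * t ^ 2) ^ j * (k.choose j : ℝ))) *
          j.factorial := by
      rw [Real.exp_add]
      linarith
    have e6 : Real.exp j * Real.exp j * (j.factorial : ℝ) ≤
        Real.exp (4 * t ^ 2 + 2) * ((k : ℝ) + n) ^ 2 * ((2 * t ^ 2) ^ j * (k.choose j : ℝ)) := by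
      rw [← mul_assoc] at e5
      exact le_of_mul_le_mul_right e5 hjf
    have e7 : Real.exp j * Real.exp j * ((n - 1 + j).factorial : ℝ) ≤
        Real.exp (4 * t ^ 2 + 2) * ((k : ℝ) + n) ^ (n + 1) * ((2 * t ^ 2) ^ j * (k.choose j : ℝ)) := by
      have en : n + 1 = 2 + (n - 1) := by lia
      rw [en, pow_add]
      calc Real.exp j * Real.exp j * ((n - 1 + j).factorial : ℝ)
          ≤ Real.exp j * Real.exp j * (j.factorial * ((k : ℝ) + n) ^ (n - 1)) := by gcongr
        _ = (Real.exp j * Real.exp j * j.factorial) * ((k : ℝ) + n) ^ (n - 1) := by ring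
        _ ≤ (Real.exp (4 * t ^ 2 + 2) * ((k : ℝ) + n) ^ 2 * ((2 * t ^ 2) ^ j * (k.choose j : ℝ))) *
            ((k : ℝ) + n) ^ (n - 1) := by gcongr
        _ = _ := by ring
    rw [← le_div_iff₀ hnjf] at e7
    refine e7.trans ?_
    rw [div_le_iff₀ hnjf]
    have e8 : 0 ≤ Real.exp (4 * t ^ 2 + 2) * ((k : ℝ) + n) ^ (n + 1) *
      ((2 * t ^ 2) ^ j * (k.choose j : ℝ)) := by positivity
    calc Real.exp (4 * t ^ 2 + 2) * ((k : ℝ) + n) ^ (n + 1) * ((2 * t ^ 2) ^ j * (k.choose j : ℝ))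
        ≤ Real.exp (4 * t ^ 2 + 2) * ((k : ℝ) + n) ^ (n + 1) * ((2 * t ^ 2) ^ j * (k.choose j : ℝ)) *
          (n - 1).factorial := le_mul_of_one_le_right e8 hnf
      _ = _ := by field_simp
  -- Rounding t√(2k) down to j costs less than 1 in each of the two exponents.
  calc Real.exp (2 * t * √(2 * k)) ≤ Real.exp 2 * (Real.exp j * Real.exp j) := by
        rw [← Real.exp_add, ← Real.exp_add]
        refine Real.exp_le_exp.2 ?_
        linarith
    _ ≤ Real.exp 2 * (Real.exp (4 * t ^ 2 + 2) * ((k : ℝ) + n) ^ (n + 1) *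
        hermiteWeight n k (2 * t ^ 2)) := by
        refine mul_le_mul_of_nonneg_left (hA.trans ?_) (Real.exp_nonneg _)
        exact mul_le_mul_of_nonneg_left hterm (by positivity)
    _ = Real.exp (4 * t ^ 2 + 4) * ((k : ℝ) + n) ^ (n + 1) * hermiteWeight n k (2 * t ^ 2) := by
        rw [← mul_assoc, ← mul_assoc, ← Real.exp_add]
        congr 3
        ring
    _ ≤ _ := by
        gcongr
        nlinarith

theorem norm_rePart_sq (z : CSpace n) : ‖rePart z‖ ^ 2 = ∑ j, (z j).re ^ 2 := by
  rw [EuclideanSpace.real_norm_sq_eq]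
  rfl

theorem norm_imPart_sq (z : CSpace n) : ‖imPart z‖ ^ 2 = ∑ j, (z j).im ^ 2 := by
  rw [EuclideanSpace.real_norm_sq_eq]
  rfl

/-- A product of n one-variable Mehler bounds with weights ρ^m. Extracting a single level k costs
ρ^{-k}, which is at most exp(2kσ/(1-σ)). The parameter σ stays free, to be optimized in terms of k.
-/
theorem sum_norm_hermiteMultiC_sq_le {σ : ℝ} (h0 : 0 < σ) (h1 : σ < 1) (z : CSpace n) (k : ℕ) :
    ∑ γ ∈ Finset.piAntidiag (Finset.univ : Finset (Fin n)) k, ‖hermiteMultiC γ z‖ ^ 2 ≤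
      Real.exp (2 * k * σ / (1 - σ)) * (1 / σ) ^ n *
        Real.exp (-σ * ‖rePart z‖ ^ 2 + 1 / σ * ‖imPart z‖ ^ 2) := by
  -- The map σ ↦ (1-σ)/(1+σ) is an involution, so the rates in the Mehler bound with r² = ρ are
  -- exactly σ and 1/σ.
  set ρ := (1 - σ) / (1 + σ) with hρ
  have hσ1 : 0 < 1 - σ := by linarith
  have hρ0 : 0 < ρ := by positivity
  have hρ1 : ρ < 1 := by rw [hρ, div_lt_one (by positivity)]; linarith
  have hr : √ρ ^ 2 = ρ := Real.sq_sqrt hρ0.le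
  have hr1 : √ρ < 1 := by rw [Real.sqrt_lt' one_pos]; simpa using hρ1
  have hmul : ∀ γ ∈ Finset.piAntidiag (Finset.univ : Finset (Fin n)) k,
      ‖hermiteMultiC γ z‖ ^ 2 * ρ ^ k = ∏ j, (ρ ^ γ j * ‖hermiteFunC (γ j) (z j)‖ ^ 2) := by
    intro γ hγ
    rw [← (Finset.mem_piAntidiag.1 hγ).1, Finset.prod_mul_distrib, Finset.prod_pow_eq_pow_sum,
      hermiteMultiC, norm_prod, Finset.prod_pow, mul_comm]
  -- The level set is enlarged to a box because a sum over a box factors into one-variable sums.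
  have hsub : Finset.piAntidiag (Finset.univ : Finset (Fin n)) k ⊆
      Fintype.piFinset fun _ => Finset.range (k + 1) := by
    intro γ hγ
    rw [Fintype.mem_piFinset]
    intro j
    rw [Finset.mem_range, Nat.lt_succ_iff, ← (Finset.mem_piAntidiag.1 hγ).1]
    exact Finset.single_le_sum (fun i _ => Nat.zero_le _) (Finset.mem_univ j)
  have hle : (∑ γ ∈ Finset.piAntidiag (Finset.univ : Finset (Fin n)) k, ‖hermiteMultiC γ z‖ ^ 2) *
      ρ ^ k ≤ (1 / σ) ^ n * Real.exp (-σ * ‖rePart z‖ ^ 2 + 1 / σ * ‖imPart z‖ ^ 2) := by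
    rw [Finset.sum_mul, Finset.sum_congr rfl hmul]
    refine (Finset.sum_le_sum_of_subset_of_nonneg hsub fun γ _ _ =>
      Finset.prod_nonneg fun j _ => by positivity).trans ?_
    rw [← Finset.prod_univ_sum (fun _ => Finset.range (k + 1))
      fun j m => ρ ^ m * ‖hermiteFunC m (z j)‖ ^ 2]
    have h2 : ∀ j, ∑ m ∈ Finset.range (k + 1), ρ ^ m * ‖hermiteFunC m (z j)‖ ^ 2 ≤
        1 / σ * Real.exp (-σ * (z j).re ^ 2 + 1 / σ * (z j).im ^ 2) := by
      intro j
      have h3 := sum_pow_mul_norm_hermiteFunC_sq_le (Real.sqrt_pos.2 hρ0) hr1 (z j)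
        (Finset.range (k + 1))
      rw [hr] at h3
      have e1 : (1 - ρ) / (1 + ρ) = σ := by
        rw [hρ]
        field_simp
        ring
      have e2 : (1 + ρ) / (1 - ρ) = 1 / σ := by rw [← e1, one_div_div]
      rw [e1, e2] at h3
      refine h3.trans ?_
      gcongr
      rw [← one_div]
      gcongr
      rw [hρ, le_sub_iff_add_le, ← le_sub_iff_add_le', div_le_iff₀ (by positivity)]
      nlinarith
    refine (Finset.prod_le_prod (fun j _ => Finset.sum_nonneg fun m _ => by positivity)
      fun j _ => h2 j).trans (le_of_eq ?_)
    rw [Finset.prod_mul_distrib, Finset.prod_const, Finset.card_univ, Fintype.card_fin,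
      ← Real.exp_sum, Finset.sum_add_distrib, ← Finset.mul_sum, ← Finset.mul_sum,
      norm_rePart_sq, norm_imPart_sq]
  have hρk : 1 ≤ Real.exp (2 * k * σ / (1 - σ)) * ρ ^ k := by
    have h2 : 1 ≤ Real.exp (2 * σ / (1 - σ)) * ρ := by
      have h3 := Real.add_one_le_exp (2 * σ / (1 - σ))
      have h4 : (2 * σ / (1 - σ) + 1) * ρ = 1 := by
        rw [hρ]
        field_simp
        ring
      calc 1 = (2 * σ / (1 - σ) + 1) * ρ := h4.symm
        _ ≤ _ := mul_le_mul_of_nonneg_right h3 hρ0.le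
    have h5 : Real.exp (2 * k * σ / (1 - σ)) = Real.exp (2 * σ / (1 - σ)) ^ k := by
      rw [← Real.exp_nat_mul]
      congr 1
      ring
    rw [h5, ← mul_pow]
    exact one_le_pow₀ h2
  set Q := ∑ γ ∈ Finset.piAntidiag (Finset.univ : Finset (Fin n)) k, ‖hermiteMultiC γ z‖ ^ 2
  have hQ : 0 ≤ Q := Finset.sum_nonneg fun γ _ => sq_nonneg _
  calc Q ≤ Q * (Real.exp (2 * k * σ / (1 - σ)) * ρ ^ k) := le_mul_of_one_le_right hQ hρk
    _ = Real.exp (2 * k * σ / (1 - σ)) * (Q * ρ ^ k) := by ring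
    _ ≤ Real.exp (2 * k * σ / (1 - σ)) * ((1 / σ) ^ n *
        Real.exp (-σ * ‖rePart z‖ ^ 2 + 1 / σ * ‖imPart z‖ ^ 2)) := by gcongr
    _ = _ := by ring

/-- The entire extension of the projection of `φ` to the `k`-th eigenspace. -/
noncomputable def hermiteBlock (φ : LTwo n) (k : ℕ) (z : CSpace n) : ℂ :=
  ∑ γ ∈ Finset.piAntidiag (Finset.univ : Finset (Fin n)) k,
    inner ℂ (hermiteVec γ) φ * hermiteMultiC γ z

theorem differentiable_hermiteBlock (φ : LTwo n) (k : ℕ) : Differentiable ℂ (hermiteBlock φ k) := by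
  unfold hermiteBlock
  have h := fun γ : Fin n → ℕ => differentiable_hermiteMultiC γ
  fun_prop

theorem norm_hermiteBlock_sq_le (φ : LTwo n) (k : ℕ) (z : CSpace n) :
    ‖hermiteBlock φ k z‖ ^ 2 ≤ ‖hermiteProj k φ‖ ^ 2 *
      ∑ γ ∈ Finset.piAntidiag (Finset.univ : Finset (Fin n)) k, ‖hermiteMultiC γ z‖ ^ 2 := by
  rw [norm_hermiteProj_sq]
  refine le_trans ?_ (Finset.sum_mul_sq_le_sq_mul_sq _ _ _)
  refine pow_le_pow_left₀ (norm_nonneg _) ((norm_sum_le _ _).trans (le_of_eq ?_)) 2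
  simp only [norm_mul]

/-- Every polynomial loss is absorbed into an exponential in √(2k) of small rate. As k is of order
λ², the total degree in λ is 2(n+1) + n + 8 = 3n + 10. -/
theorem exists_pow_mul_pow_le_exp (n : ℕ) {s a : ℝ} (hs : 0 < s) (ha0 : 0 < a) :
    ∃ K : ℝ, 0 ≤ K ∧ ∀ (k : ℕ) (lam : ℝ), 0 ≤ lam → lam ^ 2 = 2 * k →
      ((k : ℝ) + n) ^ (n + 1) * (lam + 2 * s) ^ n * ((k : ℝ) + 1) ^ 4 ≤
        K * Real.exp (a * (lam + 2 * s)) := by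
  obtain ⟨N, hN⟩ : ∃ N, N = 3 * n + 10 := ⟨_, rfl⟩
  refine ⟨(N.factorial : ℝ) / a ^ N * Real.exp (a * (n + 1)), by positivity,
    fun k lam hlam0 hlam2 => ?_⟩
  set Lam := lam + 2 * s with hLam
  have hLam0 : 0 < Lam := by positivity
  set X := Lam + (n + 1) with hX
  have hX0 : 0 < X := by positivity
  have hX2 : lam ^ 2 + ((n : ℝ) + 1) ^ 2 ≤ X ^ 2 := by
    have h1 : lam + (n + 1) ≤ X := by rw [hX]; linarith
    have h2 := pow_le_pow_left₀ (by positivity) h1 2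
    have h3 := mul_nonneg hlam0 (show (0 : ℝ) ≤ n + 1 by positivity)
    linarith [add_sq lam ((n : ℝ) + 1)]
  have hn0 : (0 : ℝ) ≤ n := n.cast_nonneg
  have hk0 : (0 : ℝ) ≤ k := k.cast_nonneg
  have hn2 : (n : ℝ) + 1 ≤ ((n : ℝ) + 1) ^ 2 := by nlinarith
  have hkn : (k : ℝ) + n ≤ X ^ 2 := by linarith
  have hk1 : (k : ℝ) + 1 ≤ X ^ 2 := by linarith
  have hLX : Lam ≤ X := by rw [hX]; linarith
  have h1 : ((k : ℝ) + n) ^ (n + 1) * Lam ^ n * ((k : ℝ) + 1) ^ 4 ≤ X ^ N := by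
    calc ((k : ℝ) + n) ^ (n + 1) * Lam ^ n * ((k : ℝ) + 1) ^ 4
        ≤ (X ^ 2) ^ (n + 1) * X ^ n * (X ^ 2) ^ 4 := by gcongr
      _ = X ^ N := by
        rw [hN, ← pow_mul, ← pow_mul, ← pow_add, ← pow_add]
        congr 1
        ring
  have h2 := Real.pow_div_factorial_le_exp (a * X) (by positivity) N
  have hNf : (0 : ℝ) < N.factorial := by exact_mod_cast N.factorial_pos
  rw [div_le_iff₀ hNf, mul_pow] at h2
  have h3 : X ^ N ≤ (N.factorial : ℝ) / a ^ N * Real.exp (a * X) := by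
    rw [div_mul_eq_mul_div, le_div_iff₀ (by positivity)]
    linarith
  refine h1.trans (h3.trans (le_of_eq ?_))
  rw [mul_assoc, ← Real.exp_add, hX]
  congr 2
  ring

/-- The decay of the blocks of an element of `V_t^ω` on smaller tubes. -/
theorem exists_norm_hermiteBlock_le (hn : 0 < n) {s t : ℝ} (hs : 0 < s) (hst : s < t)
    {φ : LTwo n} (hφ : φ ∈ VOmega n t) :
    ∃ C : ℝ, 0 ≤ C ∧ ∀ (k : ℕ) (z : CSpace n), ‖imPart z‖ ≤ s →
      ‖hermiteBlock φ k z‖ ≤ C / ((k : ℝ) + 1) ^ 2 *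
        Real.exp (-(‖rePart z‖ * √(s ^ 2 - ‖imPart z‖ ^ 2))) := by
  have ht : 0 < t := hs.trans hst
  rw [mem_VOmega_iff hn ht.le] at hφ
  have hnn : ∀ k, 0 ≤ ‖hermiteProj k φ‖ ^ 2 * hermiteWeight n k (2 * t ^ 2) := fun k =>
    mul_nonneg (sq_nonneg _) (hermiteWeight_nonneg _ _ (by positivity))
  set M := ∑' k, ‖hermiteProj k φ‖ ^ 2 * hermiteWeight n k (2 * t ^ 2) with hM
  have hM0 : 0 ≤ M := tsum_nonneg hnn
  have hMk : ∀ k, ‖hermiteProj k φ‖ ^ 2 * hermiteWeight n k (2 * t ^ 2) ≤ M := fun k =>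
    hφ.le_tsum k fun j _ => hnn j
  clear_value M
  -- The gap left when the growth exp(2sΛ) of the Hermite bound meets the decay exp(-2tλ) of the
  -- projections. It pays for the polynomial factors; since Λ = λ + 2s, only the constant 4ts
  -- survives.
  set a := 2 * (t - s) with ha
  have ha0 : 0 < a := by rw [ha]; linarith
  obtain ⟨K, hK0, hK⟩ := exists_pow_mul_pow_le_exp n hs ha0
  set D := M * Real.exp (8 * t ^ 2 + 4) * (1 / s) ^ n * Real.exp (4 * t * s + 2 * s ^ 2) *
    K with hD
  have hD0 : 0 ≤ D := by positivity
  clear_value D a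
  refine ⟨√D, Real.sqrt_nonneg _, fun k z hz => ?_⟩
  set lam := √(2 * (k : ℝ)) with hlam
  have hlam0 : 0 ≤ lam := Real.sqrt_nonneg _
  have hlam2 : lam ^ 2 = 2 * k := Real.sq_sqrt (by positivity)
  set Lam := lam + 2 * s with hLam
  have hLam0 : 0 < Lam := by positivity
  -- With this choice both 2kσ/(1-σ) and s²/σ are of size s√(2k). The summand 2s in Λ keeps σ ≤ 1/2,
  -- also for k = 0.
  set σ := s / Lam with hσ
  have hσ0 : 0 < σ := by positivity
  have hσ2 : σ ≤ 1 / 2 := by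
    rw [hσ, div_le_iff₀ hLam0, hLam]
    linarith
  have hσL : σ * Lam = s := by rw [hσ]; field_simp
  set x := ‖rePart z‖ with hx
  set y := ‖imPart z‖ with hy
  have hx0 : 0 ≤ x := norm_nonneg _
  have hy0 : 0 ≤ y := norm_nonneg _
  have hw := exp_le_mul_hermiteWeight hn ht k
  have hH := sum_norm_hermiteMultiC_sq_le hσ0 (by linarith) z k
  rw [← hlam] at hw
  rw [← hx, ← hy] at hH
  clear_value σ Lam lam x y
  have hP : ‖hermiteProj k φ‖ ^ 2 * Real.exp (2 * t * lam) ≤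
      M * Real.exp (8 * t ^ 2 + 4) * ((k : ℝ) + n) ^ (n + 1) := by
    calc ‖hermiteProj k φ‖ ^ 2 * Real.exp (2 * t * lam)
        ≤ ‖hermiteProj k φ‖ ^ 2 * (Real.exp (8 * t ^ 2 + 4) * ((k : ℝ) + n) ^ (n + 1) *
          hermiteWeight n k (2 * t ^ 2)) := by gcongr
      _ = (‖hermiteProj k φ‖ ^ 2 * hermiteWeight n k (2 * t ^ 2)) *
          (Real.exp (8 * t ^ 2 + 4) * ((k : ℝ) + n) ^ (n + 1)) := by ring
      _ ≤ M * (Real.exp (8 * t ^ 2 + 4) * ((k : ℝ) + n) ^ (n + 1)) := by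
          gcongr
          exact hMk k
      _ = _ := by ring
  have hblock := norm_hermiteBlock_sq_le φ k z
  have hexp1 : 2 * k * σ / (1 - σ) ≤ s * Lam + 2 * s ^ 2 := by
    rw [div_le_iff₀ (by linarith), ← hlam2]
    have h1 : lam ^ 2 * σ ≤ Lam * s := by
      rw [← hσL]
      have : lam ^ 2 ≤ Lam ^ 2 := by
        apply pow_le_pow_left₀ hlam0
        linarith
      nlinarith
    have h2 : (s * Lam + 2 * s ^ 2) * (1 - σ) = s * Lam + s * (2 * s) * (1 - σ) - s * (σ * Lam) := by ring
    rw [h2, hσL]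
    nlinarith
  -- Since sΛ = s²/σ, the difference of the two sides is the square (σx - κ)²/σ with κ² = s² - y².
  have hbr : -(s * Lam) - σ * x ^ 2 + 1 / σ * y ^ 2 ≤ -2 * (x * √(s ^ 2 - y ^ 2)) := by
    have hsy : 0 ≤ s ^ 2 - y ^ 2 := by nlinarith
    set κ := √(s ^ 2 - y ^ 2) with hκ
    have hκ2 : κ ^ 2 = s ^ 2 - y ^ 2 := Real.sq_sqrt hsy
    have e1 : -(s * Lam) - σ * x ^ 2 + 1 / σ * y ^ 2 =
        -2 * (x * κ) - 1 / σ * (σ * x - κ) ^ 2 := by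
      have e2 : s * Lam = 1 / σ * s ^ 2 := by
        rw [hσ]
        field_simp
      rw [e2]
      have e3 : s ^ 2 = κ ^ 2 + y ^ 2 := by linarith
      rw [e3]
      field_simp
      ring
    rw [e1]
    have : 0 ≤ 1 / σ * (σ * x - κ) ^ 2 := by positivity
    linarith
  have hpoly := hK k lam hlam0 hlam2
  rw [← hLam] at hpoly
  have hfinal : ‖hermiteBlock φ k z‖ ^ 2 * ((k : ℝ) + 1) ^ 4 ≤
      D * Real.exp (-2 * (x * √(s ^ 2 - y ^ 2))) := by
    have hP' : ‖hermiteProj k φ‖ ^ 2 ≤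
        M * Real.exp (8 * t ^ 2 + 4) * ((k : ℝ) + n) ^ (n + 1) * Real.exp (-(2 * t * lam)) := by
      rw [Real.exp_neg, ← div_eq_mul_inv, le_div_iff₀ (Real.exp_pos _)]
      exact hP
    have hH' : ∑ γ ∈ Finset.piAntidiag (Finset.univ : Finset (Fin n)) k, ‖hermiteMultiC γ z‖ ^ 2 ≤
        (1 / s) ^ n * Lam ^ n * Real.exp (2 * s * Lam + 2 * s ^ 2 - 2 * (x * √(s ^ 2 - y ^ 2))) := by
      refine hH.trans ?_
      have e1 : (1 / σ) ^ n = (1 / s) ^ n * Lam ^ n := by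
        rw [hσ, ← mul_pow]
        congr 1
        field_simp
      rw [e1, mul_comm (Real.exp _), mul_assoc, ← Real.exp_add]
      gcongr
      linarith
    calc ‖hermiteBlock φ k z‖ ^ 2 * ((k : ℝ) + 1) ^ 4
        ≤ ((M * Real.exp (8 * t ^ 2 + 4) * ((k : ℝ) + n) ^ (n + 1) * Real.exp (-(2 * t * lam))) *
          ((1 / s) ^ n * Lam ^ n *
            Real.exp (2 * s * Lam + 2 * s ^ 2 - 2 * (x * √(s ^ 2 - y ^ 2))))) *
          ((k : ℝ) + 1) ^ 4 := by
          gcongr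
          refine hblock.trans ?_
          gcongr
      _ = M * Real.exp (8 * t ^ 2 + 4) * (1 / s) ^ n *
          (((k : ℝ) + n) ^ (n + 1) * Lam ^ n * ((k : ℝ) + 1) ^ 4) *
          (Real.exp (-(2 * t * lam)) *
            Real.exp (2 * s * Lam + 2 * s ^ 2 - 2 * (x * √(s ^ 2 - y ^ 2)))) := by ring
      _ ≤ M * Real.exp (8 * t ^ 2 + 4) * (1 / s) ^ n *
          (K * Real.exp (a * Lam)) *
          (Real.exp (-(2 * t * lam)) *
            Real.exp (2 * s * Lam + 2 * s ^ 2 - 2 * (x * √(s ^ 2 - y ^ 2)))) := by gcongr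
      _ = M * Real.exp (8 * t ^ 2 + 4) * (1 / s) ^ n *
          K * (Real.exp (a * Lam) *
          (Real.exp (-(2 * t * lam)) *
            Real.exp (2 * s * Lam + 2 * s ^ 2 - 2 * (x * √(s ^ 2 - y ^ 2))))) := by ring
      _ = M * Real.exp (8 * t ^ 2 + 4) * (1 / s) ^ n *
          K *
          (Real.exp (4 * t * s + 2 * s ^ 2) * Real.exp (-2 * (x * √(s ^ 2 - y ^ 2)))) := by
          rw [← Real.exp_add, ← Real.exp_add, ← Real.exp_add]
          congr 2
          rw [ha, hLam]
          ring
      _ = _ := by rw [hD]; ring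
  have hsq : (‖hermiteBlock φ k z‖ * ((k : ℝ) + 1) ^ 2) ^ 2 ≤
      (√D * Real.exp (-(x * √(s ^ 2 - y ^ 2)))) ^ 2 := by
    rw [mul_pow, mul_pow, Real.sq_sqrt hD0, ← Real.exp_nat_mul, ← pow_mul]
    refine hfinal.trans (le_of_eq ?_)
    congr 2
    push_cast
    ring
  have h1 := le_of_sq_le_sq hsq (by positivity)
  rw [div_mul_eq_mul_div, le_div_iff₀ (by positivity)]
  exact h1

/-! ### Holomorphic extension of the elements of `V_t^ω` -/

theorem continuous_imPart : Continuous (imPart (n := n)) := by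
  unfold imPart
  fun_prop

theorem imPart_toComplex (x : RSpace n) : imPart (toComplex x) = 0 := by
  ext j
  simp [imPart, toComplex]

theorem isOpen_tube (t : ℝ) : IsOpen (tube n t) :=
  isOpen_lt continuous_imPart.norm continuous_const

theorem tube_mono {s t : ℝ} (h : s ≤ t) : tube n s ⊆ tube n t := fun _ hz => lt_of_lt_of_le hz h

theorem coeFn_hermiteProj (φ : LTwo n) (k : ℕ) :
    (hermiteProj k φ : RSpace n → ℂ) =ᵐ[volume] fun x => hermiteBlock φ k (toComplex x) := by
  rw [hermiteProj_eq_sum]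
  refine (Lp.coeFn_fun_finsetSum _ _).trans ?_
  have h : ∀ γ : Fin n → ℕ, ∀ᵐ x, (inner ℂ (hermiteVec γ) φ • hermiteVec γ : LTwo n) x =
      inner ℂ (hermiteVec γ) φ * hermiteMultiC γ (toComplex x) := by
    intro γ
    filter_upwards [Lp.coeFn_smul (inner ℂ (hermiteVec γ) φ) (hermiteVec γ),
      (memLp_hermiteMulti γ).coeFn_toLp] with x h1 h2
    rw [h1, Pi.smul_apply, hermiteVec, h2, hermiteMultiC_toComplex, smul_eq_mul]
  filter_upwards [ae_all_iff.2 h] with x hx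
  exact Finset.sum_congr rfl fun γ _ => hx γ

/-- The Hermite expansion converges unconditionally, so the multi-indices may be grouped by total
degree. -/
theorem tendsto_sum_hermiteProj (φ : LTwo n) :
    Tendsto (fun K => ∑ k ∈ Finset.range K, hermiteProj k φ) atTop (𝓝 φ) := by
  have h : Tendsto (fun S : Finset (Fin n → ℕ) => ∑ α ∈ S, inner ℂ (hermiteVec α) φ • hermiteVec α)
      atTop (𝓝 φ) := by
    have := hasSum_hermiteVec φ
    rwa [HasSum, SummationFilter.unconditional_filter] at this
  have hT : Tendsto (fun K : ℕ => (Finset.range K).biUnion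
      fun k => Finset.piAntidiag (Finset.univ : Finset (Fin n)) k) atTop atTop := by
    refine tendsto_atTop_finset_of_monotone ?_ fun γ => ⟨∑ j, γ j + 1, ?_⟩
    · intro K L hKL
      exact Finset.biUnion_subset_biUnion_of_subset_left _ (Finset.range_mono hKL)
    · rw [Finset.mem_biUnion]
      exact ⟨∑ j, γ j, by simp, by simp⟩
  refine (h.comp hT).congr fun K => ?_
  rw [Function.comp_apply, Finset.sum_biUnion]
  · exact Finset.sum_congr rfl fun k _ => (hermiteProj_eq_sum k φ).symm
  · intro k _ l _ hkl
    refine Finset.disjoint_left.2 fun γ h1 h2 => hkl ?_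
    rw [← (Finset.mem_piAntidiag.1 h1).1, (Finset.mem_piAntidiag.1 h2).1]

theorem exists_seq_tendsto_hermiteBlock (φ : LTwo n) :
    ∃ ns : ℕ → ℕ, StrictMono ns ∧ ∀ᵐ x, Tendsto
      (fun i => ∑ k ∈ Finset.range (ns i), hermiteBlock φ k (toComplex x)) atTop (𝓝 (φ x)) := by
  obtain ⟨ns, hns, h⟩ :=
    (tendstoInMeasure_of_tendsto_Lp (tendsto_sum_hermiteProj φ)).exists_seq_tendsto_ae
  refine ⟨ns, hns, ?_⟩
  filter_upwards [h, ae_all_iff.2 (coeFn_hermiteProj φ),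
    ae_all_iff.2 fun i => Lp.coeFn_fun_finsetSum (Finset.range (ns i)) fun k => hermiteProj k φ]
    with x h1 h2 h3
  refine h1.congr fun i => ?_
  rw [h3]
  exact Finset.sum_congr rfl fun k _ => h2 k

theorem summable_div_add_one_sq (C : ℝ) : Summable fun k : ℕ => C / ((k : ℝ) + 1) ^ 2 := by
  have h := (summable_nat_add_iff 1).2 (Real.summable_one_div_nat_pow.2 one_lt_two)
  refine (h.mul_left C).congr fun k => ?_
  push_cast
  ring

/-- Elements of `V_t^ω` extend holomorphically to the tube `Ω_t`, with exponential decay on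
every smaller tube. -/
theorem exists_holomorphicExtension_of_mem_VOmega (hn : 0 < n) {t : ℝ} (ht : 0 < t) {φ : LTwo n}
    (hφ : φ ∈ VOmega n t) :
    ∃ F : CSpace n → ℂ, IsHolomorphicExtension φ t F ∧
      ∀ s : ℝ, 0 < s → s < t → HasTubeBound s F := by
  have key : ∀ s, 0 < s → s < t → ∃ C : ℝ, 0 ≤ C ∧ ∀ (k : ℕ) (z : CSpace n), z ∈ tube n s →
      ‖hermiteBlock φ k z‖ ≤ C / ((k : ℝ) + 1) ^ 2 *
        Real.exp (-(‖rePart z‖ * √(s ^ 2 - ‖imPart z‖ ^ 2))) := fun s hs hst => by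
    obtain ⟨C, hC, h⟩ := exists_norm_hermiteBlock_le hn hs hst hφ
    exact ⟨C, hC, fun k z hz => h k z (le_of_lt hz)⟩
  have hexp1 : ∀ (s : ℝ) (z : CSpace n),
      Real.exp (-(‖rePart z‖ * √(s ^ 2 - ‖imPart z‖ ^ 2))) ≤ 1 := fun s z =>
    Real.exp_le_one_iff.2 (neg_nonpos.2 (by positivity))
  have hunif : ∀ s, 0 < s → s < t → ∃ C : ℝ, ∀ (k : ℕ) (z : CSpace n), z ∈ tube n s →
      ‖hermiteBlock φ k z‖ ≤ C / ((k : ℝ) + 1) ^ 2 := fun s hs hst => by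
    obtain ⟨C, hC, h⟩ := key s hs hst
    exact ⟨C, fun k z hz => (h k z hz).trans (mul_le_of_le_one_right (by positivity) (hexp1 s z))⟩
  have hbd : ∀ s, 0 < s → s < t → HasTubeBound s fun z => ∑' k, hermiteBlock φ k z := by
    intro s hs hst
    obtain ⟨C, hC, h⟩ := key s hs hst
    refine ⟨∑' k : ℕ, C / ((k : ℝ) + 1) ^ 2, fun z hz => ?_⟩
    rw [← tsum_mul_right]
    exact tsum_of_norm_bounded ((summable_div_add_one_sq C).mul_right _).hasSum fun k => h k z hz
  -- Uniform bounds hold only on strictly smaller tubes, but these exhaust Ω_t, and holomorphy and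
  -- local boundedness are local.
  have hmid : ∀ z ∈ tube n t, ∃ s, 0 < s ∧ s < t ∧ z ∈ tube n s := by
    intro z hz
    have h1 : ‖imPart z‖ < t := hz
    have h2 := norm_nonneg (imPart z)
    exact ⟨(‖imPart z‖ + t) / 2, by linarith, by linarith,
      show ‖imPart z‖ < (‖imPart z‖ + t) / 2 by linarith⟩
  refine ⟨fun z => ∑' k, hermiteBlock φ k z, ⟨?_, ?_⟩, hbd⟩
  · refine AnalyticOnNhd.differentiableOn (analyticOnNhd_of_gateaux (isOpen_tube t) ?_ ?_)
    · intro z hz v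
      obtain ⟨s, hs, hst, hzs⟩ := hmid z hz
      obtain ⟨C, hC⟩ := hunif s hs hst
      have hW : IsOpen {l : ℂ | z + l • v ∈ tube n s} :=
        (isOpen_tube s).preimage (by fun_prop)
      have h0 : (0 : ℂ) ∈ {l : ℂ | z + l • v ∈ tube n s} := by simpa using hzs
      refine (Complex.differentiableOn_tsum_of_summable_norm (summable_div_add_one_sq C)
        (fun k => ?_) hW fun k l hl => hC k _ hl).differentiableAt (hW.mem_nhds h0)
      exact ((differentiable_hermiteBlock φ k).comp (by fun_prop)).differentiableOn
    · intro z hz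
      obtain ⟨s, hs, hst, hzs⟩ := hmid z hz
      obtain ⟨C, hC⟩ := hunif s hs hst
      refine ⟨∑' k : ℕ, C / ((k : ℝ) + 1) ^ 2, ?_⟩
      filter_upwards [(isOpen_tube s).mem_nhds hzs] with w hw
      exact tsum_of_norm_bounded (summable_div_add_one_sq C).hasSum fun k => hC k w hw
  · obtain ⟨ns, hns, h⟩ := exists_seq_tendsto_hermiteBlock φ
    obtain ⟨C, hC⟩ := hunif (t / 2) (by linarith) (by linarith)
    filter_upwards [h] with x hx
    have hxt : toComplex x ∈ tube n (t / 2) := by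
      change ‖imPart (toComplex x)‖ < t / 2
      rw [imPart_toComplex, norm_zero]
      linarith
    have hsum : Summable fun k => hermiteBlock φ k (toComplex x) :=
      Summable.of_norm_bounded (summable_div_add_one_sq C) fun k => hC k _ hxt
    -- A subsequence of the partial sums tends to φ almost everywhere, while all partial sums tend
    -- to the pointwise sum of the blocks.
    exact tendsto_nhds_unique hx (hsum.hasSum.tendsto_sum_nat.comp hns.tendsto_atTop)

/-! ### Exponential decay -/

theorem integrable_exp_neg_mul_norm {c : ℝ} (hc : 0 < c) :
    Integrable fun x : RSpace n => Real.exp (-(c * ‖x‖)) := by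
  have h := integrable_one_add_norm (E := RSpace n) (μ := volume) (r := (n : ℝ) + 1) (by simp)
  refine (h.const_mul (((n + 1).factorial : ℝ) / c ^ (n + 1) * Real.exp c)).mono'
    (by fun_prop) (Eventually.of_forall fun x => ?_)
  rw [Real.norm_of_nonneg (Real.exp_nonneg _)]
  have h1 := Real.pow_div_factorial_le_exp (c * (1 + ‖x‖)) (by positivity) (n + 1)
  have h0 : (0 : ℝ) < 1 + ‖x‖ := by positivity
  have hf : (0 : ℝ) < (n + 1).factorial := by positivity
  have e : (1 + ‖x‖) ^ (-((n : ℝ) + 1)) = ((1 + ‖x‖) ^ (n + 1))⁻¹ := by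
    rw [Real.rpow_neg h0.le, ← Nat.cast_succ, Real.rpow_natCast]
  rw [e, ← div_eq_mul_inv, le_div_iff₀ (by positivity), Real.exp_neg, inv_mul_le_iff₀ (Real.exp_pos _)]
  rw [div_le_iff₀ hf, mul_pow, mul_add, mul_one, Real.exp_add] at h1
  rw [mul_comm (Real.exp (c * ‖x‖)), mul_assoc, div_mul_eq_mul_div, le_div_iff₀ (by positivity)]
  linarith

theorem memLp_exp_neg_mul_norm {c : ℝ} (hc : 0 < c) :
    MemLp (fun x : RSpace n => Real.exp (-(c * ‖x‖))) 2 volume := by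
  rw [memLp_two_iff_integrable_sq_norm (by fun_prop)]
  refine (integrable_exp_neg_mul_norm (show 0 < 2 * c by linarith)).congr
    (Eventually.of_forall fun x => ?_)
  simp only [Real.norm_of_nonneg (Real.exp_nonneg _)]
  rw [← Real.exp_nat_mul]
  congr 1
  push_cast
  ring

theorem norm_rePart_le (z : CSpace n) : ‖rePart z‖ ≤ ‖z‖ := by
  refine le_of_sq_le_sq ?_ (norm_nonneg _)
  rw [norm_rePart_sq, EuclideanSpace.norm_sq_eq]
  exact Finset.sum_le_sum fun j _ => sq_le_sq' (neg_le_of_abs_le (Complex.abs_re_le_norm _))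
    (le_of_abs_le (Complex.abs_re_le_norm _))

theorem norm_imPart_le (z : CSpace n) : ‖imPart z‖ ≤ ‖z‖ := by
  refine le_of_sq_le_sq ?_ (norm_nonneg _)
  rw [norm_imPart_sq, EuclideanSpace.norm_sq_eq]
  exact Finset.sum_le_sum fun j _ => sq_le_sq' (neg_le_of_abs_le (Complex.abs_im_le_norm _))
    (le_of_abs_le (Complex.abs_im_le_norm _))

theorem norm_sq_eq_rePart_add_imPart (z : CSpace n) :
    ‖z‖ ^ 2 = ‖rePart z‖ ^ 2 + ‖imPart z‖ ^ 2 := by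
  rw [norm_rePart_sq, norm_imPart_sq, EuclideanSpace.norm_sq_eq, ← Finset.sum_add_distrib]
  refine Finset.sum_congr rfl fun j _ => ?_
  rw [Complex.sq_norm, Complex.normSq_apply]
  ring

theorem rePart_add (z w : CSpace n) : rePart (z + w) = rePart z + rePart w := by
  ext j
  simp [rePart]

theorem imPart_add (z w : CSpace n) : imPart (z + w) = imPart z + imPart w := by
  ext j
  simp [imPart]

theorem rePart_toComplex (x : RSpace n) : rePart (toComplex x) = x := by
  ext j
  simp [rePart, toComplex]

theorem norm_toComplex (x : RSpace n) : ‖toComplex x‖ = ‖x‖ := by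
  refine le_antisymm (le_of_sq_le_sq ?_ (norm_nonneg _)) ?_
  · rw [norm_sq_eq_rePart_add_imPart, rePart_toComplex, imPart_toComplex]
    simp
  · simpa [rePart_toComplex] using norm_rePart_le (toComplex x)

theorem continuous_toComplex : Continuous (toComplex (n := n)) := by
  unfold toComplex
  fun_prop

theorem norm_sum_mul_le (z w : CSpace n) : ‖∑ j, z j * w j‖ ≤ ‖z‖ * ‖w‖ := by
  rw [EuclideanSpace.norm_eq, EuclideanSpace.norm_eq]
  refine (norm_sum_le _ _).trans ?_
  simp only [norm_mul]
  exact Real.sum_mul_le_sqrt_mul_sqrt _ _ _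

/-- Hermite functions decay faster than every exponential, uniformly in bounded complex shifts. -/
theorem exists_norm_hermiteMultiC_le (α : Fin n → ℕ) {c : ℝ} (hc : 0 ≤ c) (R : ℝ) :
    ∃ K : ℝ, 0 ≤ K ∧ ∀ (x : RSpace n) (w : CSpace n), ‖w‖ ≤ R →
      ‖hermiteMultiC α (toComplex x + w)‖ ≤ K * Real.exp (-(c * ‖x‖)) := by
  set k := ∑ j, α j with hk
  -- The constant of the level-k bound at σ = 1/2. Any fixed σ would give Gaussian decay, which
  -- beats every exponential.
  set A : ℝ := Real.exp (2 * k * (1 / 2) / (1 - 1 / 2)) * (1 / (1 / 2)) ^ n with hA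
  have hA0 : 0 ≤ A := by positivity
  refine ⟨√(A * Real.exp (2 * c * R + 2 * c ^ 2 + 2 * R ^ 2)), Real.sqrt_nonneg _,
    fun x w hw => ?_⟩
  have hR : 0 ≤ R := (norm_nonneg w).trans hw
  have h1 := sum_norm_hermiteMultiC_sq_le (show (0 : ℝ) < 1 / 2 by norm_num) (by norm_num)
    (toComplex x + w) k
  have hα : α ∈ Finset.piAntidiag (Finset.univ : Finset (Fin n)) k := by simp [hk]
  have h2 := (Finset.single_le_sum (f := fun γ => ‖hermiteMultiC γ (toComplex x + w)‖ ^ 2)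
    (fun γ _ => sq_nonneg _) hα).trans h1
  rw [← hA, rePart_add, imPart_add, rePart_toComplex, imPart_toComplex, zero_add] at h2
  have h3 : ‖imPart w‖ ≤ R := (norm_imPart_le w).trans hw
  have h4 : ‖x‖ - R ≤ ‖x + rePart w‖ := by
    have h5 : ‖x‖ ≤ ‖x + rePart w‖ + ‖rePart w‖ := by
      simpa using norm_sub_le (x + rePart w) (rePart w)
    have h6 := (norm_rePart_le w).trans hw
    linarith
  refine le_of_sq_le_sq (h2.trans ?_) (by positivity)
  rw [mul_pow, Real.sq_sqrt (by positivity), ← Real.exp_nat_mul, mul_assoc A, ← Real.exp_add]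
  refine mul_le_mul_of_nonneg_left (Real.exp_le_exp.2 ?_) hA0
  have h7 : ‖imPart w‖ ^ 2 ≤ R ^ 2 := pow_le_pow_left₀ (norm_nonneg _) h3 2
  have h8 := sq_nonneg (‖x + rePart w‖ - 2 * c)
  have h9 := mul_le_mul_of_nonneg_left h4 hc
  push_cast
  norm_num
  nlinarith

/-! ### Shift of contours -/

/-- The real axis accumulates at 0, so identities on it feed the identity theorem. -/
theorem frequently_ofReal_nhdsNE {p : ℂ → Prop} (h : ∀ r : ℝ, p r) : ∃ᶠ z in 𝓝[≠] (0 : ℂ), p z := by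
  have h1 : Tendsto (fun r : ℝ => (r : ℂ)) (𝓝[≠] 0) (𝓝[≠] 0) := by
    refine tendsto_nhdsWithin_iff.2 ⟨?_, ?_⟩
    · exact (Complex.continuous_ofReal.tendsto' 0 0 (by simp)).mono_left nhdsWithin_le_nhds
    · filter_upwards [self_mem_nhdsWithin] with r hr
      simpa using hr
  exact h1.frequently (Eventually.of_forall h).frequently

/-- The integral of a holomorphic function over a real subspace does not change under imaginary
translations. -/
theorem integral_add_imaginary {t : ℝ} {Ψ : CSpace n → ℂ} (hΨ : DifferentiableOn ℂ Ψ (tube n t))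
    (hdec : ∀ R : ℝ, ∃ g : RSpace n → ℝ, Integrable g ∧ ∀ (x : RSpace n) (w : CSpace n), ‖w‖ ≤ R →
      ‖imPart w‖ < t → ‖Ψ (toComplex x + w)‖ ≤ g x) {b : RSpace n} (hb : ‖b‖ < t) :
    ∫ x, Ψ (toComplex x + Complex.I • toComplex b) = ∫ x, Ψ (toComplex x) := by
  have him : ∀ l : ℂ, imPart (l • toComplex b) = l.im • b := by
    intro l
    ext j
    simp [imPart, toComplex]
  -- On this strip of complex translation parameters the integral is holomorphic. It is constant on
  -- the real axis by translation invariance, hence constant, in particular at l = i.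
  set U : Set ℂ := {l | |l.im| * ‖b‖ < t} with hU
  have hmem : ∀ (x : RSpace n) (l : ℂ), l ∈ U → toComplex x + l • toComplex b ∈ tube n t := by
    intro x l hl
    change ‖imPart _‖ < t
    rw [imPart_add, imPart_toComplex, zero_add, him, norm_smul]
    exact hl
  have hUo : IsOpen U := isOpen_lt (by fun_prop) continuous_const
  have hUc : Convex ℝ U := by
    intro l hl m hm p q hp hq hpq
    have hl' : |l.im| * ‖b‖ < t := hl
    have hm' : |m.im| * ‖b‖ < t := hm
    change |(p • l + q • m).im| * ‖b‖ < t
    have e : (p • l + q • m).im = p * l.im + q * m.im := by simp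
    have h1 : |p * l.im + q * m.im| ≤ p * |l.im| + q * |m.im| := by
      refine (abs_add_le _ _).trans ?_
      rw [abs_mul, abs_mul, abs_of_nonneg hp, abs_of_nonneg hq]
    rw [e]
    have h2 := mul_le_mul_of_nonneg_right h1 (norm_nonneg b)
    have h3 : p * (|l.im| * ‖b‖) + q * (|m.im| * ‖b‖) < t := by
      rcases eq_or_lt_of_le hp with h0 | h0
      · rw [← h0] at hpq ⊢
        have : q = 1 := by linarith
        rw [this]
        linarith
      · have h4 := mul_lt_mul_of_pos_left hl' h0
        have h5 := mul_le_mul_of_nonneg_left hm'.le hq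
        have h6 : p * t + q * t = t := by rw [← add_mul, hpq, one_mul]
        linarith
    linarith
  have hH : DifferentiableOn ℂ (fun l : ℂ => ∫ x, Ψ (toComplex x + l • toComplex b)) U := by
    refine differentiableOn_integral_of_dominated hUo (fun l hl => ?_) (fun x => ?_) fun l hl => ?_
    · refine Continuous.aestronglyMeasurable ?_
      refine hΨ.continuousOn.comp_continuous ?_ fun x => hmem x l hl
      exact continuous_toComplex.add continuous_const
    · exact hΨ.comp (by fun_prop) fun l hl => hmem x l hl
    · obtain ⟨g, hg, hgb⟩ := hdec ((‖l‖ + 1) * ‖b‖)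
      refine ⟨g, hg, ?_⟩
      filter_upwards [hUo.mem_nhds hl, Metric.ball_mem_nhds l one_pos] with m hm hml x
      refine hgb x _ ?_ ?_
      · rw [norm_smul, norm_toComplex]
        refine mul_le_mul_of_nonneg_right ?_ (norm_nonneg b)
        have h1 : ‖m - l‖ < 1 := by simpa [dist_eq_norm] using hml
        have h2 := norm_sub_norm_le m l
        linarith
      · rw [him, norm_smul]
        exact hm
  have h0 : (0 : ℂ) ∈ U := by
    change |(0 : ℂ).im| * ‖b‖ < t
    simpa using (norm_nonneg b).trans_lt hb
  have hreal : ∀ r : ℝ, ∫ x, Ψ (toComplex x + (r : ℂ) • toComplex b) = ∫ x, Ψ (toComplex x) := by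
    intro r
    rw [← integral_add_right_eq_self (fun x => Ψ (toComplex x)) (r • b)]
    refine integral_congr_ae (Eventually.of_forall fun x => congrArg Ψ ?_)
    ext j
    simp [toComplex]
  have hI : Complex.I ∈ U := by
    change |Complex.I.im| * ‖b‖ < t
    simpa using hb
  exact (hH.analyticOnNhd hUo).eqOn_of_preconnected_of_frequently_eq
    (g := fun _ => ∫ x, Ψ (toComplex x)) analyticOnNhd_const hUc.isPreconnected h0
    (frequently_ofReal_nhdsNE hreal) hI

/-- Cauchy–Schwarz and Bessel. This is how a bound on an L² norm is converted to the dual form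
required by `mem_VOmega_of_bounded`. -/
theorem norm_sum_mul_inner_hermiteVec_le (ψ : LTwo n) (S : Finset (Fin n → ℕ))
    (d : (Fin n → ℕ) → ℂ) :
    ‖∑ α ∈ S, d α * inner ℂ (hermiteVec α) ψ‖ ≤ ‖ψ‖ * √(∑ α ∈ S, ‖d α‖ ^ 2) := by
  refine (norm_sum_le _ _).trans ?_
  simp only [norm_mul]
  refine (Real.sum_mul_le_sqrt_mul_sqrt _ _ _).trans ?_
  rw [mul_comm]
  refine mul_le_mul_of_nonneg_right ?_ (Real.sqrt_nonneg _)
  exact Real.sqrt_le_left (norm_nonneg _) |>.2 (orthonormal_hermiteVec.sum_inner_products_le ψ)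

/-- The annihilation group moves from the Hermite functions to the holomorphic extension. -/
theorem integral_mul_creationFun {t : ℝ} {φ : LTwo n} {F : CSpace n → ℂ}
    (hF : IsHolomorphicExtension φ t F) {C : ℝ} (hC : ∀ z ∈ tube n t, ‖F z‖ ≤ C)
    {ζ : CSpace n} (hζ : ζ ∈ tube n t) (α : Fin n → ℕ) :
    ∫ x, (φ : RSpace n → ℂ) x * creationFun ζ α x =
      ∫ x, (F (toComplex x + ζ) * Complex.exp ((∑ j, ζ j * x j) + (∑ j, ζ j ^ 2) / 2)) *
        hermiteMulti α x := by
  -- The integrand continued to the tube. Translating by ζ puts the Hermite factor back on real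
  -- points: the imaginary part of ζ is a contour shift, the real part a change of variables.
  set Ψ : CSpace n → ℂ := fun z => F z *
    (Complex.exp ((∑ j, ζ j * z j) - (∑ j, ζ j ^ 2) / 2) * hermiteMultiC α (z - ζ)) with hΨ
  have ht : 0 < t := (norm_nonneg _).trans_lt hζ
  have hC0 : 0 ≤ C := (norm_nonneg _).trans (hC (toComplex 0) (by
    change ‖imPart (toComplex 0)‖ < t
    rwa [imPart_toComplex, norm_zero]))
  have hd : DifferentiableOn ℂ Ψ (tube n t) := by
    refine hF.1.mul (Differentiable.differentiableOn ?_)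
    have h := differentiable_hermiteMultiC α
    exact Differentiable.mul (by fun_prop) (h.comp (by fun_prop))
  have hdec : ∀ R : ℝ, ∃ g : RSpace n → ℝ, Integrable g ∧ ∀ (x : RSpace n) (w : CSpace n), ‖w‖ ≤ R →
      ‖imPart w‖ < t → ‖Ψ (toComplex x + w)‖ ≤ g x := by
    intro R
    obtain ⟨K, hK0, hK⟩ := exists_norm_hermiteMultiC_le α (c := ‖ζ‖ + 1) (by positivity) (R + ‖ζ‖)
    refine ⟨fun x => C * (Real.exp (‖ζ‖ * R + ‖∑ j, ζ j ^ 2‖) * K) * Real.exp (-(1 * ‖x‖)),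
      (integrable_exp_neg_mul_norm one_pos).const_mul _, fun x w hw hwt => ?_⟩
    have h1 : ‖F (toComplex x + w)‖ ≤ C := by
      refine hC _ ?_
      change ‖imPart _‖ < t
      rwa [imPart_add, imPart_toComplex, zero_add]
    have h2 : ‖hermiteMultiC α (toComplex x + w - ζ)‖ ≤ K * Real.exp (-((‖ζ‖ + 1) * ‖x‖)) := by
      rw [add_sub_assoc]
      exact hK x _ ((norm_sub_le _ _).trans (by linarith))
    have h3 : ‖Complex.exp ((∑ j, ζ j * (toComplex x + w) j) - (∑ j, ζ j ^ 2) / 2)‖ ≤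
        Real.exp (‖ζ‖ * ‖x‖ + (‖ζ‖ * R + ‖∑ j, ζ j ^ 2‖)) := by
      refine (Complex.norm_exp_le_exp_norm _).trans (Real.exp_le_exp.2 ?_)
      refine (norm_sub_le _ _).trans ?_
      have h4 := norm_sum_mul_le ζ (toComplex x + w)
      have h5 : ‖toComplex x + w‖ ≤ ‖x‖ + R := by
        refine (norm_add_le _ _).trans ?_
        rw [norm_toComplex]
        linarith
      have h6 := mul_le_mul_of_nonneg_left h5 (norm_nonneg ζ)
      have h7 : ‖(∑ j, ζ j ^ 2) / 2‖ ≤ ‖∑ j, ζ j ^ 2‖ := by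
        rw [norm_div]
        exact div_le_self (norm_nonneg _) (by norm_num)
      linarith
    calc ‖Ψ (toComplex x + w)‖ ≤ C * (Real.exp (‖ζ‖ * ‖x‖ + (‖ζ‖ * R + ‖∑ j, ζ j ^ 2‖)) *
          (K * Real.exp (-((‖ζ‖ + 1) * ‖x‖)))) := by
          rw [hΨ, norm_mul, norm_mul]
          gcongr
      _ = C * (Real.exp (‖ζ‖ * R + ‖∑ j, ζ j ^ 2‖) * K) *
          (Real.exp (‖ζ‖ * ‖x‖) * Real.exp (-((‖ζ‖ + 1) * ‖x‖))) := by
          rw [Real.exp_add]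
          ring
      _ = _ := by
          rw [← Real.exp_add]
          congr 2
          ring
  have hζ' : ∀ x, toComplex (x + rePart ζ) + Complex.I • toComplex (imPart ζ) = toComplex x + ζ := by
    intro x
    ext j
    simp only [toComplex, rePart, imPart, PiLp.add_apply, PiLp.smul_apply, smul_eq_mul,
      Complex.ofReal_add]
    rw [add_assoc, mul_comm Complex.I, Complex.re_add_im]
  calc ∫ x, (φ : RSpace n → ℂ) x * creationFun ζ α x = ∫ x, Ψ (toComplex x) := by
        refine integral_congr_ae ?_
        filter_upwards [hF.2] with x hx
        rw [hx, hΨ, creationFun]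
        rfl
    _ = ∫ x, Ψ (toComplex x + Complex.I • toComplex (imPart ζ)) :=
        (integral_add_imaginary hd hdec hζ).symm
    _ = ∫ x, Ψ (toComplex (x + rePart ζ) + Complex.I • toComplex (imPart ζ)) :=
        (integral_add_right_eq_self
          (fun x => Ψ (toComplex x + Complex.I • toComplex (imPart ζ))) (rePart ζ)).symm
    _ = _ := by
        refine integral_congr_ae (Eventually.of_forall fun x => ?_)
        simp only [hζ', hΨ]
        rw [add_sub_cancel_right, hermiteMultiC_toComplex, mul_assoc]
        congr 3
        simp only [PiLp.add_apply, mul_add, Finset.sum_add_distrib, toComplex]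
        rw [show ∑ j, ζ j * ζ j = ∑ j, ζ j ^ 2 from Finset.sum_congr rfl fun j _ => (sq _).symm]
        ring

/-- With κ = √(t² - b²), the product (κ - a)(κ + a) is at least t² - r², and κ + a ≤ 2t. Applied to
a = |Re ζ| and b = |Im ζ|, it shows that the decay of F beats the growth of exp(ζ·x) with room to
spare. -/
theorem div_add_le_sqrt {a b r t : ℝ} (ha : 0 ≤ a) (hr : 0 < r) (hrt : r < t)
    (hab : a ^ 2 + b ^ 2 ≤ r ^ 2) : (t ^ 2 - r ^ 2) / (2 * t) + a ≤ √(t ^ 2 - b ^ 2) := by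
  have ht : 0 < t := hr.trans hrt
  have h2 : a ≤ t := by
    have : a ^ 2 ≤ r ^ 2 := by linarith [sq_nonneg b]
    have := le_of_sq_le_sq this hr.le
    linarith
  have hrt2 : r ^ 2 < t ^ 2 := pow_lt_pow_left₀ hrt hr.le two_ne_zero
  have hκ2 : √(t ^ 2 - b ^ 2) ^ 2 = t ^ 2 - b ^ 2 := Real.sq_sqrt (by linarith [sq_nonneg a])
  have hκ0 : 0 ≤ √(t ^ 2 - b ^ 2) := Real.sqrt_nonneg _
  generalize √(t ^ 2 - b ^ 2) = κ at *
  have hκt : κ ≤ t := le_of_sq_le_sq (by linarith [sq_nonneg b]) ht.le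
  have h3 : t ^ 2 - r ^ 2 ≤ (κ - a) * (κ + a) := by linarith [sq_sub_sq κ a]
  have h4 : 0 < κ - a := by
    by_contra hneg
    nlinarith
  have h5 : (t ^ 2 - r ^ 2) / (2 * t) ≤ κ - a := by
    rw [div_le_iff₀ (by linarith)]
    nlinarith
  linarith

/-- A function with a holomorphic extension of exponential decay on `Ω_t` belongs to `V_s^ω` for
all smaller `s`. -/
theorem mem_VOmega_of_hasTubeBound (hn : 0 < n) {s t : ℝ} (hs : 0 < s) (hst : s < t) {φ : LTwo n}
    {F : CSpace n → ℂ} (hF : IsHolomorphicExtension φ t F) (hb : HasTubeBound t F) :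
    φ ∈ VOmega n s := by
  obtain ⟨C, hC⟩ := hb
  have ht : 0 < t := hs.trans hst
  have hC0 : 0 ≤ C := by
    have h0 : toComplex (0 : RSpace n) ∈ tube n t := by
      change ‖imPart (toComplex 0)‖ < t
      rwa [imPart_toComplex, norm_zero]
    exact nonneg_of_mul_nonneg_left ((norm_nonneg _).trans (hC _ h0)) (Real.exp_pos _)
  have hC' : ∀ z ∈ tube n t, ‖F z‖ ≤ C := fun z hz => (hC z hz).trans
    (mul_le_of_le_one_right hC0 (Real.exp_le_one_iff.2 (neg_nonpos.2 (by positivity))))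
  -- Both gaps are used: t - r leaves an exponential decay of rate δ for all ‖ζ‖ ≤ r, and r - s is
  -- consumed by the Cauchy estimates.
  obtain ⟨r, hsr, hrt⟩ := exists_between hst
  have hr : 0 < r := hs.trans hsr
  set δ := (t ^ 2 - r ^ 2) / (2 * t) with hδ
  have hδ0 : 0 < δ := div_pos (by nlinarith) (by linarith)
  clear_value δ
  have hbL : MemLp (fun x : RSpace n => C * Real.exp (-(δ * ‖x‖))) 2 volume :=
    (memLp_exp_neg_mul_norm hδ0).const_mul C
  refine mem_VOmega_of_bounded hn φ hs hsr
    (M := (eLpNorm (fun x : RSpace n => C * Real.exp (-(δ * ‖x‖))) 2 volume).toReal)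
    fun ζ hζ S d => ?_
  have hζt : ζ ∈ tube n t := by
    change ‖imPart ζ‖ < t
    have := le_of_sq_le_sq hζ hr.le
    linarith [norm_imPart_le ζ]
  set ψ : RSpace n → ℂ := fun x =>
    F (toComplex x + ζ) * Complex.exp ((∑ j, ζ j * x j) + (∑ j, ζ j ^ 2) / 2) with hψ
  have hmem : ∀ x, toComplex x + ζ ∈ tube n t := by
    intro x
    change ‖imPart _‖ < t
    rwa [imPart_add, imPart_toComplex, zero_add]
  have hψc : Continuous ψ := by
    refine Continuous.mul ?_ (by fun_prop)
    exact hF.1.continuousOn.comp_continuous (continuous_toComplex.add continuous_const) hmem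
  have hψb : ∀ x, ‖ψ x‖ ≤ C * Real.exp (-(δ * ‖x + rePart ζ‖)) := by
    intro x
    have h1 := hC _ (hmem x)
    rw [rePart_add, imPart_add, rePart_toComplex, imPart_toComplex, zero_add] at h1
    set a := rePart ζ with ha
    set b := imPart ζ with hb
    have hre : ((∑ j, ζ j * x j) + (∑ j, ζ j ^ 2) / 2).re =
        inner ℝ a (x + a) - (‖a‖ ^ 2 + ‖b‖ ^ 2) / 2 := by
      rw [inner_add_right, real_inner_self_eq_norm_sq]
      have e1 : (∑ j, ζ j * (x j : ℂ)).re = inner ℝ a x := by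
        rw [Complex.re_sum, PiLp.inner_apply]
        refine Finset.sum_congr rfl fun j _ => ?_
        simp [ha, rePart, mul_comm]
      have e2 : ((∑ j, ζ j ^ 2) / 2 : ℂ).re = (‖a‖ ^ 2 - ‖b‖ ^ 2) / 2 := by
        rw [ha, hb, norm_rePart_sq, norm_imPart_sq, ← Finset.sum_sub_distrib]
        rw [show ((2 : ℂ)) = ((2 : ℝ) : ℂ) by simp, Complex.div_ofReal_re, Complex.re_sum]
        congr 1
        refine Finset.sum_congr rfl fun j _ => ?_
        rw [sq, Complex.mul_re]
        ring
      rw [Complex.add_re, e1, e2]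
      ring
    have hab : ‖a‖ ^ 2 + ‖b‖ ^ 2 ≤ r ^ 2 := by rwa [← norm_sq_eq_rePart_add_imPart]
    have hκ : δ + ‖a‖ ≤ √(t ^ 2 - ‖b‖ ^ 2) := by
      rw [hδ]
      exact div_add_le_sqrt (norm_nonneg a) hr hrt hab
    rw [hψ, norm_mul, Complex.norm_exp, hre]
    refine (mul_le_mul_of_nonneg_right h1 (Real.exp_nonneg _)).trans ?_
    rw [mul_assoc, ← Real.exp_add]
    refine mul_le_mul_of_nonneg_left (Real.exp_le_exp.2 ?_) hC0
    have h6 := real_inner_le_norm a (x + a)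
    have h7 := mul_le_mul_of_nonneg_right hκ (norm_nonneg (x + a))
    nlinarith [sq_nonneg ‖a‖, sq_nonneg ‖b‖]
  have hshift : MemLp (fun x : RSpace n => C * Real.exp (-(δ * ‖x + rePart ζ‖))) 2 volume :=
    hbL.comp_measurePreserving (measurePreserving_add_right volume (rePart ζ))
  have hψL : MemLp ψ 2 volume := hshift.of_le hψc.aestronglyMeasurable
    (Eventually.of_forall fun x => (hψb x).trans (Real.le_norm_self _))
  -- The dominating function depends on ζ only through a translation, so its L² norm is a bound
  -- independent of ζ.
  have hnorm : ‖hψL.toLp ψ‖ ≤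
      (eLpNorm (fun x : RSpace n => C * Real.exp (-(δ * ‖x‖))) 2 volume).toReal := by
    have e := eLpNorm_comp_measurePreserving (p := 2) hbL.1
      (measurePreserving_add_right volume (rePart ζ))
    rw [Function.comp_def] at e
    rw [Lp.norm_toLp, ← e]
    exact ENNReal.toReal_mono hshift.2.ne (eLpNorm_mono_real hψb)
  have hcoef : ∀ α, ∫ x, (φ : RSpace n → ℂ) x * creationFun ζ α x =
      inner ℂ (hermiteVec α) (hψL.toLp ψ) := by
    intro α
    rw [integral_mul_creationFun hF hC' hζt, inner_hermiteVec]
    refine integral_congr_ae ?_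
    filter_upwards [hψL.coeFn_toLp] with x hx
    rw [hx]
  simp only [hcoef]
  refine (norm_sum_mul_inner_hermiteVec_le _ S d).trans ?_
  exact mul_le_mul_of_nonneg_right hnorm (Real.sqrt_nonneg _)

end AnalyticVectors

/-- Complexification of a convergent power series along a small affine line. -/
theorem exists_differentiableOn_eq_of_analyticAt {E H : Type*} [NormedAddCommGroup E]
    [NormedSpace ℝ E] [NormedAddCommGroup H] [NormedSpace ℝ H] [NormedSpace ℂ H]
    [IsScalarTower ℝ ℂ H] {f : E → H} (hf : AnalyticAt ℝ f 0) :
    ∃ ρ M : ℝ, 0 < ρ ∧ 0 ≤ M ∧ ∀ v w : E, ‖v‖ ≤ ρ → ‖w‖ ≤ ρ → ∀ L : H →L[ℂ] ℂ,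
      ∃ c : ℂ → ℂ, DifferentiableOn ℂ c (ball 0 2) ∧
        (∀ μ : ℝ, |μ| < 2 → c μ = L (f (v + μ • w))) ∧ ∀ μ ∈ ball (0 : ℂ) 2, ‖c μ‖ ≤ M * ‖L‖ := by
  obtain ⟨p, r, hp⟩ := hf
  obtain ⟨δ, hδ0, hδr⟩ := ENNReal.lt_iff_exists_nnreal_btwn.1 hp.r_pos
  have hδ : (0 : ℝ) < δ := by exact_mod_cast hδ0
  have hsum : Summable fun m => ‖p m‖ * (δ : ℝ) ^ m :=
    p.summable_norm_mul_pow (hδr.trans_le hp.r_le)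
  -- In degree m there are 2^m subsets and |μ|^{|s|} ≤ 2^m, which together compensate exactly for
  -- the 4^m in (δ/4)^m. For real |μ| < 2 the point v + μw has norm at most 3δ/4.
  refine ⟨δ / 4, ∑' m, ‖p m‖ * (δ : ℝ) ^ m, by positivity, tsum_nonneg fun m => by positivity,
    fun v w hv hw L => ?_⟩
  -- Multilinear expansion of the m-th term at v + μw. As a polynomial in μ it makes sense for
  -- complex μ, although E is only a real space.
  set q : ℕ → ℂ → ℂ := fun m μ => ∑ s : Finset (Fin m),
    μ ^ s.card * L (p m (s.piecewise (fun _ => w) fun _ => v)) with hq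
  have hqb : ∀ m, ∀ μ ∈ ball (0 : ℂ) 2, ‖q m μ‖ ≤ ‖p m‖ * (δ : ℝ) ^ m * ‖L‖ := by
    intro m μ hμ
    have hμ2 : ‖μ‖ ≤ 2 := by simpa using (mem_ball_zero_iff.1 hμ).le
    have hterm : ∀ s : Finset (Fin m), ‖μ ^ s.card * L (p m (s.piecewise (fun _ => w) fun _ => v))‖ ≤
        2 ^ m * (‖L‖ * (‖p m‖ * (δ / 4) ^ m)) := by
      intro s
      rw [norm_mul, norm_pow]
      have h1 : ‖μ‖ ^ s.card ≤ 2 ^ m := by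
        refine (pow_le_pow_left₀ (norm_nonneg _) hμ2 _).trans
          (pow_le_pow_right₀ one_le_two ?_)
        simpa using s.card_le_univ
      have h2 : ‖p m (s.piecewise (fun _ => w) fun _ => v)‖ ≤ ‖p m‖ * (δ / 4) ^ m := by
        refine ((p m).le_opNorm _).trans (mul_le_mul_of_nonneg_left ?_ (norm_nonneg _))
        refine (Finset.prod_le_prod (fun i _ => norm_nonneg _) (g := fun _ => (δ / 4 : ℝ))
          fun i _ => ?_).trans (by simp [div_pow])
        by_cases hi : i ∈ s
        · rwa [Finset.piecewise_eq_of_mem _ _ _ hi]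
        · rwa [Finset.piecewise_eq_of_notMem _ _ _ hi]
      refine mul_le_mul h1 ((L.le_opNorm _).trans ?_) (norm_nonneg _) (by positivity)
      exact mul_le_mul_of_nonneg_left h2 (norm_nonneg _)
    refine (norm_sum_le _ _).trans ((Finset.sum_le_sum fun s _ => hterm s).trans (le_of_eq ?_))
    rw [Finset.sum_const, Finset.card_univ, Fintype.card_finset, Fintype.card_fin, nsmul_eq_mul,
      div_pow]
    have h4 : (4 : ℝ) ^ m = 2 ^ m * 2 ^ m := by rw [← mul_pow]; norm_num
    rw [h4]
    push_cast
    field_simp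
  have hsumL := hsum.mul_right ‖L‖
  have hLr : ∀ (a : ℝ) (y : H), L (a • y) = (a : ℂ) * L y := by
    intro a y
    rw [← algebraMap_smul ℂ a y, map_smul, smul_eq_mul]
    rfl
  refine ⟨fun μ => ∑' m, q m μ, ?_, fun μ hμ => ?_, fun μ hμ => ?_⟩
  · refine Complex.differentiableOn_tsum_of_summable_norm hsumL (fun m => ?_) isOpen_ball hqb
    refine Differentiable.differentiableOn ?_
    simp only [hq]
    fun_prop
  · have hy : v + μ • w ∈ eball (0 : E) r := by
      rw [mem_eball_zero_iff]
      refine lt_of_le_of_lt ?_ hδr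
      rw [← ofReal_norm, ← ENNReal.ofReal_coe_nnreal]
      refine ENNReal.ofReal_le_ofReal ((norm_add_le _ _).trans ?_)
      rw [norm_smul, Real.norm_eq_abs]
      have := mul_le_mul hμ.le hw (norm_nonneg _) (by norm_num)
      linarith
    have h1 := L.hasSum (hp.hasSum hy)
    rw [zero_add] at h1
    refine Eq.trans (tsum_congr fun m => ?_) h1.tsum_eq
    have h2 : (fun _ : Fin m => v + μ • w) = (fun _ => μ • w) + fun _ => v := by
      ext i
      simp [add_comm]
    have h3 : ∀ s : Finset (Fin m), p m (s.piecewise (fun _ => μ • w) fun _ => v) =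
        μ ^ s.card • p m (s.piecewise (fun _ => w) fun _ => v) := by
      intro s
      have h4 := (p m).map_piecewise_smul (fun _ => μ) (s.piecewise (fun _ => w) fun _ => v) s
      rw [Finset.prod_const] at h4
      rw [← h4]
      congr 1
      ext i
      by_cases hi : i ∈ s <;> simp [hi]
    rw [h2, ContinuousMultilinearMap.map_add_univ, map_sum]
    refine Finset.sum_congr rfl fun s _ => ?_
    rw [h3, hLr]
    push_cast
    rfl
  · rw [← tsum_mul_right]
    exact tsum_of_norm_bounded hsumL.hasSum fun m => hqb m μ hμ

namespace AnalyticVectors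

variable {n : ℕ}

/-! ### Analytic vectors have holomorphic extensions -/

/-- The transpose of `π(X, U, 0)`, for complex `X` and `U`, applied to a Hermite function. -/
noncomputable def heisenbergFun (X U : CSpace n) (α : Fin n → ℕ) (x : RSpace n) : ℂ :=
  Complex.exp (Complex.I * ((∑ j, X j * x j) - (∑ j, X j * U j) / 2)) *
    hermiteMultiC α (toComplex x - U)

/-- The bridge between the group and the ladder operators: at this complex group element only
creation operators remain in the exponent. -/
theorem heisenbergFun_neg_I_smul (ζ : CSpace n) (α : Fin n → ℕ) (x : RSpace n) :
    heisenbergFun (-Complex.I • ζ) ζ α x = creationFun ζ α x := by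
  rw [heisenbergFun, creationFun]
  congr 2
  simp only [PiLp.smul_apply, smul_eq_mul, mul_assoc, ← Finset.mul_sum, ← sq]
  linear_combination (-(∑ j, ζ j * (x j : ℂ)) + (∑ j, ζ j ^ 2) / 2) * Complex.I_sq

/-- The change of variables x ↦ x + b moves the representation from φ, which has no continuation
yet, to the entire Hermite function. -/
theorem inner_hermiteVec_schrodinger (a b : RSpace n) (φ : LTwo n) (α : Fin n → ℕ) :
    inner ℂ (hermiteVec α) (schrodinger a b 0 φ) =
      ∫ x, (φ : RSpace n → ℂ) x * heisenbergFun (toComplex a) (toComplex b) α x := by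
  rw [inner_hermiteVec, ← integral_add_right_eq_self
    (fun x => (φ : RSpace n → ℂ) x * heisenbergFun (toComplex a) (toComplex b) α x) b]
  refine integral_congr_ae ?_
  filter_upwards [(memLp_schrodingerFun a b 0 φ).coeFn_toLp] with x hx
  rw [schrodinger, hx, schrodingerFun, heisenbergFun]
  have e1 : toComplex (x + b) - toComplex b = toComplex x := by
    ext j
    simp [toComplex]
  have e2 : ∀ y : RSpace n, ((inner ℝ a y : ℝ) : ℂ) = ∑ j, toComplex a j * y j := by
    intro y
    rw [PiLp.inner_apply, Complex.ofReal_sum]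
    refine Finset.sum_congr rfl fun j _ => ?_
    simp [toComplex, mul_comm]
  have e3 : ∑ j, toComplex a j * toComplex b j = ((inner ℝ a b : ℝ) : ℂ) := (e2 b).symm
  rw [e1, hermiteMultiC_toComplex, e3, ← e2, inner_add_right]
  push_cast
  rw [mul_zero, Complex.exp_zero, one_mul]
  rw [show (inner ℝ a x : ℝ) + (1 / 2 : ℂ) * (inner ℝ a b : ℝ) =
    (inner ℝ a x : ℝ) + (inner ℝ a b : ℝ) - ((inner ℝ a b : ℝ) : ℂ) / 2 by ring]
  ring

theorem differentiable_integral_mul_heisenbergFun (φ : LTwo n) (X₀ X₁ U₀ U₁ : CSpace n)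
    (α : Fin n → ℕ) :
    Differentiable ℂ fun μ : ℂ =>
      ∫ x, (φ : RSpace n → ℂ) x * heisenbergFun (X₀ + μ • X₁) (U₀ + μ • U₁) α x := by
  rw [← differentiableOn_univ]
  have hH := differentiable_hermiteMultiC α
  refine differentiableOn_integral_of_dominated isOpen_univ (fun μ _ => ?_) (fun x => ?_)
    fun μ _ => ?_
  · refine (Lp.aestronglyMeasurable φ).mul (Continuous.aestronglyMeasurable ?_)
    unfold heisenbergFun
    exact Continuous.mul (by fun_prop)
      (hH.continuous.comp (continuous_toComplex.sub continuous_const))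
  · refine Differentiable.differentiableOn (Differentiable.const_mul ?_ _)
    unfold heisenbergFun
    exact Differentiable.mul (by fun_prop) (hH.comp (by fun_prop))
  · set R := ‖μ‖ + 1 with hR
    set RX := ‖X₀‖ + R * ‖X₁‖ with hRX
    set RU := ‖U₀‖ + R * ‖U₁‖ with hRU
    have hRX0 : 0 ≤ RX := by positivity
    have hRU0 : 0 ≤ RU := by positivity
    obtain ⟨K, hK0, hK⟩ := exists_norm_hermiteMultiC_le α (c := RX + 1) (by positivity) RU
    refine ⟨fun x => ‖(φ : RSpace n → ℂ) x‖ * ((Real.exp (RX * RU) * K) * Real.exp (-(1 * ‖x‖))),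
      ?_, ?_⟩
    · exact MemLp.integrable_mul (Lp.memLp φ).norm
        ((memLp_exp_neg_mul_norm one_pos).const_mul (Real.exp (RX * RU) * K))
    · filter_upwards [ball_mem_nhds μ one_pos] with l hl x
      have hlR : ‖l‖ ≤ R := by
        have h1 : ‖l - μ‖ < 1 := by simpa [dist_eq_norm] using hl
        have h2 := norm_sub_norm_le l μ
        linarith
      have hline : ∀ Y₀ Y₁ : CSpace n, ‖Y₀ + l • Y₁‖ ≤ ‖Y₀‖ + R * ‖Y₁‖ := by
        intro Y₀ Y₁
        refine (norm_add_le _ _).trans ?_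
        rw [norm_smul]
        gcongr
      have hX := hline X₀ X₁
      have hU := hline U₀ U₁
      generalize X₀ + l • X₁ = X at hX ⊢
      generalize U₀ + l • U₁ = U at hU ⊢
      rw [← hRX] at hX
      rw [← hRU] at hU
      clear_value RX RU
      have h1 : ‖hermiteMultiC α (toComplex x - U)‖ ≤ K * Real.exp (-((RX + 1) * ‖x‖)) := by
        rw [sub_eq_add_neg]
        exact hK x _ (by rwa [norm_neg])
      have h2 : ‖Complex.exp (Complex.I * ((∑ j, X j * x j) - (∑ j, X j * U j) / 2))‖ ≤
          Real.exp (RX * ‖x‖ + RX * RU) := by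
        refine (Complex.norm_exp_le_exp_norm _).trans (Real.exp_le_exp.2 ?_)
        rw [norm_mul, Complex.norm_I, one_mul]
        refine (norm_sub_le _ _).trans (add_le_add ?_ ?_)
        · refine (norm_sum_mul_le X (toComplex x)).trans ?_
          rw [norm_toComplex]
          gcongr
        · rw [norm_div]
          refine (div_le_self (norm_nonneg _) (by norm_num)).trans
            ((norm_sum_mul_le X U).trans ?_)
          gcongr
      rw [norm_mul, heisenbergFun, norm_mul]
      refine mul_le_mul_of_nonneg_left ?_ (norm_nonneg _)
      refine (mul_le_mul h2 h1 (norm_nonneg _) (Real.exp_nonneg _)).trans (le_of_eq ?_)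
      rw [mul_comm (Real.exp (RX * RU)), mul_left_comm, ← Real.exp_add, mul_assoc, ← Real.exp_add]
      congr 2
      ring

/-- An analytic vector lies in `V_s^ω` for some `s > 0`. -/
theorem exists_mem_VOmega_of_isAnalyticVector (hn : 0 < n) {φ : LTwo n} (hφ : IsAnalyticVector φ) :
    ∃ s : ℝ, 0 < s ∧ φ ∈ VOmega n s := by
  obtain ⟨ρ, M, hρ, hM, h⟩ := exists_differentiableOn_eq_of_analyticAt (hφ 0 (mem_univ 0))
  refine ⟨ρ / 2, by positivity, mem_VOmega_of_bounded hn φ (t := ρ) (M := M) (by positivity)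
    (by linarith) fun ζ hζ S d => ?_⟩
  have hζρ := le_of_sq_le_sq hζ hρ.le
  set a := rePart ζ with ha
  set b := imPart ζ with hb
  have ha' : ‖a‖ ≤ ρ := (norm_rePart_le ζ).trans hζρ
  have hb' : ‖b‖ ≤ ρ := (norm_imPart_le ζ).trans hζρ
  set L : LTwo n →L[ℂ] ℂ := ∑ α ∈ S, d α • innerSL ℂ (hermiteVec α) with hL
  have hLa : ∀ ψ, L ψ = ∑ α ∈ S, d α * inner ℂ (hermiteVec α) ψ := by
    intro ψ
    simp [hL]
  have hLn : ‖L‖ ≤ √(∑ α ∈ S, ‖d α‖ ^ 2) := by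
    refine L.opNorm_le_bound (Real.sqrt_nonneg _) fun ψ => ?_
    rw [hLa, mul_comm]
    exact norm_sum_mul_inner_hermiteVec_le ψ S d
  -- On the line (b - μa, a + μb, 0) the parameter μ = i gives X = -iζ and U = ζ. The radius 2 of
  -- the disc leaves room for i.
  obtain ⟨c, hcd, hcr, hcb⟩ := h (b, a, 0) (-a, b, 0)
    (by simp [Prod.norm_def, ha', hb']) (by simp [Prod.norm_def, ha', hb']) L
  set A : ℂ → ℂ := fun μ => ∑ α ∈ S, d α * ∫ x, (φ : RSpace n → ℂ) x *
    heisenbergFun (toComplex b + μ • -toComplex a) (toComplex a + μ • toComplex b) α x with hA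
  have hAd : Differentiable ℂ A := Differentiable.fun_sum fun α _ =>
    (differentiable_integral_mul_heisenbergFun φ _ _ _ _ α).const_mul (d α)
  have hreal : ∀ μ : ℝ, |μ| < 2 → c μ = A μ := by
    intro μ hμ
    rw [hcr μ hμ, hLa, hA]
    refine Finset.sum_congr rfl fun α _ => ?_
    have e1 : toComplex b + (μ : ℂ) • -toComplex a = toComplex (b + μ • -a) := by
      ext j
      simp [toComplex]
    have e2 : toComplex a + (μ : ℂ) • toComplex b = toComplex (a + μ • b) := by
      ext j
      simp [toComplex]
    rw [e1, e2, ← inner_hermiteVec_schrodinger]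
    simp
  -- The continued power series and the entire matrix coefficients agree at real parameters, hence
  -- also at i.
  have hfreq : ∃ᶠ μ in 𝓝[≠] (0 : ℂ), c μ = A μ := by
    have h1 : ∃ᶠ μ in 𝓝[≠] (0 : ℂ), ‖μ‖ < 2 → c μ = A μ :=
      frequently_ofReal_nhdsNE fun r hr => hreal r (by simpa using hr)
    have h2 : ∀ᶠ μ in 𝓝[≠] (0 : ℂ), ‖μ‖ < 2 := by
      refine nhdsWithin_le_nhds ?_
      filter_upwards [ball_mem_nhds (0 : ℂ) two_pos] with μ hμ
      simpa using hμ
    exact (h1.and_eventually h2).mono fun μ hμ => hμ.1 hμ.2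
  have hI : Complex.I ∈ ball (0 : ℂ) 2 := by simp
  have heq : c Complex.I = A Complex.I :=
    (hcd.analyticOnNhd isOpen_ball).eqOn_of_preconnected_of_frequently_eq
      (hAd.differentiableOn.analyticOnNhd isOpen_ball) (convex_ball _ _).isPreconnected
      (mem_ball_self two_pos) hfreq hI
  have e1 : toComplex a + Complex.I • toComplex b = ζ := by
    ext j
    simp only [ha, hb, toComplex, rePart, imPart, PiLp.add_apply, PiLp.smul_apply, smul_eq_mul]
    rw [mul_comm Complex.I, Complex.re_add_im]
  have e2 : toComplex b + Complex.I • -toComplex a = -Complex.I • ζ := by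
    rw [← e1, smul_add, smul_smul, neg_mul, Complex.I_mul_I, neg_neg, one_smul, smul_neg, neg_smul,
      add_comm]
  have hAI : A Complex.I = ∑ α ∈ S, d α * ∫ x, (φ : RSpace n → ℂ) x * creationFun ζ α x := by
    rw [hA]
    simp only [e1, e2, heisenbergFun_neg_I_smul]
  rw [← hAI, ← heq]
  exact (hcb _ hI).trans (mul_le_mul_of_nonneg_left hLn hM)

/-- Membership in V_s^ω gives the decay estimate only on strictly smaller tubes, whence the passage
to s/2. -/
theorem exists_hasTubeBound_of_isAnalyticVector (hn : 0 < n) {φ : LTwo n}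
    (hφ : IsAnalyticVector φ) :
    ∃ t : ℝ, 0 < t ∧ ∃ F : CSpace n → ℂ, IsHolomorphicExtension φ t F ∧ HasTubeBound t F := by
  obtain ⟨s, hs, hφs⟩ := exists_mem_VOmega_of_isAnalyticVector hn hφ
  obtain ⟨F, hF, hb⟩ := exists_holomorphicExtension_of_mem_VOmega hn hs hφs
  exact ⟨s / 2, by positivity, F, ⟨hF.1.mono (tube_mono (by linarith)), hF.2⟩,
    hb (s / 2) (by positivity) (by linarith)⟩

/-! ### Holomorphic extensions of exponential decay are analytic vectors -/

/-- The complexified orbit `ξ ↦ e^{i (X·ξ + X·U/2)} F(ξ + U)`. -/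
noncomputable def orbitFun (F : CSpace n → ℂ) (p : CSpace n × CSpace n) (ξ : RSpace n) : ℂ :=
  Complex.exp (Complex.I * ((∑ j, p.1 j * ξ j) + (∑ j, p.1 j * p.2 j) / 2)) *
    F (toComplex ξ + p.2)

theorem add_mem_tube {t : ℝ} (ξ : RSpace n) {w : CSpace n} (hw : w ∈ tube n t) :
    toComplex ξ + w ∈ tube n t := by
  change ‖imPart _‖ < t
  rwa [imPart_add, imPart_toComplex, zero_add]

/-- For |Im U| < t/4 the function F decays at rate at least t/2, while |Im X| < t/4 makes the
exponential grow at rate at most t/4. The surplus t/4 yields an L² majorant that is locally uniform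
in the group parameters. -/
theorem norm_orbitFun_le {t C : ℝ} (ht : 0 < t) (hC0 : 0 ≤ C) {F : CSpace n → ℂ}
    (hC : ∀ z ∈ tube n t, ‖F z‖ ≤ C * Real.exp (-(‖rePart z‖ * √(t ^ 2 - ‖imPart z‖ ^ 2))))
    {R : ℝ} {p : CSpace n × CSpace n} (hp : p ∈ tube n (t / 4) ×ˢ tube n (t / 4))
    (hpR : ‖p‖ ≤ R) (ξ : RSpace n) :
    ‖orbitFun F p ξ‖ ≤ C * Real.exp (R * R + R * t) * Real.exp (-(t / 4 * ‖ξ‖)) := by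
  obtain ⟨X, U⟩ := p
  have hX : ‖imPart X‖ < t / 4 := hp.1
  have hU : ‖imPart U‖ < t / 4 := hp.2
  have hXR : ‖X‖ ≤ R := (norm_fst_le (X, U)).trans hpR
  have hUR : ‖U‖ ≤ R := (norm_snd_le (X, U)).trans hpR
  have hR : 0 ≤ R := (norm_nonneg X).trans hXR
  have hU' : U ∈ tube n t := hU.trans (by linarith)
  have h1 := hC _ (add_mem_tube ξ hU')
  rw [rePart_add, imPart_add, rePart_toComplex, imPart_toComplex, zero_add] at h1
  have h2 : ‖ξ‖ - R ≤ ‖ξ + rePart U‖ := by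
    have h5 : ‖ξ‖ ≤ ‖ξ + rePart U‖ + ‖rePart U‖ := by
      simpa using norm_sub_le (ξ + rePart U) (rePart U)
    have h6 := (norm_rePart_le U).trans hUR
    linarith
  have h3 : t / 2 ≤ √(t ^ 2 - ‖imPart U‖ ^ 2) := by
    refine Real.le_sqrt_of_sq_le ?_
    have := pow_le_pow_left₀ (norm_nonneg _) hU.le 2
    nlinarith
  have h4 : (‖ξ‖ - R) * (t / 2) ≤ ‖ξ + rePart U‖ * √(t ^ 2 - ‖imPart U‖ ^ 2) :=
    (mul_le_mul_of_nonneg_right h2 (by linarith)).trans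
      (mul_le_mul_of_nonneg_left h3 (norm_nonneg _))
  have h5 : ‖Complex.exp (Complex.I * ((∑ j, X j * ξ j) + (∑ j, X j * U j) / 2))‖ ≤
      Real.exp (t / 4 * ‖ξ‖ + R * R) := by
    rw [Complex.norm_exp]
    refine Real.exp_le_exp.2 ?_
    rw [mul_add, Complex.add_re]
    refine add_le_add ?_ ?_
    · have e : (Complex.I * ∑ j, X j * (ξ j : ℂ)).re = inner ℝ (-imPart X) ξ := by
        rw [Complex.I_mul_re, Complex.im_sum, inner_neg_left, PiLp.inner_apply]
        congr 1
        refine Finset.sum_congr rfl fun j _ => ?_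
        simp [imPart, mul_comm]
      rw [e]
      refine (real_inner_le_norm _ _).trans ?_
      rw [norm_neg]
      exact mul_le_mul_of_nonneg_right hX.le (norm_nonneg _)
    · refine (Complex.re_le_norm _).trans ?_
      rw [norm_mul, Complex.norm_I, one_mul, norm_div]
      refine (div_le_self (norm_nonneg _) (by norm_num)).trans ((norm_sum_mul_le X U).trans ?_)
      gcongr
  rw [orbitFun, norm_mul]
  refine (mul_le_mul h5 h1 (norm_nonneg _) (Real.exp_nonneg _)).trans ?_
  rw [mul_left_comm, mul_assoc, ← Real.exp_add, ← Real.exp_add]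
  refine mul_le_mul_of_nonneg_left (Real.exp_le_exp.2 ?_) hC0
  nlinarith

/-- The inclusion of real points as a continuous linear map. -/
noncomputable def toComplexCLM : RSpace n →L[ℝ] CSpace n where
  toFun := toComplex
  map_add' x y := by
    ext j
    simp [toComplex]
  map_smul' r x := by
    ext j
    simp [toComplex]
  cont := continuous_toComplex

theorem isAnalyticVector_of_hasTubeBound {t : ℝ} (ht : 0 < t) {φ : LTwo n} {F : CSpace n → ℂ}
    (hF : IsHolomorphicExtension φ t F) (hb : HasTubeBound t F) : IsAnalyticVector φ := by
  obtain ⟨C, hC⟩ := hb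
  have hC0 : 0 ≤ C := by
    have h0 : toComplex (0 : RSpace n) ∈ tube n t := by
      change ‖imPart (toComplex 0)‖ < t
      rwa [imPart_toComplex, norm_zero]
    exact nonneg_of_mul_nonneg_left ((norm_nonneg _).trans (hC _ h0)) (Real.exp_pos _)
  set U : Set (CSpace n × CSpace n) := tube n (t / 4) ×ˢ tube n (t / 4) with hU
  have hUo : IsOpen U := (isOpen_tube _).prod (isOpen_tube _)
  have hmem : ∀ p ∈ U, ∀ ξ : RSpace n, toComplex ξ + p.2 ∈ tube n t := fun p hp ξ =>
    add_mem_tube ξ (tube_mono (by linarith) hp.2)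
  have hL : ∀ p ∈ U, MemLp (orbitFun F p) 2 volume := by
    intro p hp
    refine ((memLp_exp_neg_mul_norm (show 0 < t / 4 by positivity)).const_mul
      (C * Real.exp (‖p‖ * ‖p‖ + ‖p‖ * t))).of_le (Continuous.aestronglyMeasurable ?_)
      (Eventually.of_forall fun ξ =>
        (norm_orbitFun_le ht hC0 hC hp le_rfl ξ).trans (Real.le_norm_self _))
    unfold orbitFun
    exact Continuous.mul (by fun_prop) (hF.1.continuousOn.comp_continuous
      (continuous_toComplex.add continuous_const) (hmem p hp))
  classical
  -- The default 0 is irrelevant, since all orbit functions over U are square integrable.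
  set G : CSpace n × CSpace n → LTwo n := fun p =>
    if h : MemLp (orbitFun F p) 2 volume then h.toLp (orbitFun F p) else 0 with hG
  have hGae : ∀ p ∈ U, G p =ᵐ[volume] orbitFun F p := by
    intro p hp
    rw [hG]
    simp only [dif_pos (hL p hp)]
    exact (hL p hp).coeFn_toLp
  have hGan : AnalyticOnNhd ℂ G U := by
    refine analyticOnNhd_Lp_of_dominated hUo hGae (fun ξ => ?_) fun p hp => ?_
    · refine DifferentiableOn.mul (Differentiable.differentiableOn (by fun_prop)) ?_
      exact hF.1.comp (by fun_prop) fun p hp => hmem p hp ξ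
    · refine ⟨_, (memLp_exp_neg_mul_norm (show 0 < t / 4 by positivity)).const_mul
        (C * Real.exp ((‖p‖ + 1) * (‖p‖ + 1) + (‖p‖ + 1) * t)), ?_⟩
      filter_upwards [hUo.mem_nhds hp, ball_mem_nhds p one_pos] with q hq hqp ξ
      refine norm_orbitFun_le ht hC0 hC hq ?_ ξ
      have h1 : ‖q - p‖ < 1 := by simpa [dist_eq_norm] using hqp
      have h2 := norm_sub_norm_le q p
      linarith
  have hreal : ∀ x u : RSpace n, (toComplex x, toComplex u) ∈ U := by
    have h0 : ∀ x : RSpace n, toComplex x ∈ tube n (t / 4) := by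
      intro x
      change ‖imPart (toComplex x)‖ < t / 4
      rw [imPart_toComplex, norm_zero]
      positivity
    exact fun x u => ⟨h0 x, h0 u⟩
  have horbit : ∀ (x u : RSpace n) (τ : ℝ), schrodinger x u τ φ =
      Complex.exp (Complex.I * (τ : ℂ)) • G (toComplex x, toComplex u) := by
    intro x u τ
    refine Lp.ext ?_
    have hφ := (measurePreserving_add_right (volume : Measure (RSpace n)) u).quasiMeasurePreserving.ae
      hF.2
    filter_upwards [(memLp_schrodingerFun x u τ φ).coeFn_toLp, hφ, hGae _ (hreal x u),
      Lp.coeFn_smul (Complex.exp (Complex.I * (τ : ℂ))) (G (toComplex x, toComplex u))]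
      with ξ h1 h2 h3 h4
    rw [h4, Pi.smul_apply, h3, schrodinger, h1, schrodingerFun, orbitFun, smul_eq_mul, h2, mul_assoc]
    have e1 : toComplex (ξ + u) = toComplex ξ + toComplex u := map_add toComplexCLM ξ u
    have e2 : ∀ y : RSpace n, ((inner ℝ x y : ℝ) : ℂ) = ∑ j, toComplex x j * y j := by
      intro y
      rw [PiLp.inner_apply, Complex.ofReal_sum]
      refine Finset.sum_congr rfl fun j _ => ?_
      simp [toComplex, mul_comm]
    have e3 : ∑ j, toComplex x j * toComplex u j = ((inner ℝ x u : ℝ) : ℂ) := (e2 u).symm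
    rw [e1]
    simp only [e3, ← e2]
    push_cast
    congr 4
    ring
  intro g _
  simp only [horbit]
  -- Real points lie in U, so the orbit map is the restriction of a holomorphic map to a real
  -- subspace, times the analytic scalar e^{iτ}.
  have hGr : AnalyticAt ℝ G (toComplex g.1, toComplex g.2.1) :=
    (hGan _ (hreal g.1 g.2.1)).restrictScalars
  let J : RSpace n × RSpace n × ℝ →L[ℝ] CSpace n × CSpace n :=
    (toComplexCLM.comp (ContinuousLinearMap.fst ℝ _ _)).prod
      (toComplexCLM.comp ((ContinuousLinearMap.fst ℝ _ _).comp (ContinuousLinearMap.snd ℝ _ _)))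
  have hJ : AnalyticAt ℝ (fun g : RSpace n × RSpace n × ℝ => G (toComplex g.1, toComplex g.2.1)) g :=
    AnalyticAt.fun_comp (g := G) (f := J) hGr (J.analyticAt g)
  let T : RSpace n × RSpace n × ℝ →L[ℝ] ℂ :=
    Complex.ofRealCLM.comp ((ContinuousLinearMap.snd ℝ _ _).comp (ContinuousLinearMap.snd ℝ _ _))
  have hT : AnalyticAt ℝ (fun g : RSpace n × RSpace n × ℝ =>
      Complex.exp (Complex.I * (g.2.2 : ℂ))) g :=
    AnalyticAt.fun_comp (g := fun z : ℂ => Complex.exp (Complex.I * z)) (f := T)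
      (AnalyticAt.restrictScalars (𝕜' := ℂ) (by fun_prop)) (T.analyticAt g)
  exact hT.smul hJ

end AnalyticVectors

/-! ### The characterization of analytic vectors. -/

theorem theorem3p3 (n : ℕ) (hn : 0 < n) (φ : AnalyticVectors.LTwo n) :
    (AnalyticVectors.IsAnalyticVector φ ↔
      ∃ t : ℝ, 0 < t ∧ ∃ F : AnalyticVectors.CSpace n → ℂ,
        AnalyticVectors.IsHolomorphicExtension φ t F ∧ AnalyticVectors.HasTubeBound t F) ∧
    (∀ t : ℝ, 0 < t → φ ∈ AnalyticVectors.VOmega n t →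
      ∃ F : AnalyticVectors.CSpace n → ℂ, AnalyticVectors.IsHolomorphicExtension φ t F ∧
        ∀ s : ℝ, 0 < s → s < t → AnalyticVectors.HasTubeBound s F) ∧
    (∀ t : ℝ, 0 < t →
      (∃ F : AnalyticVectors.CSpace n → ℂ,
        AnalyticVectors.IsHolomorphicExtension φ t F ∧ AnalyticVectors.HasTubeBound t F) →
      ∀ s : ℝ, 0 < s → s < t → φ ∈ AnalyticVectors.VOmega n s) := by
  refine ⟨⟨AnalyticVectors.exists_hasTubeBound_of_isAnalyticVector hn, ?_⟩, ?_, ?_⟩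
  · rintro ⟨t, ht, F, hF, hb⟩
    exact AnalyticVectors.isAnalyticVector_of_hasTubeBound ht hF hb
  · exact fun t ht hφ => AnalyticVectors.exists_holomorphicExtension_of_mem_VOmega hn ht hφ
  · rintro t - ⟨F, hF, hb⟩ s hs hst
    exact AnalyticVectors.mem_VOmega_of_hasTubeBound hn hs hst hF hb
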